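/- Let $\mathbb D=\mathbb H\times\mathbb H$ with coordinates $z=(z_1,z_2)$, $z_j=x_j+iy_j$, and let $dd^c=-\frac1{2\pi i}\partial\bar\partial$. For a real matrix $M=\begin{pmatrix}a&b\\c&d\end{pmatrix}$ put $$(M,M)=2\det M,\qquad R(z,M)=\frac{|a-bz_2-cz_1+dz_1z_2|^2}{2y_1y_2},\qquad D_M=\{z\in\mathbb D: R(z,M)=0\},$$ and, with $-\mathrm{Ei}(-t)=\int_1^\infty e^{-tr}\,\frac{dr}{r}$ for $t>0$, let $\xi(z,M)=-\mathrm{Ei}(-2\pi R(z,M))\,e^{-\pi(M,M)}$ be Kudla's function. Let $g_{z_j}=\begin{pmatrix}y_j^{1/2}&x_jy_j^{-1/2}\\0&y_j^{-1/2}\end{pmatrix}$ and $\begin{pmatrix}a'&b'\\c'&d'\end{pmatrix}=g_{z_1}^{-1}M\,{}^t(g_{z_2}^{-1})$. The Kudla--Millson Schwartz form is the smooth $(1,1)$-form $$\varphi_{KM}(z,M)=\Big(\big((a'+d')^2-\tfrac1{2\pi}\big)\Omega_1+(a'+d')(c'-b')\,\Omega_2+\big((c'-b')^2-\tfrac1{2\pi}\big)\Omega_3\Big)e^{-\pi(2R(z,M)+(M,M))},$$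 where $$\Omega_{1},\Omega_3=\frac1{8i}\Big(\frac{dz_1\wedge d\bar z_1}{y_1^2}+\frac{dz_2\wedge d\bar z_2}{y_2^2}\pm\frac{dz_1\wedge d\bar z_2+dz_2\wedge d\bar z_1}{y_1y_2}\Big)$$ (with $+$ for $\Omega_1$ and $-$ for $\Omega_3$) and $\Omega_2=\frac14\,\frac{dz_1\wedge d\bar z_2-dz_2\wedge d\bar z_1}{y_1y_2}$. In these coordinates the Schwartz form in Kudla's normalization is $\varphi^{\mathrm{Ku}}_{KM}:=-\varphi_{KM}$. (1) For every real $2\times2$ matrix $M\neq0$, the function $\xi(\cdot,M)$ is locally integrable on $\mathbb D$, and as currents on $\mathbb D$ $$dd^c\,\xi(z,M)+e^{-\pi(M,M)}\,\delta_{D_M}=[\varphi^{\mathrm{Ku}}_{KM}(z,M)].$$ (2) Let $m\neq0$ be an integer and $v>0$. Let $L_m$ be the set of integral $2\times 2$ matrices of determinant $m$, let $\Gamma=\mathrm{SL}_2(\mathbb Z)^2$, $X\setminus D=\Gamma\backslash\mathbb D$ (with its orbifold structure), and let $T(m)$ be the reduced divisor $\{z\in\mathbb D:\exists\,\gamma\in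 L_m,\ z_1=\gamma z_2\}$ (which is empty for $m<0$). Then the series $$\Xi(v,z,m)=\frac12\sum_{M\in L_m}-\mathrm{Ei}(-2\pi v\,R(z,M))$$ converges absolutely for every $z\in\mathbb D\setminus T(m)$, and $\Xi(v,\cdot,m)$ is a Green function for $T(m)$ on the open variety $X\setminus D$. This means: $T(m)$ and $\Xi(v,\cdot,m)$ are $\Gamma$-invariant; $\Xi(v,\cdot,m)$ is smooth on $\mathbb D\setminus T(m)$; near each point of $\mathbb D$ one has $\Xi(v,z,m)=-\log|f(z)|^2+(\text{smooth})$ off $T(m)$, with $f=0$ a reduced local holomorphic equation of $T(m)$; and $\Xi(v,\cdot,m)$ is locally integrable and there is a smooth $\Gamma$-invariant $(1,1)$-form $\omega$ on $\mathbb D$ with $dd^c[\Xi(v,\cdot,m)]+\delta_{T(m)}=[\omega]$ as currents. -/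

import Mathlib

open scoped Topology ContDiff

noncomputable section

namespace KudlaGreen

/-! ### The domain, `(1,1)`-forms and currents on `ℍ × ℍ` -/

/-- The product of two upper half planes, as an open subset of `ℂ × ℂ`. -/
def HH : Set (ℂ × ℂ) := {z | 0 < z.1.im ∧ 0 < z.2.im}

/-- A `(1,1)`-form `∑ j k, α j k dz_j ∧ dz̄_k`, given by its coefficient functions
(the index `0` stands for `z₁`, the index `1` for `z₂`). -/
abbrev Form11 : Type := Fin 2 → Fin 2 → ℂ × ℂ → ℂ

/-- The form has smooth (`C^∞` in the real sense) coefficients on `ℍ × ℍ`. -/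
def Form11.IsSmooth (α : Form11) : Prop := ∀ j k, ContDiffOn ℝ ∞ (α j k) HH

/-- Test forms: smooth `(1,1)`-forms with compact support inside `ℍ × ℍ`. -/
def Form11.IsTest (η : Form11) : Prop :=
  ∀ j k, ContDiff ℝ ∞ (η j k) ∧ HasCompactSupport (η j k) ∧ tsupport (η j k) ⊆ HH

/-- The coordinate vectors of `ℂ × ℂ`. -/
def basisVec (j : Fin 2) : ℂ × ℂ := if j = 0 then (1, 0) else (0, 1)

/-- The Wirtinger derivative `∂/∂z_j`. -/
def dZ (j : Fin 2) (h : ℂ × ℂ → ℂ) (z : ℂ × ℂ) : ℂ :=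
  (1 / 2) * (fderiv ℝ h z (basisVec j) - Complex.I * fderiv ℝ h z (Complex.I • basisVec j))

/-- The Wirtinger derivative `∂/∂z̄_j`. -/
def dZbar (j : Fin 2) (h : ℂ × ℂ → ℂ) (z : ℂ × ℂ) : ℂ :=
  (1 / 2) * (fderiv ℝ h z (basisVec j) + Complex.I * fderiv ℝ h z (Complex.I • basisVec j))

/-- The coefficient of `dz₁ ∧ dz̄₁ ∧ dz₂ ∧ dz̄₂` in `α ∧ β`. -/
def wedge (α β : Form11) (z : ℂ × ℂ) : ℂ :=
  α 0 0 z * β 1 1 z + α 1 1 z * β 0 0 z - α 0 1 z * β 1 0 z - α 1 0 z * β 0 1 z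

/-- The coefficient of `dz₁ ∧ dz̄₁ ∧ dz₂ ∧ dz̄₂` in `dd^c η`,
where `dd^c = -(1 / (2πi)) ∂∂̄ = (i / (2π)) ∂∂̄`. -/
def ddc (η : Form11) (z : ℂ × ℂ) : ℂ :=
  -(1 / (2 * Real.pi * Complex.I)) *
    (dZ 0 (dZbar 0 (η 1 1)) z + dZ 1 (dZbar 1 (η 0 0)) z
      - dZ 0 (dZbar 1 (η 1 0)) z - dZ 1 (dZbar 0 (η 0 1)) z)

/-- The integral of the top degree form `h dz₁ ∧ dz̄₁ ∧ dz₂ ∧ dz̄₂` over `ℍ × ℍ`; this form equals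
`-4 h dx₁ ∧ dy₁ ∧ dx₂ ∧ dy₂`. -/
def topIntegral (h : ℂ × ℂ → ℂ) : ℂ := ∫ z in HH, (-4 : ℂ) * h z

/-- The current `[α]` of a `(1,1)`-form: `η ↦ ∫ α ∧ η`. -/
def formCurrent (α η : Form11) : ℂ := topIntegral (wedge α η)

/-- The current `dd^c [g]` of a (locally integrable) function: `η ↦ ∫ g dd^c η`. -/
def ddcCurrent (g : ℂ × ℂ → ℝ) (η : Form11) : ℂ := topIntegral fun z => (g z : ℂ) * ddc η z

/-- Near the point `p` the set `Z` is the graph `z₁ = f(z₂)` of the holomorphic germ `f`. -/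
def IsBranch (Z : Set (ℂ × ℂ)) (p : ℂ × ℂ) (f : ℂ → ℂ) : Prop :=
  AnalyticAt ℂ f p.2 ∧ f p.2 = p.1 ∧ ∀ᶠ q in 𝓝 p, (q ∈ Z ↔ q.1 = f q.2)

/-- The current `δ_Z` of integration over the regular part of a complex curve `Z ⊆ ℍ × ℍ` none of
whose components lies in a fibre `z₂ = const`. On a local branch `z₁ = f(w), z₂ = w` the form `η`
pulls back to `(η₁₁ |f'|² + η₁₂ f' + η₂₁ conj f' + η₂₂) dw ∧ dw̄`, and `dw ∧ dw̄ = -2i du ∧ dv`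
for `w = u + iv`; the contributions of the branches over the same `w` are added up. -/
def curveCurrent (Z : Set (ℂ × ℂ)) (η : Form11) : ℂ :=
  ∫ w in {w : ℂ | 0 < w.im}, (-2 * Complex.I) *
    ∑' z₁ : {z₁ : ℂ // ∃ f, IsBranch Z (z₁, w) f},
      (let s : ℂ := deriv z₁.2.choose w
       let p : ℂ × ℂ := (z₁.1, w)
       η 0 0 p * (s * star s) + η 0 1 p * s + η 1 0 p * star s + η 1 1 p)

/-! ### Kudla's function and the Schwartz form -/

/-- `R(z, M) = |a - b z₂ - c z₁ + d z₁ z₂|² / (2 y₁ y₂)`. -/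
def R (z : ℂ × ℂ) (M : Matrix (Fin 2) (Fin 2) ℝ) : ℝ :=
  ‖(M 0 0 : ℂ) - M 0 1 * z.2 - M 1 0 * z.1 + M 1 1 * z.1 * z.2‖ ^ 2 / (2 * z.1.im * z.2.im)

/-- The quadratic form `(M, M) = 2 det M`. -/
def quad (M : Matrix (Fin 2) (Fin 2) ℝ) : ℝ := 2 * M.det

/-- `-Ei(-t) = ∫_1^∞ exp(-t r) dr / r`, for `t > 0`. -/
def negEi (t : ℝ) : ℝ := ∫ r in Set.Ioi (1 : ℝ), Real.exp (-t * r) / r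

/-- Kudla's function `ξ(z, M) = -Ei(-2π R(z, M)) exp(-π (M, M))`. -/
def xi (z : ℂ × ℂ) (M : Matrix (Fin 2) (Fin 2) ℝ) : ℝ :=
  negEi (2 * Real.pi * R z M) * Real.exp (-Real.pi * quad M)

/-- `D_M = {z ∈ ℍ × ℍ : R(z, M) = 0}`. -/
def DM (M : Matrix (Fin 2) (Fin 2) ℝ) : Set (ℂ × ℂ) := {z | z ∈ HH ∧ R z M = 0}

/-- The matrix `g_z = (y^{1/2}, x y^{-1/2}; 0, y^{-1/2})`, which maps `i` to `z = x + iy`. -/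
def gMat (z : ℂ) : Matrix (Fin 2) (Fin 2) ℝ :=
  !![Real.sqrt z.im, z.re / Real.sqrt z.im; 0, 1 / Real.sqrt z.im]

/-- The matrix `M' = (a', b'; c', d')` obtained from `M` by letting the inverse of
`(g_{z₁}, g_{z₂})` act through `M ↦ γ₁ M γ₂ᵗ`. -/
def primed (z : ℂ × ℂ) (M : Matrix (Fin 2) (Fin 2) ℝ) : Matrix (Fin 2) (Fin 2) ℝ :=
  (gMat z.1)⁻¹ * M * ((gMat z.2)⁻¹).transpose

/-- `Ω₁ = (1/8i) (dz₁dz̄₁/y₁² + dz₂dz̄₂/y₂² + (dz₁dz̄₂ + dz₂dz̄₁)/(y₁y₂))`. -/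
def Omega1 : Form11 := fun j k z =>
  1 / (8 * Complex.I) *
    (!![1 / (z.1.im : ℂ) ^ 2, 1 / ((z.1.im : ℂ) * z.2.im);
        1 / ((z.1.im : ℂ) * z.2.im), 1 / (z.2.im : ℂ) ^ 2] : Matrix (Fin 2) (Fin 2) ℂ) j k

/-- `Ω₂ = (1/4) (dz₁dz̄₂ - dz₂dz̄₁)/(y₁y₂)`. -/
def Omega2 : Form11 := fun j k z =>
  1 / 4 *
    (!![0, 1 / ((z.1.im : ℂ) * z.2.im);
        -(1 / ((z.1.im : ℂ) * z.2.im)), 0] : Matrix (Fin 2) (Fin 2) ℂ) j k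

/-- `Ω₃ = (1/8i) (dz₁dz̄₁/y₁² + dz₂dz̄₂/y₂² - (dz₁dz̄₂ + dz₂dz̄₁)/(y₁y₂))`. -/
def Omega3 : Form11 := fun j k z =>
  1 / (8 * Complex.I) *
    (!![1 / (z.1.im : ℂ) ^ 2, -(1 / ((z.1.im : ℂ) * z.2.im));
        -(1 / ((z.1.im : ℂ) * z.2.im)), 1 / (z.2.im : ℂ) ^ 2] : Matrix (Fin 2) (Fin 2) ℂ) j k

/-- The Kudla–Millson Schwartz form
`φ_KM(z, M) = (c₁' Ω₁ + c₂' Ω₂ + c₃' Ω₃) exp(-π (2 R(z, M) + (M, M)))` with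
`c₁' = (a'+d')² - 1/(2π)`, `c₂' = (a'+d')(c'-b')`, `c₃' = (c'-b')² - 1/(2π)`. -/
def phiKM (M : Matrix (Fin 2) (Fin 2) ℝ) : Form11 := fun j k z =>
  let p : ℝ := primed z M 0 0 + primed z M 1 1
  let q : ℝ := primed z M 1 0 - primed z M 0 1
  (((p ^ 2 - 1 / (2 * Real.pi) : ℝ) : ℂ) * Omega1 j k z
    + ((p * q : ℝ) : ℂ) * Omega2 j k z
    + ((q ^ 2 - 1 / (2 * Real.pi) : ℝ) : ℂ) * Omega3 j k z)
    * ((Real.exp (-Real.pi * (2 * R z M + quad M)) : ℝ) : ℂ)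

/-- The Schwartz form in Kudla's normalization, which in these coordinates on `ℍ × ℍ` is the
negative of the form `phiKM` built from the Kudla–Millson prescription. -/
def phiKudla (M : Matrix (Fin 2) (Fin 2) ℝ) : Form11 := fun j k z => -phiKM M j k z

/-! ### Hecke correspondences and Green functions on `(SL₂(ℤ) \ ℍ)²` -/

/-- Integral matrices of determinant `m`. -/
abbrev Lm (m : ℤ) : Type := {M : Matrix (Fin 2) (Fin 2) ℤ // M.det = m}

/-- The fractional linear action of an integral matrix. -/
def moeb (γ : Matrix (Fin 2) (Fin 2) ℤ) (w : ℂ) : ℂ :=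
  ((γ 0 0 : ℂ) * w + γ 0 1) / ((γ 1 0 : ℂ) * w + γ 1 1)

/-- The Hecke correspondence `T(m) = {z ∈ ℍ × ℍ : z₁ = γ z₂ for some γ of determinant m}`,
for `m ≠ 0` (empty if `m < 0`). As a divisor it is reduced. -/
def T (m : ℤ) : Set (ℂ × ℂ) := {z | z ∈ HH ∧ ∃ γ : Lm m, z.1 = moeb γ.1 z.2}

/-- The summand `-Ei(-2π v R(z, M))` of Kudla's Green function. -/
def XiTerm (v : ℝ) (z : ℂ × ℂ) (M : Matrix (Fin 2) (Fin 2) ℤ) : ℝ :=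
  negEi (2 * Real.pi * v * R z (M.map fun n : ℤ => (n : ℝ)))

/-- Kudla's Green function `Ξ(v, z, m) = (1/2) ∑_{M ∈ L_m} -Ei(-2π v R(z, M))`. -/
def Xi (v : ℝ) (m : ℤ) (z : ℂ × ℂ) : ℝ := (1 / 2) * ∑' M : Lm m, XiTerm v z M.1

/-- The action of `Γ = SL₂(ℤ) × SL₂(ℤ)` on `ℍ × ℍ`. -/
def act (γ : Fin 2 → Matrix.SpecialLinearGroup (Fin 2) ℤ) (z : ℂ × ℂ) : ℂ × ℂ :=
  (moeb (γ 0).1 z.1, moeb (γ 1).1 z.2)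

/-- The derivative `(c z_j + d)⁻²` of the `j`-th component of the action. -/
def actDeriv (γ : Fin 2 → Matrix.SpecialLinearGroup (Fin 2) ℤ) (j : Fin 2) (z : ℂ × ℂ) : ℂ :=
  1 / (((γ j).1 1 0 : ℂ) * (if j = 0 then z.1 else z.2) + ((γ j).1 1 1 : ℂ)) ^ 2

/-- A `(1,1)`-form on `ℍ × ℍ` is `Γ`-invariant, i.e. it is a form on `Γ \ (ℍ × ℍ)`. -/
def Form11.IsInvariant (α : Form11) : Prop :=
  ∀ γ, ∀ z ∈ HH, ∀ j k, α j k (act γ z) * actDeriv γ j z * star (actDeriv γ k z) = α j k z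

/-- `f = 0` is a reduced holomorphic equation of `Z` on the open set `U`: `f` vanishes exactly
on `Z`, and its differential does not vanish identically along any part of `Z`. -/
def IsReducedEquation (Z U : Set (ℂ × ℂ)) (f : ℂ × ℂ → ℂ) : Prop :=
  DifferentiableOn ℂ f U ∧ (∀ z ∈ U, f z = 0 ↔ z ∈ Z) ∧
    Z ∩ U ⊆ closure {z | z ∈ Z ∩ U ∧ fderiv ℂ f z ≠ 0}

/-- `g` is a Green function on the open variety `X ∖ D = Γ \ (ℍ × ℍ)` (as an orbifold quotient)
for the reduced divisor with the `Γ`-invariant preimage `Z ⊆ ℍ × ℍ`. Values of `g` on `Z` are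
irrelevant. -/
structure IsGreenFunction (Z : Set (ℂ × ℂ)) (g : ℂ × ℂ → ℝ) : Prop where
  /-- the divisor lives on the quotient -/
  invariant_divisor : ∀ γ, ∀ z ∈ HH, act γ z ∈ Z ↔ z ∈ Z
  /-- the function lives on the quotient -/
  invariant : ∀ γ, ∀ z ∈ HH \ Z, g (act γ z) = g z
  /-- the function is smooth away from the divisor -/
  smooth : ContDiffOn ℝ ∞ g (HH \ Z)
  /-- logarithmic singularity: `g = -log |f|² + smooth` for local equations `f` of the divisor -/
  log_singularity : ∀ z₀ ∈ HH, ∃ U ⊆ HH, IsOpen U ∧ z₀ ∈ U ∧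
    ∃ f : ℂ × ℂ → ℂ, IsReducedEquation Z U f ∧
      ∃ u : ℂ × ℂ → ℝ, ContDiffOn ℝ ∞ u U ∧ ∀ z ∈ U \ Z, g z = -Real.log (‖f z‖ ^ 2) + u z
  /-- the function defines a current -/
  locallyIntegrable : MeasureTheory.LocallyIntegrableOn g HH
  /-- `dd^c [g] + δ_Z = [α]` for a smooth form `α` on the quotient -/
  current_equation : ∃ α : Form11, α.IsSmooth ∧ α.IsInvariant ∧
    ∀ η : Form11, η.IsTest → ddcCurrent g η + curveCurrent Z η = formCurrent α η

end KudlaGreen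

end

open scoped Topology ContDiff

noncomputable section

namespace KudlaGreen

open MeasureTheory Filter Set

/-! ### Wirtinger calculus -/

/-! Write f for the polynomial a - b z₂ - c z₁ + d z₁z₂, Q for the form ∂R ∧ ∂̄R / R and H for ∂∂̄
log(y₁y₂). Since f is affine in each variable, Q is smooth even where f = 0, and ∂∂̄R = Q - R·H.
Hence ∂∂̄ of a function E(R) involves only R·E′ and E′ + R·E″.

For part (1), the logarithmic singularity is avoided by truncation. The integral ∫₁ⁿ exp(-tr) dr/r
is smooth in t down to t = 0, so its value at t = 2πrR is smooth across D_M and ordinary integration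
by parts applies. For this function t·E′ and t·E″ + E′ are combinations of exp(-t) and exp(-nt), and
dd^c of it is exactly a Schwartz form at scale r minus the one at scale nr (`dZbar_dZ_negEiTrunc`).
Now let n tend to infinity. The truncations increase to -Ei, which is locally integrable
(`integrableOn_negEi_comp_R`), and the Schwartz forms at scale nr concentrate as Gaussians
transversal to D_M with limit δ_{D_M} (`tendsto_formCurrent_schwartzForm`). This gives
`ddcCurrent_negEi_add_curveCurrent`. The identification with the Kudla–Millson form is
`phiKudla_eq`: after moving z to (i, i), the numbers a'+d' and c'-b' are the real and imaginary
parts of f(z̄₁, z₂) / √(y₁y₂).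

For part (2), the quadratic form R + det M is positive definite in M, uniformly for z in a compact
set (`exists_mul_sumSq_le`). With det M = m fixed, R therefore grows like |M|². On a compact set all
but finitely many terms have R ≥ 1, and these, with all derivatives, are dominated by a Gaussian in
the entries of M (`exists_bound_iteratedFDerivWithin_comp_R`). So the series is a finite sum plus a
smooth function. The expansion -Ei(-t) = const - log t + (entire) exhibits the singularity, and the
current equation follows by summing part (1).

The factor 1/2 identifies M with -M. What makes δ_{T(m)} the sum of the δ_{D_M} without
multiplicities is that distinct classes ±M give curves meeting in at most one point
(`subsingleton_curveMap_eq`), so the branches over almost every z₂ are distinct. Invariance comes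
from reindexing the sum by the action of Γ on L_m. -/

/-- The real linear form `p₀ dz₁ + q₀ dz̄₁ + p₁ dz₂ + q₁ dz̄₂`. -/
def wirtingerForm (p₀ q₀ p₁ q₁ : ℂ) : ℂ × ℂ →L[ℝ] ℂ :=
  p₀ • ContinuousLinearMap.fst ℝ ℂ ℂ
    + q₀ • (Complex.conjCLE : ℂ →L[ℝ] ℂ).comp (ContinuousLinearMap.fst ℝ ℂ ℂ)
    + p₁ • ContinuousLinearMap.snd ℝ ℂ ℂ
    + q₁ • (Complex.conjCLE : ℂ →L[ℝ] ℂ).comp (ContinuousLinearMap.snd ℝ ℂ ℂ)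

lemma wirtingerForm_apply (p₀ q₀ p₁ q₁ : ℂ) (v : ℂ × ℂ) :
    wirtingerForm p₀ q₀ p₁ q₁ v
      = p₀ * v.1 + q₀ * star v.1 + p₁ * v.2 + q₁ * star v.2 := by
  simp [wirtingerForm]

/-- `h` has differential `p₀ dz₁ + q₀ dz̄₁ + p₁ dz₂ + q₁ dz̄₂` at `z`. -/
def HasWirtinger (h : ℂ × ℂ → ℂ) (p₀ q₀ p₁ q₁ : ℂ) (z : ℂ × ℂ) : Prop :=
  HasFDerivAt h (wirtingerForm p₀ q₀ p₁ q₁) z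

namespace HasWirtinger

variable {h k : ℂ × ℂ → ℂ} {p₀ q₀ p₁ q₁ r₀ s₀ r₁ s₁ : ℂ} {z : ℂ × ℂ}

lemma dZ_zero (H : HasWirtinger h p₀ q₀ p₁ q₁ z) : dZ 0 h z = p₀ := by
  rw [dZ, HasFDerivAt.fderiv H, wirtingerForm_apply, wirtingerForm_apply]
  simp [basisVec]
  linear_combination (1 / 2) * (q₀ - p₀) * Complex.I_sq

lemma dZ_one (H : HasWirtinger h p₀ q₀ p₁ q₁ z) : dZ 1 h z = p₁ := by
  rw [dZ, HasFDerivAt.fderiv H, wirtingerForm_apply, wirtingerForm_apply]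
  simp [basisVec]
  linear_combination (1 / 2) * (q₁ - p₁) * Complex.I_sq

lemma dZbar_zero (H : HasWirtinger h p₀ q₀ p₁ q₁ z) : dZbar 0 h z = q₀ := by
  rw [dZbar, HasFDerivAt.fderiv H, wirtingerForm_apply, wirtingerForm_apply]
  simp [basisVec]
  linear_combination (1 / 2) * (p₀ - q₀) * Complex.I_sq

lemma dZbar_one (H : HasWirtinger h p₀ q₀ p₁ q₁ z) : dZbar 1 h z = q₁ := by
  rw [dZbar, HasFDerivAt.fderiv H, wirtingerForm_apply, wirtingerForm_apply]
  simp [basisVec]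
  linear_combination (1 / 2) * (p₁ - q₁) * Complex.I_sq

lemma const (c : ℂ) (z : ℂ × ℂ) : HasWirtinger (fun _ => c) 0 0 0 0 z := by
  have : wirtingerForm 0 0 0 0 = 0 := by ext v <;> simp [wirtingerForm_apply]
  rw [HasWirtinger, this]
  exact hasFDerivAt_const c z

lemma fst (z : ℂ × ℂ) : HasWirtinger (fun z => z.1) 1 0 0 0 z := by
  have : wirtingerForm 1 0 0 0 = ContinuousLinearMap.fst ℝ ℂ ℂ := by
    ext v <;> simp [wirtingerForm_apply]
  rw [HasWirtinger, this]
  exact hasFDerivAt_fst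

lemma snd (z : ℂ × ℂ) : HasWirtinger (fun z => z.2) 0 0 1 0 z := by
  have : wirtingerForm 0 0 1 0 = ContinuousLinearMap.snd ℝ ℂ ℂ := by
    ext v <;> simp [wirtingerForm_apply]
  rw [HasWirtinger, this]
  exact hasFDerivAt_snd

lemma star_fst (z : ℂ × ℂ) : HasWirtinger (fun z => star z.1) 0 1 0 0 z := by
  have : wirtingerForm 0 1 0 0
      = (Complex.conjCLE : ℂ →L[ℝ] ℂ).comp (ContinuousLinearMap.fst ℝ ℂ ℂ) := by
    ext v <;> simp [wirtingerForm_apply]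
  rw [HasWirtinger, this]
  exact ((Complex.conjCLE : ℂ →L[ℝ] ℂ).comp (ContinuousLinearMap.fst ℝ ℂ ℂ)).hasFDerivAt

lemma star_snd (z : ℂ × ℂ) : HasWirtinger (fun z => star z.2) 0 0 0 1 z := by
  have : wirtingerForm 0 0 0 1
      = (Complex.conjCLE : ℂ →L[ℝ] ℂ).comp (ContinuousLinearMap.snd ℝ ℂ ℂ) := by
    ext v <;> simp [wirtingerForm_apply]
  rw [HasWirtinger, this]
  exact ((Complex.conjCLE : ℂ →L[ℝ] ℂ).comp (ContinuousLinearMap.snd ℝ ℂ ℂ)).hasFDerivAt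

lemma add (H : HasWirtinger h p₀ q₀ p₁ q₁ z) (K : HasWirtinger k r₀ s₀ r₁ s₁ z) :
    HasWirtinger (fun z => h z + k z) (p₀ + r₀) (q₀ + s₀) (p₁ + r₁) (q₁ + s₁) z := by
  have : wirtingerForm (p₀ + r₀) (q₀ + s₀) (p₁ + r₁) (q₁ + s₁)
      = wirtingerForm p₀ q₀ p₁ q₁ + wirtingerForm r₀ s₀ r₁ s₁ := by
    ext v <;> simp [wirtingerForm_apply] <;> ring
  rw [HasWirtinger, this]
  exact HasFDerivAt.add H K

lemma sub (H : HasWirtinger h p₀ q₀ p₁ q₁ z) (K : HasWirtinger k r₀ s₀ r₁ s₁ z) :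
    HasWirtinger (fun z => h z - k z) (p₀ - r₀) (q₀ - s₀) (p₁ - r₁) (q₁ - s₁) z := by
  have : wirtingerForm (p₀ - r₀) (q₀ - s₀) (p₁ - r₁) (q₁ - s₁)
      = wirtingerForm p₀ q₀ p₁ q₁ - wirtingerForm r₀ s₀ r₁ s₁ := by
    ext v <;> simp [wirtingerForm_apply] <;> ring
  rw [HasWirtinger, this]
  exact HasFDerivAt.sub H K

lemma mul (H : HasWirtinger h p₀ q₀ p₁ q₁ z) (K : HasWirtinger k r₀ s₀ r₁ s₁ z) :
    HasWirtinger (fun z => h z * k z) (h z * r₀ + k z * p₀) (h z * s₀ + k z * q₀)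
      (h z * r₁ + k z * p₁) (h z * s₁ + k z * q₁) z := by
  have : wirtingerForm (h z * r₀ + k z * p₀) (h z * s₀ + k z * q₀)
      (h z * r₁ + k z * p₁) (h z * s₁ + k z * q₁)
      = h z • wirtingerForm r₀ s₀ r₁ s₁ + k z • wirtingerForm p₀ q₀ p₁ q₁ := by
    ext v <;> simp [wirtingerForm_apply] <;> ring
  rw [HasWirtinger, this]
  exact HasFDerivAt.mul H K

lemma inv (H : HasWirtinger h p₀ q₀ p₁ q₁ z) (h0 : h z ≠ 0) :
    HasWirtinger (fun z => (h z)⁻¹) (-p₀ / h z ^ 2) (-q₀ / h z ^ 2) (-p₁ / h z ^ 2)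
      (-q₁ / h z ^ 2) z := by
  have e := ((hasDerivAt_inv h0).hasFDerivAt.restrictScalars ℝ).comp z H
  refine HasFDerivAt.congr_fderiv e ?_
  ext v <;> simp [wirtingerForm_apply] <;> field_simp <;> ring

lemma congr_coeff (H : HasWirtinger h p₀ q₀ p₁ q₁ z) (e₁ : p₀ = r₀) (e₂ : q₀ = s₀) (e₃ : p₁ = r₁)
    (e₄ : q₁ = s₁) : HasWirtinger h r₀ s₀ r₁ s₁ z := by
  subst e₁ e₂ e₃ e₄; exact H

/-- Chain rule for a real function of a real function. -/
lemma comp_real {ρ : ℂ × ℂ → ℝ} (H : HasWirtinger (fun z => (ρ z : ℂ)) p₀ q₀ p₁ q₁ z)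
    {E : ℝ → ℝ} {E' : ℝ} (hE : HasDerivAt E E' (ρ z)) :
    HasWirtinger (fun z => (E (ρ z) : ℂ)) (E' * p₀) (E' * q₀) (E' * p₁) (E' * q₁) z := by
  have h1 : HasFDerivAt ρ (Complex.reCLM.comp (wirtingerForm p₀ q₀ p₁ q₁)) z := by
    simpa [Function.comp_def] using Complex.reCLM.hasFDerivAt.comp z H
  have h2 := Complex.ofRealCLM.hasFDerivAt.comp z h1
  have h3 := HasFDerivAt.unique h2 H
  have h4 := Complex.ofRealCLM.hasFDerivAt.comp z (hE.comp_hasFDerivAt z h1)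
  refine HasFDerivAt.congr_fderiv h4 ?_
  have h5 : ∀ v, ((wirtingerForm p₀ q₀ p₁ q₁ v).re : ℂ) = wirtingerForm p₀ q₀ p₁ q₁ v :=
    fun v => by simpa using congrArg (fun L => L v) h3
  ext v <;> simp [-Complex.ofReal_re, -Complex.re_add_im, h5] <;> simp [wirtingerForm_apply] <;> ring

end HasWirtinger

/-! ### Integration by parts -/

lemma isOpen_HH : IsOpen HH :=
  (isOpen_lt continuous_const (Complex.continuous_im.comp continuous_fst)).inter
    (isOpen_lt continuous_const (Complex.continuous_im.comp continuous_snd))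

lemma measurableSet_HH : MeasurableSet HH := isOpen_HH.measurableSet

/-- A function which is continuous on an open set containing the support of a compactly supported
continuous function gives a continuous product. -/
lemma continuous_mul_of_tsupport {u ψ : ℂ × ℂ → ℂ} {U : Set (ℂ × ℂ)} (hU : IsOpen U)
    (hu : ContinuousOn u U)
    (hψ : Continuous ψ) (hs : tsupport ψ ⊆ U) : Continuous fun z => u z * ψ z := by
  rw [continuous_iff_continuousAt]
  intro z
  by_cases hz : z ∈ tsupport ψ
  · exact (hu.continuousAt (hU.mem_nhds (hs hz))).mul hψ.continuousAt
  · have : (fun z => u z * ψ z) =ᶠ[𝓝 z] fun _ => 0 := by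
      filter_upwards [(isClosed_tsupport ψ).isOpen_compl.mem_nhds hz] with w hw
      simp [image_eq_zero_of_notMem_tsupport hw]
    exact this.continuousAt

lemma integrable_mul_of_tsupport {u ψ : ℂ × ℂ → ℂ} {U : Set (ℂ × ℂ)} (hU : IsOpen U)
    (hu : ContinuousOn u U)
    (hψ : Continuous ψ) (hc : HasCompactSupport ψ) (hs : tsupport ψ ⊆ U) :
    Integrable fun z => u z * ψ z :=
  (continuous_mul_of_tsupport hU hu hψ hs).integrable_of_hasCompactSupport hc.mul_left

/-- Nothing is assumed about `u` off `HH`: every product vanishes outside `tsupport ψ ⊆ HH`, so its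
regularity matters only there and there are no boundary terms. -/
lemma integral_mul_fderiv_eq_neg {u ψ : ℂ × ℂ → ℂ} (hu : ContDiffOn ℝ 1 u HH)
    (hψ : ContDiff ℝ 1 ψ) (hc : HasCompactSupport ψ) (hs : tsupport ψ ⊆ HH) (v : ℂ × ℂ) :
    ∫ z, u z * fderiv ℝ ψ z v = - ∫ z, fderiv ℝ u z v * ψ z := by
  have hd : Continuous fun z => fderiv ℝ ψ z v := (hψ.continuous_fderiv (by simp)).clm_apply
    continuous_const
  have hsub : (fun z => fderiv ℝ ψ z v).support ⊆ tsupport ψ := fun z hz => by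
    apply support_fderiv_subset ℝ
    intro h
    apply hz
    simp [h]
  have hd2 : tsupport (fun z => fderiv ℝ ψ z v) ⊆ tsupport ψ :=
    closure_minimal hsub (isClosed_tsupport ψ)
  have : (volume : Measure (ℂ × ℂ)).IsAddHaarMeasure :=
    Measure.prod.instIsAddHaarMeasure volume volume
  refine integral_mul_fderiv_eq_neg_fderiv_mul_of_integrable ?_ ?_ ?_ ?_ ?_
  · refine integrable_mul_of_tsupport isOpen_HH ?_ hψ.continuous hc hs
    exact (hu.continuousOn_fderiv_of_isOpen isOpen_HH le_rfl).clm_apply continuousOn_const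
  · exact integrable_mul_of_tsupport isOpen_HH hu.continuousOn hd
      (hc.mono' hsub) (hd2.trans hs)
  · exact integrable_mul_of_tsupport isOpen_HH hu.continuousOn hψ.continuous hc hs
  · exact fun z hz => (hu.differentiableOn (by simp)).differentiableAt
      (isOpen_HH.mem_nhds (hs hz))
  · exact fun z _ => (hψ.differentiable (by simp)).differentiableAt

/-- The common shape of the two Wirtinger derivatives `∂/∂z_j` (`σ = -1`) and `∂/∂z̄_j`
(`σ = 1`). -/
def wirtinger (σ : ℂ) (j : Fin 2) (h : ℂ × ℂ → ℂ) (z : ℂ × ℂ) : ℂ :=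
  (1 / 2) * (fderiv ℝ h z (basisVec j) + σ * Complex.I * fderiv ℝ h z (Complex.I • basisVec j))

lemma dZ_eq_wirtinger (j : Fin 2) : dZ j = wirtinger (-1) j := by
  ext h z; simp [dZ, wirtinger, sub_eq_add_neg]

lemma dZbar_eq_wirtinger (j : Fin 2) : dZbar j = wirtinger 1 j := by
  ext h z; simp [dZbar, wirtinger]

lemma contDiffOn_wirtinger {u : ℂ × ℂ → ℂ} {n m : ℕ∞} (hu : ContDiffOn ℝ m u HH)
    (hn : n + 1 ≤ m) (σ : ℂ) (j : Fin 2) : ContDiffOn ℝ n (wirtinger σ j u) HH := by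
  have h : ∀ v, ContDiffOn ℝ n (fun z => fderiv ℝ u z v) HH := fun v =>
    (hu.fderiv_of_isOpen isOpen_HH (by exact_mod_cast hn)).clm_apply contDiffOn_const
  exact contDiffOn_const.mul ((h _).add (contDiffOn_const.mul (h _)))

lemma contDiff_wirtinger {u : ℂ × ℂ → ℂ} (hu : ContDiff ℝ ∞ u) (σ : ℂ) (j : Fin 2) :
    ContDiff ℝ ∞ (wirtinger σ j u) := by
  have h : ∀ v, ContDiff ℝ ∞ (fun z => fderiv ℝ u z v) := fun v =>
    (hu.fderiv_right le_rfl).clm_apply contDiff_const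
  exact contDiff_const.mul ((h _).add (contDiff_const.mul (h _)))

lemma support_wirtinger_subset {u : ℂ × ℂ → ℂ} (σ : ℂ) (j : Fin 2) :
    (wirtinger σ j u).support ⊆ tsupport u := fun z hz => by
  apply support_fderiv_subset ℝ
  intro h
  apply hz
  simp [wirtinger, h]

lemma tsupport_wirtinger_subset {u : ℂ × ℂ → ℂ} (σ : ℂ) (j : Fin 2) :
    tsupport (wirtinger σ j u) ⊆ tsupport u :=
  closure_minimal (support_wirtinger_subset σ j) (isClosed_tsupport u)

lemma integrable_mul_fderiv {u ψ : ℂ × ℂ → ℂ} (hu : ContinuousOn u HH)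
    (hψ : ContDiff ℝ 1 ψ) (hc : HasCompactSupport ψ) (hs : tsupport ψ ⊆ HH) (v : ℂ × ℂ) :
    Integrable fun z => u z * fderiv ℝ ψ z v := by
  have hd : Continuous fun z => fderiv ℝ ψ z v := (hψ.continuous_fderiv (by simp)).clm_apply
    continuous_const
  have hsub : (fun z => fderiv ℝ ψ z v).support ⊆ tsupport ψ := fun z hz => by
    apply support_fderiv_subset ℝ
    intro h
    apply hz
    simp [h]
  exact integrable_mul_of_tsupport isOpen_HH hu hd (hc.mono' hsub)
    ((closure_minimal hsub (isClosed_tsupport ψ)).trans hs)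

lemma integrable_fderiv_mul {u ψ : ℂ × ℂ → ℂ} (hu : ContDiffOn ℝ 1 u HH)
    (hψ : Continuous ψ) (hc : HasCompactSupport ψ) (hs : tsupport ψ ⊆ HH) (v : ℂ × ℂ) :
    Integrable fun z => fderiv ℝ u z v * ψ z :=
  integrable_mul_of_tsupport isOpen_HH
    ((hu.continuousOn_fderiv_of_isOpen isOpen_HH le_rfl).clm_apply continuousOn_const) hψ hc hs

lemma integral_mul_wirtinger_eq_neg {u ψ : ℂ × ℂ → ℂ} (hu : ContDiffOn ℝ 1 u HH)
    (hψ : ContDiff ℝ 1 ψ) (hc : HasCompactSupport ψ) (hs : tsupport ψ ⊆ HH) (σ : ℂ) (j : Fin 2) :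
    ∫ z, u z * wirtinger σ j ψ z = - ∫ z, wirtinger σ j u z * ψ z := by
  have e1 : ∀ z, u z * wirtinger σ j ψ z = (1 / 2) * (u z * fderiv ℝ ψ z (basisVec j))
      + (1 / 2) * (σ * Complex.I) * (u z * fderiv ℝ ψ z (Complex.I • basisVec j)) := fun z => by
    rw [wirtinger]; ring
  have e2 : ∀ z, wirtinger σ j u z * ψ z = (1 / 2) * (fderiv ℝ u z (basisVec j) * ψ z)
      + (1 / 2) * (σ * Complex.I) * (fderiv ℝ u z (Complex.I • basisVec j) * ψ z) := fun z => by
    rw [wirtinger]; ring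
  simp_rw [e1, e2]
  rw [integral_add, integral_add, integral_const_mul, integral_const_mul, integral_const_mul,
    integral_const_mul, integral_mul_fderiv_eq_neg hu hψ hc hs,
    integral_mul_fderiv_eq_neg hu hψ hc hs]
  · ring
  · exact (integrable_fderiv_mul hu hψ.continuous hc hs _).const_mul _
  · exact (integrable_fderiv_mul hu hψ.continuous hc hs _).const_mul _
  · exact (integrable_mul_fderiv hu.continuousOn hψ hc hs _).const_mul _
  · exact (integrable_mul_fderiv hu.continuousOn hψ hc hs _).const_mul _

/-- Moving the derivatives across one at a time, outermost first, reverses their order and cancels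
the two signs. No symmetry of second derivatives is used. -/
lemma integral_mul_dZ_dZbar {u ψ : ℂ × ℂ → ℂ} (hu : ContDiffOn ℝ 2 u HH)
    (hψ : ContDiff ℝ ∞ ψ) (hc : HasCompactSupport ψ) (hs : tsupport ψ ⊆ HH) (j k : Fin 2) :
    ∫ z, u z * dZ j (dZbar k ψ) z = ∫ z, dZbar k (dZ j u) z * ψ z := by
  rw [dZ_eq_wirtinger, dZbar_eq_wirtinger, integral_mul_wirtinger_eq_neg (hu.of_le (by norm_num))
    ((contDiff_wirtinger hψ _ _).of_le (by simp)) (hc.mono' (support_wirtinger_subset _ _))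
    ((tsupport_wirtinger_subset _ _).trans hs),
    integral_mul_wirtinger_eq_neg (by
      exact_mod_cast contDiffOn_wirtinger (n := 1) (m := 2) (by exact_mod_cast hu)
        (by norm_num) _ _) (hψ.of_le (by simp)) hc hs, neg_neg]

/-- All derivatives of a test form are integrable against functions continuous on `ℍ × ℍ`. -/
lemma integrable_mul_dZ_dZbar {u ψ : ℂ × ℂ → ℂ} (hu : ContinuousOn u HH)
    (hψ : ContDiff ℝ ∞ ψ) (hc : HasCompactSupport ψ) (hs : tsupport ψ ⊆ HH) (j k : Fin 2) :
    Integrable fun z => u z * dZ j (dZbar k ψ) z := by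
  rw [dZ_eq_wirtinger, dZbar_eq_wirtinger]
  exact integrable_mul_of_tsupport isOpen_HH hu
    (contDiff_wirtinger (contDiff_wirtinger hψ _ _) _ _).continuous
    ((hc.mono' (support_wirtinger_subset _ _)).mono' (support_wirtinger_subset _ _))
    (((tsupport_wirtinger_subset _ _).trans (tsupport_wirtinger_subset _ _)).trans hs)

lemma integral_add_sub_sub {X : Type*} [MeasurableSpace X] {μ : Measure X} {a b c d : X → ℂ}
    (ha : Integrable a μ) (hb : Integrable b μ) (hc : Integrable c μ) (hd : Integrable d μ) :
    ∫ z, (a z + b z - c z - d z) ∂μ = ∫ z, a z ∂μ + ∫ z, b z ∂μ - ∫ z, c z ∂μ - ∫ z, d z ∂μ := by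
  have h1 : Integrable (fun z => a z + b z) μ := ha.add hb
  have h2 : Integrable (fun z => a z + b z - c z) μ := h1.sub hc
  rw [integral_sub h2 hd, integral_sub h1 hc, integral_add ha hb]

/-- Stokes' theorem for a `C²` function on `ℍ × ℍ`:
`∫ u dd^c η = ∫ α ∧ η` if `α = dd^c u`, i.e. `α j k = (i / 2π) ∂_j ∂̄_k u`. -/
lemma topIntegral_mul_ddc {u : ℂ × ℂ → ℂ} (hu : ContDiffOn ℝ 2 u HH) {α η : Form11}
    (hη : η.IsTest)
    (hα : ∀ j k, ∀ z ∈ HH,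
      α j k z = -(1 / (2 * Real.pi * Complex.I)) * dZbar k (dZ j u) z) :
    topIntegral (fun z => u z * ddc η z) = topIntegral (wedge α η) := by
  have H : ∀ j k j' k', ∫ z, u z * dZ j (dZbar k (η j' k')) z
      = ∫ z, dZbar k (dZ j u) z * η j' k' z := fun j k j' k' =>
    integral_mul_dZ_dZbar hu (hη j' k').1 (hη j' k').2.1 (hη j' k').2.2 j k
  have I1 : ∀ j k j' k', Integrable fun z => u z * dZ j (dZbar k (η j' k')) z := fun j k j' k' =>
    integrable_mul_dZ_dZbar hu.continuousOn (hη j' k').1 (hη j' k').2.1 (hη j' k').2.2 j k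
  have I2 : ∀ j k j' k', Integrable fun z => dZbar k (dZ j u) z * η j' k' z := fun j k j' k' => by
    refine integrable_mul_of_tsupport isOpen_HH ?_ (hη j' k').1.continuous (hη j' k').2.1
      (hη j' k').2.2
    rw [dZ_eq_wirtinger, dZbar_eq_wirtinger]
    refine (contDiffOn_wirtinger (n := 0) (m := 1) ?_ (by norm_num) _ _).continuousOn
    exact contDiffOn_wirtinger (n := 1) (m := 2) (by exact_mod_cast hu) (by norm_num) _ _
  set c : ℂ := -(1 / (2 * Real.pi * Complex.I)) with hc
  -- Both integrands vanish off `HH`, so the integrals may be taken over all of ℂ × ℂ, where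
  -- integration by parts is available.
  have z1 : ∀ z ∉ HH, (-4 : ℂ) * (u z * ddc η z) = 0 := fun z hz => by
    have : ∀ j k j' k', dZ j (dZbar k (η j' k')) z = 0 := fun j k j' k' => by
      refine image_eq_zero_of_notMem_tsupport fun h => hz ((hη j' k').2.2 ?_)
      rw [dZ_eq_wirtinger, dZbar_eq_wirtinger] at h
      exact tsupport_wirtinger_subset _ _ (tsupport_wirtinger_subset _ _ h)
    simp [ddc, this]
  have z2 : ∀ z ∉ HH, (-4 : ℂ) * wedge α η z = 0 := fun z hz => by
    have : ∀ j k, η j k z = 0 := fun j k =>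
      image_eq_zero_of_notMem_tsupport fun h => hz ((hη j k).2.2 h)
    simp [wedge, this]
  have l : ∀ z, (-4 : ℂ) * (u z * ddc η z) = (-4 * c) *
      (u z * dZ 0 (dZbar 0 (η 1 1)) z + u z * dZ 1 (dZbar 1 (η 0 0)) z
        - u z * dZ 0 (dZbar 1 (η 1 0)) z - u z * dZ 1 (dZbar 0 (η 0 1)) z) := fun z => by
    rw [ddc]; ring
  have r : ∀ z, (-4 : ℂ) * wedge α η z = (-4 * c) *
      (dZbar 0 (dZ 0 u) z * η 1 1 z + dZbar 1 (dZ 1 u) z * η 0 0 z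
        - dZbar 1 (dZ 0 u) z * η 1 0 z - dZbar 0 (dZ 1 u) z * η 0 1 z) := fun z => by
    by_cases hz : z ∈ HH
    · rw [wedge, hα _ _ z hz, hα _ _ z hz, hα _ _ z hz, hα _ _ z hz]; ring
    · have : ∀ j k, η j k z = 0 := fun j k =>
        image_eq_zero_of_notMem_tsupport fun h => hz ((hη j k).2.2 h)
      simp [wedge, this]
  rw [topIntegral, topIntegral, setIntegral_eq_integral_of_forall_compl_eq_zero z1,
    setIntegral_eq_integral_of_forall_compl_eq_zero z2]
  simp_rw [l, r]
  rw [integral_const_mul, integral_const_mul,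
    integral_add_sub_sub (I1 _ _ _ _) (I1 _ _ _ _) (I1 _ _ _ _) (I1 _ _ _ _),
    integral_add_sub_sub (I2 _ _ _ _) (I2 _ _ _ _) (I2 _ _ _ _) (I2 _ _ _ _), H, H, H, H]

/-! ### The exponential integral -/

/-- The derivatives of `(1 - exp (-t)) / t = ∫₀¹ exp (-t s) ds`. -/
def expMean (n : ℕ) (t : ℝ) : ℝ := ∫ s in (0 : ℝ)..1, (-s) ^ n * Real.exp (-t * s)

lemma hasDerivAt_expMean (n : ℕ) (t : ℝ) : HasDerivAt (expMean n) (expMean (n + 1) t) t := by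
  have hc : ∀ (m : ℕ) (x : ℝ), Continuous fun s : ℝ => (-s) ^ m * Real.exp (-x * s) :=
    fun m x => by fun_prop
  refine (intervalIntegral.hasDerivAt_integral_of_dominated_loc_of_deriv_le
    (F := fun x s => (-s) ^ n * Real.exp (-x * s))
    (F' := fun x s => (-s) ^ (n + 1) * Real.exp (-x * s))
    (bound := fun _ => Real.exp (|t| + 1)) (Metric.ball_mem_nhds t one_pos)
    (Eventually.of_forall fun x => (hc n x).aestronglyMeasurable)
    ((hc n t).intervalIntegrable _ _) (hc (n + 1) t).aestronglyMeasurable ?_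
    intervalIntegrable_const ?_).2
  · refine Eventually.of_forall fun s hs x hx => ?_
    rw [uIoc_of_le zero_le_one] at hs
    rw [norm_mul, norm_pow, norm_neg, Real.norm_eq_abs, Real.norm_eq_abs, abs_of_pos hs.1,
      Real.abs_exp]
    have h1 : s ^ (n + 1) ≤ 1 := pow_le_one₀ hs.1.le hs.2
    have h2 : Real.exp (-x * s) ≤ Real.exp (|t| + 1) := by
      apply Real.exp_le_exp.2
      have h3 : |x| ≤ |t| + 1 := by
        have := abs_sub_abs_le_abs_sub x t
        rw [Metric.mem_ball, Real.dist_eq] at hx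
        linarith
      calc -x * s ≤ |x| * s := mul_le_mul_of_nonneg_right (neg_le_abs x) hs.1.le
        _ ≤ |x| * 1 := mul_le_mul_of_nonneg_left hs.2 (abs_nonneg x)
        _ ≤ _ := by linarith
    calc _ ≤ 1 * Real.exp (|t| + 1) := by gcongr
      _ = _ := one_mul _
  · refine Eventually.of_forall fun s _ x _ => ?_
    have : HasDerivAt (fun x => -x * s) (-s) x := by
      simpa using (hasDerivAt_id x).neg.mul_const s
    refine (this.exp.const_mul ((-s) ^ n)).congr_deriv ?_
    ring

/-- Differentiation only raises the index, so induction on the order of smoothness works once it is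
run for all indices simultaneously. -/
lemma contDiff_expMean (n : ℕ) : ContDiff ℝ ∞ (expMean n) := by
  have : ∀ m n : ℕ, ContDiff ℝ m (expMean n) := fun m => by
    induction m with
    | zero =>
      intro n
      have : Differentiable ℝ (expMean n) := fun t => (hasDerivAt_expMean n t).differentiableAt
      exact contDiff_zero.2 this.continuous
    | succ m ih =>
      intro n
      push_cast
      refine contDiff_succ_iff_deriv.2
        ⟨fun t => (hasDerivAt_expMean n t).differentiableAt, by simp, ?_⟩
      rw [show deriv (expMean n) = expMean (n + 1) from
        funext fun t => (hasDerivAt_expMean n t).deriv]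
      exact ih _
  exact contDiff_infty.2 fun m => this m n

/-- The multiplied-out form remains valid at `t = 0`, which is the value taken on D_M. -/
lemma mul_expMean_zero (t : ℝ) : t * expMean 0 t = 1 - Real.exp (-t) := by
  rw [expMean, ← intervalIntegral.integral_const_mul,
    intervalIntegral.integral_eq_sub_of_hasDerivAt (f := fun s => -Real.exp (-t * s))]
  · simp; ring
  · intro s _
    have : HasDerivAt (fun s => -t * s) (-t) s := by
      simpa using (hasDerivAt_id s).const_mul (-t)
    refine this.exp.neg.congr_deriv ?_
    ring
  · apply Continuous.intervalIntegrable
    fun_prop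

/-- The entire exponential integral `∫₀ᵗ (1 - exp (-s)) / s ds`. -/
def ein (t : ℝ) : ℝ := ∫ s in (0 : ℝ)..t, expMean 0 s

lemma hasDerivAt_ein (t : ℝ) : HasDerivAt ein (expMean 0 t) t :=
  have h := (contDiff_expMean 0).continuous
  intervalIntegral.integral_hasDerivAt_right (h.intervalIntegrable _ _)
    (h.stronglyMeasurableAtFilter _ _) h.continuousAt

lemma contDiff_ein : ContDiff ℝ ∞ ein := by
  refine contDiff_infty_iff_deriv.2 ⟨fun t => (hasDerivAt_ein t).differentiableAt, ?_⟩
  rw [show deriv ein = expMean 0 from funext fun t => (hasDerivAt_ein t).deriv]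
  exact contDiff_expMean 0

lemma integrableOn_exp_neg_mul {t : ℝ} (ht : 0 < t) :
    IntegrableOn (fun r => Real.exp (-t * r)) (Ioi 1) := exp_neg_integrableOn_Ioi 1 ht

lemma integral_exp_neg_mul_Ioi {t : ℝ} (ht : 0 < t) :
    ∫ r in Ioi (1 : ℝ), Real.exp (-t * r) = Real.exp (-t) / t := by
  rw [integral_exp_mul_Ioi (by linarith)]
  simp [neg_div, div_neg]

lemma integrableOn_negEi {t : ℝ} (ht : 0 < t) :
    IntegrableOn (fun r => Real.exp (-t * r) / r) (Ioi 1) := by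
  refine (integrableOn_exp_neg_mul ht).mono' ?_ ?_
  · exact Measurable.aestronglyMeasurable (by fun_prop)
  · refine (ae_restrict_iff' measurableSet_Ioi).2 (Eventually.of_forall fun r (hr : 1 < r) => ?_)
    rw [Real.norm_eq_abs, abs_of_nonneg (by positivity)]
    exact div_le_self (Real.exp_pos _).le hr.le

lemma negEi_nonneg (t : ℝ) : 0 ≤ negEi t :=
  setIntegral_nonneg measurableSet_Ioi fun r (hr : 1 < r) => by positivity

lemma negEi_le {t : ℝ} (ht : 0 < t) : negEi t ≤ Real.exp (-t) / t := by
  rw [← integral_exp_neg_mul_Ioi ht]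
  refine setIntegral_mono_on (integrableOn_negEi ht) (integrableOn_exp_neg_mul ht)
    measurableSet_Ioi fun r (hr : 1 < r) => ?_
  exact div_le_self (Real.exp_pos _).le hr.le

lemma hasDerivAt_negEi {t : ℝ} (ht : 0 < t) : HasDerivAt negEi (-(Real.exp (-t) / t)) t := by
  have h := (hasDerivAt_integral_of_dominated_loc_of_deriv_le (μ := volume.restrict (Ioi (1 : ℝ)))
    (F := fun t r => Real.exp (-t * r) / r)
    (F' := fun t r => -Real.exp (-t * r)) (bound := fun r => Real.exp (-(t / 2) * r))
    (Ioi_mem_nhds (half_lt_self ht))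
    (Eventually.of_forall fun x => Measurable.aestronglyMeasurable (by fun_prop))
    (integrableOn_negEi ht) (Measurable.aestronglyMeasurable (by fun_prop)) ?_
    (integrableOn_exp_neg_mul (half_pos ht)) ?_).2
  · rwa [integral_neg, integral_exp_neg_mul_Ioi ht] at h
  · refine (ae_restrict_iff' measurableSet_Ioi).2
      (Eventually.of_forall fun r (hr : 1 < r) x (hx : t / 2 < x) => ?_)
    rw [norm_neg, Real.norm_eq_abs, Real.abs_exp]
    apply Real.exp_le_exp.2
    nlinarith
  · refine (ae_restrict_iff' measurableSet_Ioi).2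
      (Eventually.of_forall fun r (hr : 1 < r) x _ => ?_)
    have : HasDerivAt (fun x => -x * r) (-r) x := by
      simpa using (hasDerivAt_id x).neg.mul_const r
    refine (this.exp.div_const r).congr_deriv ?_
    field_simp

/-- `-Ei(-t) = c - log t + Ein(t)`. -/
lemma exists_negEi_eq : ∃ c : ℝ, ∀ t, 0 < t → negEi t = c - Real.log t + ein t := by
  -- The three derivatives -exp(-t)/t, 1/t and (1 - exp(-t))/t cancel, so the combination is
  -- constant on (0, ∞). The value of the constant never matters; it is read off at `t = 1`.
  have hd : ∀ t, 0 < t → HasDerivAt (fun t => negEi t + Real.log t - ein t) 0 t := fun t ht => by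
    refine (((hasDerivAt_negEi ht).add (Real.hasDerivAt_log ht.ne')).sub
      (hasDerivAt_ein t)).congr_deriv ?_
    have := mul_expMean_zero t
    field_simp
    linarith
  refine ⟨negEi 1 + Real.log 1 - ein 1, fun t ht => ?_⟩
  have := (convex_Ioi (0 : ℝ)).is_const_of_fderivWithin_eq_zero (𝕜 := ℝ)
    (f := fun t => negEi t + Real.log t - ein t)
    (fun t ht => (hd t ht).differentiableAt.differentiableWithinAt)
    (fun t ht => by
      rw [fderivWithin_of_isOpen isOpen_Ioi ht]
      have := (hd t ht).hasFDerivAt.fderiv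
      simpa using this)
    (show t ∈ Ioi (0 : ℝ) from ht) (show (1 : ℝ) ∈ Ioi (0 : ℝ) from one_pos (α := ℝ))
  linarith

lemma contDiffOn_negEi : ContDiffOn ℝ ∞ negEi (Ioi 0) := by
  obtain ⟨c, hc⟩ := exists_negEi_eq
  refine ContDiffOn.congr (f := fun t => c - Real.log t + ein t) ?_ fun t ht => hc t ht
  exact (contDiffOn_const.sub (Real.contDiffOn_log.mono fun t (ht : 0 < t) => ht.ne')).add
    contDiff_ein.contDiffOn

/-- A smooth truncation of `-Ei(-t)`, equal to `∫_1^n exp (-t r) dr / r`. -/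
def negEiTrunc (n t : ℝ) : ℝ := Real.log n + ein t - ein (n * t)

lemma contDiff_negEiTrunc (n : ℝ) : ContDiff ℝ ∞ (negEiTrunc n) :=
  (contDiff_const.add contDiff_ein).sub (contDiff_ein.comp (contDiff_const.mul contDiff_id))

lemma hasDerivAt_negEiTrunc (n t : ℝ) :
    HasDerivAt (negEiTrunc n) (expMean 0 t - n * expMean 0 (n * t)) t := by
  have h : HasDerivAt (fun t => n * t) n t := by simpa using (hasDerivAt_id t).const_mul n
  have := ((hasDerivAt_ein t).const_add (Real.log n)).sub ((hasDerivAt_ein (n * t)).comp t h)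
  refine this.congr_deriv ?_
  ring

/-- The tail of the integral beyond n is, after rescaling r, again -Ei, at the argument nt. In the
logarithmic expansions the unknown constant drops out. -/
lemma negEiTrunc_eq {n t : ℝ} (hn : 0 < n) (ht : 0 < t) :
    negEiTrunc n t = negEi t - negEi (n * t) := by
  obtain ⟨c, hc⟩ := exists_negEi_eq
  rw [hc t ht, hc _ (mul_pos hn ht), Real.log_mul hn.ne' ht.ne', negEiTrunc]
  ring

lemma negEi_anti {s t : ℝ} (hs : 0 < s) (hst : s ≤ t) : negEi t ≤ negEi s := by
  refine setIntegral_mono_on (integrableOn_negEi (hs.trans_le hst)) (integrableOn_negEi hs)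
    measurableSet_Ioi fun r (hr : 1 < r) => ?_
  have : Real.exp (-t * r) ≤ Real.exp (-s * r) := Real.exp_le_exp.2 (by nlinarith)
  gcongr

/-- Only part of a positive integral is retained. This is the majorant used to let the truncation go
to infinity under the integral. -/
lemma abs_negEiTrunc_le {n t : ℝ} (hn : 1 ≤ n) (ht : 0 < t) : |negEiTrunc n t| ≤ negEi t := by
  have hn0 : 0 < n := by linarith
  rw [negEiTrunc_eq hn0 ht, abs_of_nonneg]
  · linarith [negEi_nonneg (n * t)]
  · linarith [negEi_anti ht (le_mul_of_one_le_left ht.le hn)]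

lemma tendsto_negEi_atTop : Tendsto negEi atTop (𝓝 0) := by
  refine squeeze_zero' (Eventually.of_forall negEi_nonneg) ?_
    (Real.tendsto_exp_neg_atTop_nhds_zero)
  filter_upwards [eventually_ge_atTop 1] with t ht
  exact (negEi_le (by linarith)).trans (div_le_self (Real.exp_pos _).le ht)

lemma tendsto_negEiTrunc {t : ℝ} (ht : 0 < t) :
    Tendsto (fun n => negEiTrunc n t) atTop (𝓝 (negEi t)) := by
  have h : Tendsto (fun n => negEi t - negEi (n * t)) atTop (𝓝 (negEi t - 0)) :=
    tendsto_const_nhds.sub (tendsto_negEi_atTop.comp (tendsto_id.atTop_mul_const ht))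
  rw [sub_zero] at h
  refine h.congr' ?_
  filter_upwards [eventually_gt_atTop 0] with n hn
  exact (negEiTrunc_eq hn ht).symm

/-- `t E'(t) = e^{-nt} - e^{-t}` and `t E''(t) + E'(t) = e^{-t} - n e^{-nt}` for the truncation. -/
lemma mul_deriv_negEiTrunc (n t : ℝ) :
    t * (expMean 0 t - n * expMean 0 (n * t)) = Real.exp (-(n * t)) - Real.exp (-t) := by
  have h1 := mul_expMean_zero t
  have h2 := mul_expMean_zero (n * t)
  linear_combination h1 - h2

lemma hasDerivAt_deriv_negEiTrunc (n t : ℝ) :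
    HasDerivAt (fun t => expMean 0 t - n * expMean 0 (n * t))
      (expMean 1 t - n ^ 2 * expMean 1 (n * t)) t := by
  have h : HasDerivAt (fun t => n * t) n t := by simpa using (hasDerivAt_id t).const_mul n
  refine ((hasDerivAt_expMean 0 t).sub
    (((hasDerivAt_expMean 0 (n * t)).comp t h).const_mul n)).congr_deriv ?_
  ring

/-- Differentiate the identity for t·E′ and compare with the derivative of its right-hand side; no
closed formula for `expMean 1` is needed. -/
lemma mul_deriv_deriv_negEiTrunc (n t : ℝ) :
    t * (expMean 1 t - n ^ 2 * expMean 1 (n * t)) + (expMean 0 t - n * expMean 0 (n * t))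
      = Real.exp (-t) - n * Real.exp (-(n * t)) := by
  have h1 := (hasDerivAt_id t).mul (hasDerivAt_deriv_negEiTrunc n t)
  have h : HasDerivAt (fun t => -(n * t)) (-n) t := by
    simpa using (hasDerivAt_id t).const_mul n |>.fun_neg
  have h2 := h.exp.sub (hasDerivAt_neg t).exp
  have h3 : (id * fun t => expMean 0 t - n * expMean 0 (n * t))
      = fun t => Real.exp (-(n * t)) - Real.exp (-t) :=
    funext fun t => mul_deriv_negEiTrunc n t
  rw [h3] at h1
  have := h1.unique h2
  simp only [id] at this
  linarith

/-! ### The function `R` and the Schwartz form -/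

/-- The bilinear polynomial `a - b z₂ - c z₁ + d z₁ z₂`. -/
def bilin (M : Matrix (Fin 2) (Fin 2) ℝ) (z₁ z₂ : ℂ) : ℂ :=
  (M 0 0 : ℂ) - M 0 1 * z₂ - M 1 0 * z₁ + M 1 1 * z₁ * z₂

lemma star_bilin (M : Matrix (Fin 2) (Fin 2) ℝ) (z₁ z₂ : ℂ) :
    star (bilin M z₁ z₂) = bilin M (star z₁) (star z₂) := by
  simp [bilin]

lemma R_eq (z : ℂ × ℂ) (M : Matrix (Fin 2) (Fin 2) ℝ) :
    R z M = ‖bilin M z.1 z.2‖ ^ 2 / (2 * z.1.im * z.2.im) := rfl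

lemma HasWirtinger.bilin {h k : ℂ × ℂ → ℂ} {p₀ q₀ p₁ q₁ r₀ s₀ r₁ s₁ : ℂ} {z : ℂ × ℂ}
    (M : Matrix (Fin 2) (Fin 2) ℝ)
    (H : HasWirtinger h p₀ q₀ p₁ q₁ z) (K : HasWirtinger k r₀ s₀ r₁ s₁ z) :
    HasWirtinger (fun z => bilin M (h z) (k z))
      ((M 1 1 * k z - M 1 0) * p₀ + (M 1 1 * h z - M 0 1) * r₀)
      ((M 1 1 * k z - M 1 0) * q₀ + (M 1 1 * h z - M 0 1) * s₀)
      ((M 1 1 * k z - M 1 0) * p₁ + (M 1 1 * h z - M 0 1) * r₁)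
      ((M 1 1 * k z - M 1 0) * q₁ + (M 1 1 * h z - M 0 1) * s₁) z :=
  ((((const (M 0 0 : ℂ) z).sub ((const (M 0 1 : ℂ) z).mul K)).sub
    ((const (M 1 0 : ℂ) z).mul H)).add (((const (M 1 1 : ℂ) z).mul H).mul K)).congr_coeff
    (by ring) (by ring) (by ring) (by ring)

/-- `P_j`, where `∂_j R = P_j f̄ / (2 y₁ y₂)` for `f = a - b z₂ - c z₁ + d z₁ z₂`. -/
def gradCoeff (M : Matrix (Fin 2) (Fin 2) ℝ) (j : Fin 2) (z : ℂ × ℂ) : ℂ :=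
  if j = 0 then -bilin M (star z.1) z.2 / (2 * Complex.I * z.1.im)
  else -bilin M z.1 (star z.2) / (2 * Complex.I * z.2.im)

/-- `∂_j R ∂̄_k R / R = P_j P̄_k / (2 y₁ y₂)`. -/
def quadCoeff (M : Matrix (Fin 2) (Fin 2) ℝ) (j k : Fin 2) (z : ℂ × ℂ) : ℂ :=
  gradCoeff M j z * star (gradCoeff M k z) / (2 * z.1.im * z.2.im)

/-- The coefficients of `∂∂̄ log (y₁ y₂)`. -/
def hypCoeff (j k : Fin 2) (z : ℂ × ℂ) : ℂ :=
  (!![-1 / (4 * (z.1.im : ℂ) ^ 2), 0; 0, -1 / (4 * (z.2.im : ℂ) ^ 2)] :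
    Matrix (Fin 2) (Fin 2) ℂ) j k

/-- The form `(i / 2π) exp (-2π r R) (2π r ∂R ∧ ∂̄R / R + ∂∂̄ log (y₁ y₂))`. -/
def schwartzForm (r : ℝ) (M : Matrix (Fin 2) (Fin 2) ℝ) : Form11 := fun j k z =>
  -(1 / (2 * Real.pi * Complex.I)) * ((Real.exp (-(2 * Real.pi * r * R z M)) : ℝ) : ℂ)
    * (2 * Real.pi * r * quadCoeff M j k z + hypCoeff j k z)

lemma ofReal_im_eq (z : ℂ) : (z.im : ℂ) = (z - star z) / (2 * Complex.I) := by
  apply Complex.ext <;> simp [Complex.div_re, Complex.div_im]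
  ring

lemma sub_star_ne_zero {z : ℂ} (hz : 0 < z.im) : z - star z ≠ 0 := fun h => by
  have := congrArg Complex.im h
  simp at this
  linarith

lemma gradCoeff_zero (M : Matrix (Fin 2) (Fin 2) ℝ) (z : ℂ × ℂ) :
    gradCoeff M 0 z = -bilin M (star z.1) z.2 / (z.1 - star z.1) := by
  simp only [gradCoeff, if_pos, ofReal_im_eq]
  congr 1
  field_simp

lemma gradCoeff_one (M : Matrix (Fin 2) (Fin 2) ℝ) (z : ℂ × ℂ) :
    gradCoeff M 1 z = -bilin M z.1 (star z.2) / (z.2 - star z.2) := by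
  simp only [gradCoeff, one_ne_zero, if_false, ofReal_im_eq]
  congr 1
  field_simp

lemma star_gradCoeff_zero (M : Matrix (Fin 2) (Fin 2) ℝ) (z : ℂ × ℂ) :
    star (gradCoeff M 0 z) = bilin M z.1 (star z.2) / (z.1 - star z.1) := by
  rw [gradCoeff_zero, star_div₀, star_neg, star_bilin, star_sub, star_star, neg_div, ← div_neg,
    neg_sub]

lemma star_gradCoeff_one (M : Matrix (Fin 2) (Fin 2) ℝ) (z : ℂ × ℂ) :
    star (gradCoeff M 1 z) = bilin M (star z.1) z.2 / (z.2 - star z.2) := by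
  rw [gradCoeff_one, star_div₀, star_neg, star_bilin, star_sub, star_star, neg_div, ← div_neg,
    neg_sub]

/-- Expressed as a rational function of z and z̄, treated as independent variables, R can be
differentiated by formal rules. The constant is 2/(2i)² = -1/2. -/
lemma ofReal_R (z : ℂ × ℂ) (M : Matrix (Fin 2) (Fin 2) ℝ) :
    (R z M : ℂ) = bilin M z.1 z.2 * bilin M (star z.1) (star z.2)
      * (-(1 / 2) * (z.1 - star z.1) * (z.2 - star z.2))⁻¹ := by
  rw [R_eq, ← star_bilin]
  push_cast
  rw [← Complex.mul_conj', div_eq_mul_inv, ofReal_im_eq, ofReal_im_eq]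
  congr 2
  field_simp
  rw [Complex.I_sq]
  ring

lemma two_mul_im_mul_im (z : ℂ × ℂ) :
    (2 * z.1.im * z.2.im : ℂ) = -(1 / 2) * (z.1 - star z.1) * (z.2 - star z.2) := by
  rw [ofReal_im_eq, ofReal_im_eq]
  field_simp
  rw [Complex.I_sq]
  ring

lemma hasWirtinger_denom (z : ℂ × ℂ) :
    HasWirtinger (fun z => -(1 / 2) * (z.1 - star z.1) * (z.2 - star z.2))
      (-(1 / 2) * (z.2 - star z.2)) ((1 / 2) * (z.2 - star z.2))
      (-(1 / 2) * (z.1 - star z.1)) ((1 / 2) * (z.1 - star z.1)) z :=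
  (((HasWirtinger.const (-(1 / 2)) z).mul ((HasWirtinger.fst z).sub (HasWirtinger.star_fst z))).mul
    ((HasWirtinger.snd z).sub (HasWirtinger.star_snd z))).congr_coeff
    (by ring) (by ring) (by ring) (by ring)

/-- Since f is affine in z₁, (z₁ - z̄₁) ∂f/∂z₁ = f(z₁, z₂) - f(z̄₁, z₂). Differentiating f f̄ /
(2y₁y₂) therefore cancels the f(z₁, z₂) term and leaves -f(z̄₁, z₂)/(z₁ - z̄₁) in front of f̄; the
other three derivatives are analogous. -/
lemma hasWirtinger_R {z : ℂ × ℂ} (hz : z ∈ HH) (M : Matrix (Fin 2) (Fin 2) ℝ) :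
    HasWirtinger (fun z => (R z M : ℂ))
      (gradCoeff M 0 z * bilin M (star z.1) (star z.2)
        * (-(1 / 2) * (z.1 - star z.1) * (z.2 - star z.2))⁻¹)
      (bilin M z.1 z.2 * star (gradCoeff M 0 z)
        * (-(1 / 2) * (z.1 - star z.1) * (z.2 - star z.2))⁻¹)
      (gradCoeff M 1 z * bilin M (star z.1) (star z.2)
        * (-(1 / 2) * (z.1 - star z.1) * (z.2 - star z.2))⁻¹)
      (bilin M z.1 z.2 * star (gradCoeff M 1 z)
        * (-(1 / 2) * (z.1 - star z.1) * (z.2 - star z.2))⁻¹) z := by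
  have h1 := sub_star_ne_zero hz.1
  have h2 := sub_star_ne_zero hz.2
  have hY : -(1 / 2) * (z.1 - star z.1) * (z.2 - star z.2) ≠ 0 :=
    mul_ne_zero (mul_ne_zero (by norm_num) h1) h2
  simp_rw [ofReal_R]
  refine ((((HasWirtinger.fst z).bilin M (HasWirtinger.snd z)).mul
    ((HasWirtinger.star_fst z).bilin M (HasWirtinger.star_snd z))).mul
    ((hasWirtinger_denom z).inv hY)).congr_coeff ?_ ?_ ?_ ?_ <;>
  (try simp only [star_gradCoeff_zero, star_gradCoeff_one]) <;>
  (try simp only [gradCoeff_zero, gradCoeff_one]) <;>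
  simp only [KudlaGreen.bilin] <;> field_simp <;> ring

/-- The mixed second derivatives `∂_j ∂̄_k R = P_j P̄_k / (2 y₁ y₂) - R ∂_j ∂̄_k log (y₁ y₂)`. -/
lemma exists_hasWirtinger_gradCoeff {z : ℂ × ℂ} (hz : z ∈ HH) (M : Matrix (Fin 2) (Fin 2) ℝ)
    (j : Fin 2) : ∃ p₀ p₁, HasWirtinger (fun z => gradCoeff M j z * bilin M (star z.1) (star z.2)
        * (-(1 / 2) * (z.1 - star z.1) * (z.2 - star z.2))⁻¹)
      p₀ (quadCoeff M j 0 z - R z M * hypCoeff j 0 z)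
      p₁ (quadCoeff M j 1 z - R z M * hypCoeff j 1 z) z := by
  have h1 := sub_star_ne_zero hz.1
  have h2 := sub_star_ne_zero hz.2
  have hY : -(1 / 2) * (z.1 - star z.1) * (z.2 - star z.2) ≠ 0 :=
    mul_ne_zero (mul_ne_zero (by norm_num) h1) h2
  have hb : ∀ y : ℂ, y - star y ≠ 0 → -1 / (4 * (y.im : ℂ) ^ 2) = 1 / (y - star y) ^ 2 :=
    fun y hy => by
      rw [ofReal_im_eq, div_pow, mul_pow, Complex.I_sq]
      field_simp
      ring
  fin_cases j
  · have h := ((((HasWirtinger.const (-1) z).mul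
      ((HasWirtinger.star_fst z).bilin M (HasWirtinger.snd z))).mul
      (((HasWirtinger.fst z).sub (HasWirtinger.star_fst z)).inv h1)).mul
      ((HasWirtinger.star_fst z).bilin M (HasWirtinger.star_snd z))).mul
      ((hasWirtinger_denom z).inv hY)
    have e : (fun z : ℂ × ℂ => gradCoeff M 0 z * bilin M (star z.1) (star z.2)
        * (-(1 / 2) * (z.1 - star z.1) * (z.2 - star z.2))⁻¹) = fun z =>
        -1 * bilin M (star z.1) (z.2) * (z.1 - star z.1)⁻¹ * bilin M (star z.1) (star z.2)
          * (-(1 / 2) * (z.1 - star z.1) * (z.2 - star z.2))⁻¹ := by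
      funext z
      rw [gradCoeff_zero, neg_one_mul, div_eq_mul_inv]
    simp only [Fin.zero_eta, Fin.isValue]
    rw [e]
    -- Only the antiholomorphic coefficients need a closed form; the holomorphic ones are whatever
    -- the product rule yields.
    refine ⟨_, _, h.congr_coeff rfl ?_ rfl ?_⟩ <;>
    simp only [quadCoeff, hypCoeff, two_mul_im_mul_im, ofReal_R, hb _ h1, hb _ h2,
      star_gradCoeff_zero, star_gradCoeff_one, Matrix.of_apply, Matrix.cons_val_zero,
      Matrix.cons_val_one] <;>
    simp only [gradCoeff_zero] <;>
    simp only [bilin] <;>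
    field_simp <;> ring
  · have h := ((((HasWirtinger.const (-1) z).mul
      ((HasWirtinger.fst z).bilin M (HasWirtinger.star_snd z))).mul
      (((HasWirtinger.snd z).sub (HasWirtinger.star_snd z)).inv h2)).mul
      ((HasWirtinger.star_fst z).bilin M (HasWirtinger.star_snd z))).mul
      ((hasWirtinger_denom z).inv hY)
    have e : (fun z : ℂ × ℂ => gradCoeff M 1 z * bilin M (star z.1) (star z.2)
        * (-(1 / 2) * (z.1 - star z.1) * (z.2 - star z.2))⁻¹) = fun z =>
        -1 * bilin M (z.1) (star z.2) * (z.2 - star z.2)⁻¹ * bilin M (star z.1) (star z.2)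
          * (-(1 / 2) * (z.1 - star z.1) * (z.2 - star z.2))⁻¹ := by
      funext z
      rw [gradCoeff_one, neg_one_mul, div_eq_mul_inv]
    simp only [Fin.mk_one, Fin.isValue]
    rw [e]
    refine ⟨_, _, h.congr_coeff rfl ?_ rfl ?_⟩ <;>
    simp only [quadCoeff, hypCoeff, two_mul_im_mul_im, ofReal_R, hb _ h1, hb _ h2,
      star_gradCoeff_zero, star_gradCoeff_one, Matrix.of_apply, Matrix.cons_val_zero,
      Matrix.cons_val_one] <;>
    simp only [gradCoeff_one] <;>
    simp only [bilin] <;>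
    field_simp <;> ring

lemma dZbar_congr {f g : ℂ × ℂ → ℂ} {z : ℂ × ℂ} (h : f =ᶠ[𝓝 z] g) (k : Fin 2) :
    dZbar k f z = dZbar k g z := by
  rw [dZbar, dZbar, h.fderiv_eq]

/-- The product of the two first derivatives of R contains f f̄ / (2y₁y₂) = R as a factor. This is
what makes ∂R ∧ ∂̄R / R extend smoothly over D_M. -/
lemma gradCoeff_mul_bilin_mul (M : Matrix (Fin 2) (Fin 2) ℝ) (j k : Fin 2) (z : ℂ × ℂ) :
    gradCoeff M j z * bilin M (star z.1) (star z.2)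
        * (-(1 / 2) * (z.1 - star z.1) * (z.2 - star z.2))⁻¹
      * (bilin M z.1 z.2 * star (gradCoeff M k z)
        * (-(1 / 2) * (z.1 - star z.1) * (z.2 - star z.2))⁻¹)
      = R z M * quadCoeff M j k z := by
  rw [ofReal_R, quadCoeff, two_mul_im_mul_im, div_eq_mul_inv]
  ring

/-- `∂_j ∂̄_k` of a function of `R`. -/
lemma dZbar_dZ_comp_R {E E₁ E₂ : ℝ → ℝ} (h₁ : ∀ t, HasDerivAt E (E₁ t) t)
    (h₂ : ∀ t, HasDerivAt E₁ (E₂ t) t) (M : Matrix (Fin 2) (Fin 2) ℝ) (j k : Fin 2)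
    {z : ℂ × ℂ} (hz : z ∈ HH) :
    dZbar k (dZ j fun z => (E (R z M) : ℂ)) z
      = E₁ (R z M) * (quadCoeff M j k z - R z M * hypCoeff j k z)
        + E₂ (R z M) * (R z M * quadCoeff M j k z) := by
  have e : dZ j (fun z => (E (R z M) : ℂ)) =ᶠ[𝓝 z] fun z => (E₁ (R z M) : ℂ) *
      (gradCoeff M j z * bilin M (star z.1) (star z.2)
        * (-(1 / 2) * (z.1 - star z.1) * (z.2 - star z.2))⁻¹) := by
    filter_upwards [isOpen_HH.mem_nhds hz] with w hw
    have := (hasWirtinger_R hw M).comp_real (h₁ (R w M))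
    fin_cases j
    · exact this.dZ_zero
    · exact this.dZ_one
  rw [dZbar_congr e]
  obtain ⟨p₀, p₁, hg⟩ := exists_hasWirtinger_gradCoeff hz M j
  have H := ((hasWirtinger_R hz M).comp_real (h₂ (R z M))).mul hg
  fin_cases k
  · refine H.dZbar_zero.trans ?_
    simp only [Fin.zero_eta, ← gradCoeff_mul_bilin_mul]
    ring
  · refine H.dZbar_one.trans ?_
    simp only [Fin.mk_one, ← gradCoeff_mul_bilin_mul]
    ring

/-- The regularized form of `dd^c ξ = φ`. -/
lemma dZbar_dZ_negEiTrunc (n r : ℝ) (M : Matrix (Fin 2) (Fin 2) ℝ) (j k : Fin 2)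
    {z : ℂ × ℂ} (hz : z ∈ HH) :
    schwartzForm r M j k z - schwartzForm (n * r) M j k z = -(1 / (2 * Real.pi * Complex.I))
      * dZbar k (dZ j fun z => (negEiTrunc n (2 * Real.pi * r * R z M) : ℂ)) z := by
  have hl : ∀ t, HasDerivAt (fun t => 2 * Real.pi * r * t) (2 * Real.pi * r) t := fun t => by
    simpa using (hasDerivAt_id t).const_mul (2 * Real.pi * r)
  rw [dZbar_dZ_comp_R (E := fun t => negEiTrunc n (2 * Real.pi * r * t))
    (fun t => (hasDerivAt_negEiTrunc n _).comp t (hl t))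
    (fun t => ((hasDerivAt_deriv_negEiTrunc n _).comp t (hl t)).mul_const _) M j k hz]
  have h1 := mul_deriv_negEiTrunc n (2 * Real.pi * r * R z M)
  have h2 := mul_deriv_deriv_negEiTrunc n (2 * Real.pi * r * R z M)
  simp only [schwartzForm]
  rw [show 2 * Real.pi * (n * r) * R z M = n * (2 * Real.pi * r * R z M) by ring]
  -- With t = 2πrR, the derivatives x = E′(t) and y = E″(t) enter only through t·x, multiplying
  -- `hypCoeff`, and t·y + x, multiplying `quadCoeff`. Both are combinations of exponentials by `h1`
  -- and `h2`.
  generalize expMean 0 (2 * Real.pi * r * R z M)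
    - n * expMean 0 (n * (2 * Real.pi * r * R z M)) = x at *
  generalize expMean 1 (2 * Real.pi * r * R z M)
    - n ^ 2 * expMean 1 (n * (2 * Real.pi * r * R z M)) = y at *
  have h1' := congrArg (fun t : ℝ => (t : ℂ)) h1
  have h2' := congrArg (fun t : ℝ => (t : ℂ)) h2
  push_cast at h1' h2' ⊢
  linear_combination (-(1 / (2 * Real.pi * Complex.I))) * hypCoeff j k z * h1'
    + (1 / (2 * Real.pi * Complex.I)) * (2 * Real.pi * r) * quadCoeff M j k z * h2'

/-! ### Comparison with the Kudla–Millson form -/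

lemma gMat_inv {z : ℂ} (hz : 0 < z.im) :
    (gMat z)⁻¹ = !![1 / Real.sqrt z.im, -z.re / Real.sqrt z.im; 0, Real.sqrt z.im] := by
  have h := (Real.sqrt_pos.2 hz).ne'
  refine Matrix.inv_eq_right_inv ?_
  ext i j
  fin_cases i <;> fin_cases j <;> simp [gMat, Matrix.mul_apply, Fin.sum_univ_two, h]
  field_simp
  ring

/-- Transporting (z̄₁, z₂) to (-i, i) multiplies the polynomial by √(y₁y₂) and replaces M by M'; the
value at (-i, i) is a' - b'i + c'i + d'. -/
lemma bilin_star_eq_primed {z : ℂ × ℂ} (hz : z ∈ HH) (M : Matrix (Fin 2) (Fin 2) ℝ) :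
    bilin M (star z.1) z.2 = Real.sqrt z.1.im * Real.sqrt z.2.im *
      ((primed z M 0 0 + primed z M 1 1 : ℝ)
        + (primed z M 1 0 - primed z M 0 1 : ℝ) * Complex.I) := by
  have h1 := (Real.sqrt_pos.2 hz.1).ne'
  have h2 := (Real.sqrt_pos.2 hz.2).ne'
  have e1 := Real.sq_sqrt hz.1.le
  have e2 := Real.sq_sqrt hz.2.le
  obtain ⟨a, b, c, d, rfl⟩ : ∃ a b c d, M = !![a, b; c, d] := ⟨_, _, _, _, M.eta_fin_two⟩
  have ht : (!![1 / Real.sqrt z.2.im, -z.2.re / Real.sqrt z.2.im; 0, Real.sqrt z.2.im]).transpose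
      = !![1 / Real.sqrt z.2.im, 0; -z.2.re / Real.sqrt z.2.im, Real.sqrt z.2.im] := by
    ext i j
    fin_cases i <;> fin_cases j <;> rfl
  simp only [primed, gMat_inv hz.1, gMat_inv hz.2, ht, Matrix.mul_fin_two]
  apply Complex.ext <;> simp [bilin] <;> field_simp <;> simp only [e1, e2] <;> ring

/-- Kudla's Schwartz form is `exp (-π (M, M))` times the form `schwartzForm`. -/
lemma phiKudla_eq {z : ℂ × ℂ} (hz : z ∈ HH) (M : Matrix (Fin 2) (Fin 2) ℝ) (j k : Fin 2) :
    phiKudla M j k z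
      = ((Real.exp (-Real.pi * quad M) : ℝ) : ℂ) * schwartzForm 1 M j k z := by
  have hW := bilin_star_eq_primed hz M
  have hW' : bilin M z.1 (star z.2) = star (bilin M (star z.1) z.2) := by
    rw [star_bilin, star_star]
  rw [hW] at hW'
  simp only [phiKudla, phiKM, schwartzForm, quadCoeff]
  have e : Real.exp (-Real.pi * (2 * R z M + quad M)) = Real.exp (-Real.pi * quad M)
      * Real.exp (-(2 * Real.pi * 1 * R z M)) := by
    rw [← Real.exp_add]; ring_nf
  rw [e]
  set p := primed z M 0 0 + primed z M 1 1
  set q := primed z M 1 0 - primed z M 0 1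
  have e1 : (z.1.im : ℂ) = (Real.sqrt z.1.im : ℂ) ^ 2 := by
    rw [← Complex.ofReal_pow, Real.sq_sqrt hz.1.le]
  have e2 : (z.2.im : ℂ) = (Real.sqrt z.2.im : ℂ) ^ 2 := by
    rw [← Complex.ofReal_pow, Real.sq_sqrt hz.2.le]
  have n1 : (Real.sqrt z.1.im : ℂ) ≠ 0 := by exact_mod_cast (Real.sqrt_pos.2 hz.1).ne'
  have n2 : (Real.sqrt z.2.im : ℂ) ≠ 0 := by exact_mod_cast (Real.sqrt_pos.2 hz.2).ne'
  have hpi : (Real.pi : ℂ) ≠ 0 := by exact_mod_cast Real.pi_ne_zero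
  -- The terms in p², pq, q² match `quadCoeff`. The remaining -(Ω₁ + Ω₃)/(2π), in which the
  -- off-diagonal entries cancel, matches `hypCoeff`.
  simp only [gradCoeff, hypCoeff, Omega1, Omega2, Omega3, hW, hW', e1, e2]
  fin_cases j <;> fin_cases k <;> simp <;> field_simp
  all_goals (ring_nf; simp only [Complex.I_sq]; ring)

/-! ### Families depending linearly or quadratically on the matrix -/

/-- Families of functions on `ℍ × ℍ` which depend linearly on the matrix `M`. -/
def IsLinearFamily (f : Matrix (Fin 2) (Fin 2) ℝ → ℂ × ℂ → ℂ) : Prop :=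
  ∃ ρ : Fin 2 × Fin 2 → ℂ × ℂ → ℂ, (∀ p, ContDiffOn ℝ ∞ (ρ p) HH) ∧
    ∀ M, ∀ z ∈ HH, f M z = ∑ p, (M p.1 p.2 : ℂ) * ρ p z

/-- Families of functions on `ℍ × ℍ` which depend quadratically on the matrix `M`. -/
def IsQuadraticFamily {E : Type*} [NormedAddCommGroup E] [NormedSpace ℝ E]
    (f : Matrix (Fin 2) (Fin 2) ℝ → ℂ × ℂ → E) : Prop :=
  ∃ ρ : (Fin 2 × Fin 2) × (Fin 2 × Fin 2) → ℂ × ℂ → E, (∀ p, ContDiffOn ℝ ∞ (ρ p) HH) ∧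
    ∀ M, ∀ z ∈ HH, f M z = ∑ p, (M p.1.1 p.1.2 * M p.2.1 p.2.2) • ρ p z

lemma isLinearFamily_bilin {u v : ℂ × ℂ → ℂ} (hu : ContDiffOn ℝ ∞ u HH)
    (hv : ContDiffOn ℝ ∞ v HH) : IsLinearFamily fun M z => bilin M (u z) (v z) := by
  refine ⟨fun p z => (if p.1 = 0 then 1 else -u z) * (if p.2 = 0 then 1 else -v z),
    fun p => ?_, fun M z _ => ?_⟩
  · refine ContDiffOn.mul ?_ ?_
    · split_ifs
      · exact contDiffOn_const
      · exact hu.neg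
    · split_ifs
      · exact contDiffOn_const
      · exact hv.neg
  · simp [Fintype.sum_prod_type, bilin]
    ring

lemma IsLinearFamily.mul {f g : Matrix (Fin 2) (Fin 2) ℝ → ℂ × ℂ → ℂ} (hf : IsLinearFamily f)
    (hg : IsLinearFamily g) {s : ℂ × ℂ → ℂ} (hs : ContDiffOn ℝ ∞ s HH) :
    IsQuadraticFamily fun M z => f M z * g M z * s z := by
  obtain ⟨ρ, hρ, ef⟩ := hf
  obtain ⟨σ, hσ, eg⟩ := hg
  refine ⟨fun p z => ρ p.1 z * σ p.2 z * s z, fun p => ((hρ _).mul (hσ _)).mul hs,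
    fun M z hz => ?_⟩
  beta_reduce
  rw [ef M z hz, eg M z hz, Finset.sum_mul_sum, Finset.sum_mul]
  refine Eq.trans ?_ (Fintype.sum_prod_type _).symm
  refine Finset.sum_congr rfl fun p _ => ?_
  rw [Finset.sum_mul]
  refine Finset.sum_congr rfl fun q _ => ?_
  rw [Complex.real_smul]
  push_cast
  ring

lemma IsQuadraticFamily.congr {E : Type*} [NormedAddCommGroup E] [NormedSpace ℝ E]
    {f g : Matrix (Fin 2) (Fin 2) ℝ → ℂ × ℂ → E} (hf : IsQuadraticFamily f)
    (h : ∀ M, ∀ z ∈ HH, g M z = f M z) : IsQuadraticFamily g := by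
  obtain ⟨ρ, hρ, ef⟩ := hf
  exact ⟨ρ, hρ, fun M z hz => (h M z hz).trans (ef M z hz)⟩

lemma IsQuadraticFamily.contDiffOn {E : Type*} [NormedAddCommGroup E] [NormedSpace ℝ E]
    {f : Matrix (Fin 2) (Fin 2) ℝ → ℂ × ℂ → E} (hf : IsQuadraticFamily f)
    (M : Matrix (Fin 2) (Fin 2) ℝ) : ContDiffOn ℝ ∞ (f M) HH := by
  obtain ⟨ρ, hρ, ef⟩ := hf
  exact (ContDiffOn.sum fun p _ => contDiffOn_const.smul (hρ p)).congr (ef M)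

lemma IsQuadraticFamily.clm_comp {E F : Type*} [NormedAddCommGroup E] [NormedSpace ℝ E]
    [NormedAddCommGroup F] [NormedSpace ℝ F]
    {f : Matrix (Fin 2) (Fin 2) ℝ → ℂ × ℂ → E} (hf : IsQuadraticFamily f) (L : E →L[ℝ] F) :
    IsQuadraticFamily fun M z => L (f M z) := by
  obtain ⟨ρ, hρ, ef⟩ := hf
  refine ⟨fun p z => L (ρ p z), fun p => L.contDiff.comp_contDiffOn (hρ p), fun M z hz => ?_⟩
  simp [ef M z hz]

lemma contDiff_fst_star : ContDiff ℝ ∞ fun z : ℂ × ℂ => star z.1 :=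
  Complex.conjCLE.contDiff.comp contDiff_fst

lemma contDiff_snd_star : ContDiff ℝ ∞ fun z : ℂ × ℂ => star z.2 :=
  Complex.conjCLE.contDiff.comp contDiff_snd

lemma contDiffOn_inv_sub_star_fst : ContDiffOn ℝ ∞ (fun z : ℂ × ℂ => (z.1 - star z.1)⁻¹) HH :=
  ContDiffOn.inv (contDiff_fst.sub contDiff_fst_star).contDiffOn fun _ hz =>
    sub_star_ne_zero hz.1

lemma contDiffOn_inv_sub_star_snd : ContDiffOn ℝ ∞ (fun z : ℂ × ℂ => (z.2 - star z.2)⁻¹) HH :=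
  ContDiffOn.inv (contDiff_snd.sub contDiff_snd_star).contDiffOn fun _ hz =>
    sub_star_ne_zero hz.2

lemma isQuadraticFamily_R : IsQuadraticFamily fun M z => R z M := by
  have h := ((isLinearFamily_bilin contDiff_fst.contDiffOn contDiff_snd.contDiffOn).mul
    (isLinearFamily_bilin contDiff_fst_star.contDiffOn contDiff_snd_star.contDiffOn)
    ((contDiffOn_const (c := (-2 : ℂ))).mul
      (contDiffOn_inv_sub_star_fst.mul contDiffOn_inv_sub_star_snd))).clm_comp Complex.reCLM
  refine h.congr fun M z hz => ?_
  have : R z M = Complex.re (R z M : ℂ) := rfl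
  rw [this, ofReal_R]
  congr 2
  have h1 := sub_star_ne_zero hz.1
  have h2 := sub_star_ne_zero hz.2
  field_simp

lemma exists_gradCoeff_eq (j : Fin 2) : ∃ f s, IsLinearFamily f ∧ ContDiffOn ℝ ∞ s HH ∧
    ∀ M, ∀ z ∈ HH, gradCoeff M j z = f M z * s z := by
  fin_cases j
  · refine ⟨fun M z => bilin M (star z.1) z.2, fun z => -(z.1 - star z.1)⁻¹,
      isLinearFamily_bilin contDiff_fst_star.contDiffOn contDiff_snd.contDiffOn,
      contDiffOn_inv_sub_star_fst.neg, fun M z hz => ?_⟩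
    exact (gradCoeff_zero M z).trans (by ring)
  · refine ⟨fun M z => bilin M z.1 (star z.2), fun z => -(z.2 - star z.2)⁻¹,
      isLinearFamily_bilin contDiff_fst.contDiffOn contDiff_snd_star.contDiffOn,
      contDiffOn_inv_sub_star_snd.neg, fun M z hz => ?_⟩
    exact (gradCoeff_one M z).trans (by ring)

lemma exists_star_gradCoeff_eq (j : Fin 2) : ∃ f s, IsLinearFamily f ∧ ContDiffOn ℝ ∞ s HH ∧
    ∀ M, ∀ z ∈ HH, star (gradCoeff M j z) = f M z * s z := by
  fin_cases j
  · refine ⟨fun M z => bilin M z.1 (star z.2), fun z => (z.1 - star z.1)⁻¹,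
      isLinearFamily_bilin contDiff_fst.contDiffOn contDiff_snd_star.contDiffOn,
      contDiffOn_inv_sub_star_fst, fun M z hz => ?_⟩
    exact (star_gradCoeff_zero M z).trans (by ring)
  · refine ⟨fun M z => bilin M (star z.1) z.2, fun z => (z.2 - star z.2)⁻¹,
      isLinearFamily_bilin contDiff_fst_star.contDiffOn contDiff_snd.contDiffOn,
      contDiffOn_inv_sub_star_snd, fun M z hz => ?_⟩
    exact (star_gradCoeff_one M z).trans (by ring)

lemma isQuadraticFamily_quadCoeff (j k : Fin 2) :
    IsQuadraticFamily fun M z => quadCoeff M j k z := by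
  obtain ⟨f, s, hf, hs, ef⟩ := exists_gradCoeff_eq j
  obtain ⟨g, t, hg, ht, eg⟩ := exists_star_gradCoeff_eq k
  refine (hf.mul hg ((hs.mul ht).mul ((contDiffOn_const (c := (-2 : ℂ))).mul
      (contDiffOn_inv_sub_star_fst.mul contDiffOn_inv_sub_star_snd)))).congr fun M z hz => ?_
  have h1 := sub_star_ne_zero hz.1
  have h2 := sub_star_ne_zero hz.2
  rw [quadCoeff, ef M z hz, eg M z hz, two_mul_im_mul_im]
  field_simp

lemma contDiffOn_hypCoeff (j k : Fin 2) : ContDiffOn ℝ ∞ (hypCoeff j k) HH := by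
  have h : ∀ y : ℂ, -1 / (4 * (y.im : ℂ) ^ 2) = (y - star y)⁻¹ ^ 2 := fun y => by
    rw [ofReal_im_eq, div_pow, mul_pow, Complex.I_sq]
    -- The identity is wanted for every y, because `hypCoeff` is rewritten as a function; for real y
    -- both sides are 0 by the convention on division.
    by_cases hy : y - star y = 0
    · rw [hy]; simp
    · field_simp
      ring
  unfold hypCoeff
  simp only [h]
  fin_cases j <;> fin_cases k <;> simp only [Fin.zero_eta, Fin.mk_one, Matrix.of_apply,
    Matrix.cons_val]
  · exact contDiffOn_inv_sub_star_fst.pow 2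
  · exact contDiffOn_const
  · exact contDiffOn_const
  · exact contDiffOn_inv_sub_star_snd.pow 2

lemma contDiffOn_R (M : Matrix (Fin 2) (Fin 2) ℝ) : ContDiffOn ℝ ∞ (fun z => R z M) HH :=
  isQuadraticFamily_R.contDiffOn M

lemma isSmooth_schwartzForm (r : ℝ) (M : Matrix (Fin 2) (Fin 2) ℝ) :
    (schwartzForm r M).IsSmooth := fun j k =>
  (contDiffOn_const.mul (Complex.ofRealCLM.contDiff.comp_contDiffOn
    (Real.contDiff_exp.comp_contDiffOn (contDiffOn_const.mul (contDiffOn_R M)).neg))).mul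
    ((contDiffOn_const.mul ((isQuadraticFamily_quadCoeff j k).contDiffOn M)).add
      (contDiffOn_hypCoeff j k))

/-! ### Currents -/

lemma integrable_wedge {α η : Form11} (hα : ∀ j k, ContinuousOn (α j k) HH) (hη : η.IsTest) :
    Integrable (wedge α η) := by
  have h : ∀ j k j' k', Integrable fun z => α j k z * η j' k' z := fun j k j' k' =>
    integrable_mul_of_tsupport isOpen_HH (hα j k) (hη j' k').1.continuous (hη j' k').2.1
      (hη j' k').2.2
  exact (((h _ _ _ _).add (h _ _ _ _)).sub (h _ _ _ _)).sub (h _ _ _ _)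

lemma formCurrent_sub {α β η : Form11} (hα : ∀ j k, ContinuousOn (α j k) HH)
    (hβ : ∀ j k, ContinuousOn (β j k) HH) (hη : η.IsTest) :
    formCurrent (fun j k z => α j k z - β j k z) η = formCurrent α η - formCurrent β η := by
  rw [formCurrent, formCurrent, formCurrent, topIntegral, topIntegral, topIntegral,
    ← integral_sub ((integrable_wedge hα hη).const_mul _).integrableOn
      ((integrable_wedge hβ hη).const_mul _).integrableOn]
  congr 1
  funext z
  simp only [wedge]
  ring

/-- The regularized current equation. -/
lemma topIntegral_negEiTrunc (n r : ℝ) (M : Matrix (Fin 2) (Fin 2) ℝ) {η : Form11}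
    (hη : η.IsTest) :
    topIntegral (fun z => (negEiTrunc n (2 * Real.pi * r * R z M) : ℂ) * ddc η z)
      = formCurrent (schwartzForm r M) η - formCurrent (schwartzForm (n * r) M) η := by
  rw [← formCurrent_sub (fun j k => (isSmooth_schwartzForm r M j k).continuousOn)
    (fun j k => (isSmooth_schwartzForm _ M j k).continuousOn) hη]
  refine topIntegral_mul_ddc ?_ hη fun j k z hz => dZbar_dZ_negEiTrunc n r M j k hz
  exact_mod_cast contDiffOn_infty.1 (Complex.ofRealCLM.contDiff.comp_contDiffOn
    ((contDiff_negEiTrunc n).comp_contDiffOn (contDiffOn_const.mul (contDiffOn_R M)))) 2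

/-! ### The curves `D_M` -/

/-- The denominator `d w - c` of the parametrization of `D_M`. -/
def curveDenom (M : Matrix (Fin 2) (Fin 2) ℝ) (w : ℂ) : ℂ := M 1 1 * w - M 1 0

/-- The parametrization `z₁ = (b w - a) / (d w - c)` of `D_M`. -/
def curveMap (M : Matrix (Fin 2) (Fin 2) ℝ) (w : ℂ) : ℂ :=
  (M 0 1 * w - M 0 0) / curveDenom M w

/-- The imaginary part gives a = 0, then the real part gives b = 0. All nonvanishing statements for
real polynomials on the upper half plane reduce to this. -/
lemma ofReal_mul_sub_eq_zero {a b : ℝ} {w : ℂ} (hw : 0 < w.im) (h : (a : ℂ) * w - b = 0) :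
    a = 0 ∧ b = 0 := by
  have h1 := congrArg Complex.im h
  have h2 := congrArg Complex.re h
  simp at h1 h2
  have : a = 0 := h1.resolve_right hw.ne'
  subst this
  simp at h2
  exact ⟨rfl, h2⟩

lemma curveDenom_ne_zero {M : Matrix (Fin 2) (Fin 2) ℝ} (hM : M.det ≠ 0) {w : ℂ}
    (hw : 0 < w.im) : curveDenom M w ≠ 0 := fun h => by
  obtain ⟨h1, h2⟩ := ofReal_mul_sub_eq_zero hw h
  exact hM (by rw [Matrix.det_fin_two, h1, h2]; ring)

lemma bilin_eq_mul {M : Matrix (Fin 2) (Fin 2) ℝ} {w : ℂ} (hw : curveDenom M w ≠ 0) (z : ℂ) :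
    bilin M z w = curveDenom M w * (z - curveMap M w) := by
  rw [mul_sub, curveMap, mul_div_cancel₀ _ hw, bilin, curveDenom]
  ring

lemma im_curveMap (M : Matrix (Fin 2) (Fin 2) ℝ) {w : ℂ} (hw : curveDenom M w ≠ 0) :
    (curveMap M w).im = M.det * w.im / ‖curveDenom M w‖ ^ 2 := by
  have h : Complex.normSq (curveDenom M w) ≠ 0 := by simpa using hw
  rw [curveMap, Complex.div_im, ← Complex.normSq_eq_norm_sq, Matrix.det_fin_two]
  field_simp
  simp [curveDenom]
  ring

/-- A zero would give z₁ = `curveMap M z.2`, whose imaginary part has the sign of det M and so is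
not positive. If the denominator vanishes, then c = d = 0, and the equation forces a = b = 0 as
well. -/
lemma bilin_ne_zero {M : Matrix (Fin 2) (Fin 2) ℝ} (hM : M ≠ 0) (hd : M.det ≤ 0) {z : ℂ × ℂ}
    (hz : z ∈ HH) : bilin M z.1 z.2 ≠ 0 := fun h => by
  by_cases hw : curveDenom M z.2 = 0
  · obtain ⟨h1, h2⟩ := ofReal_mul_sub_eq_zero hz.2 hw
    have h3 : (M 0 1 : ℂ) * z.2 - M 0 0 = 0 := by
      rw [bilin, h1, h2] at h
      simp at h
      linear_combination -h
    obtain ⟨h4, h5⟩ := ofReal_mul_sub_eq_zero hz.2 h3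
    apply hM
    ext i j
    fin_cases i <;> fin_cases j <;> simpa
  · rw [bilin_eq_mul hw] at h
    have h1 : z.1 = curveMap M z.2 := sub_eq_zero.1 ((mul_eq_zero.1 h).resolve_left hw)
    have h2 := im_curveMap M hw
    rw [← h1] at h2
    have : M.det * z.2.im / ‖curveDenom M z.2‖ ^ 2 ≤ 0 :=
      div_nonpos_of_nonpos_of_nonneg (mul_nonpos_of_nonpos_of_nonneg hd hz.2.le) (by positivity)
    linarith [hz.1]

lemma im_curveMap_pos {M : Matrix (Fin 2) (Fin 2) ℝ} (hM : 0 < M.det) {w : ℂ}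
    (hw : 0 < w.im) : 0 < (curveMap M w).im := by
  have h := curveDenom_ne_zero hM.ne' hw
  rw [im_curveMap M h]
  positivity

lemma R_nonneg {z : ℂ × ℂ} (hz : z ∈ HH) (M : Matrix (Fin 2) (Fin 2) ℝ) : 0 ≤ R z M := by
  have := hz.1
  have := hz.2
  rw [R_eq]
  positivity

lemma R_eq_zero_iff {z : ℂ × ℂ} (hz : z ∈ HH) (M : Matrix (Fin 2) (Fin 2) ℝ) :
    R z M = 0 ↔ bilin M z.1 z.2 = 0 := by
  have h1 := hz.1.ne'
  have h2 := hz.2.ne'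
  rw [R_eq, div_eq_zero_iff]
  simp [h1, h2]

lemma R_pos_iff {z : ℂ × ℂ} (hz : z ∈ HH) (M : Matrix (Fin 2) (Fin 2) ℝ) :
    0 < R z M ↔ bilin M z.1 z.2 ≠ 0 := by
  rw [(R_nonneg hz M).lt_iff_ne', Ne, R_eq_zero_iff hz]

/-- Only z₂ has to be in the upper half plane: positive determinant puts the image point there
automatically. -/
lemma mem_DM_iff {M : Matrix (Fin 2) (Fin 2) ℝ} (hM : 0 < M.det) {z : ℂ × ℂ} (hz : 0 < z.2.im) :
    z ∈ DM M ↔ z.1 = curveMap M z.2 := by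
  have h := curveDenom_ne_zero hM.ne' hz
  constructor
  · rintro ⟨h1, h2⟩
    rw [R_eq_zero_iff h1, bilin_eq_mul h] at h2
    exact sub_eq_zero.1 ((mul_eq_zero.1 h2).resolve_left h)
  · intro h1
    have hz' : z ∈ HH := ⟨by rw [h1]; exact im_curveMap_pos hM hz, hz⟩
    exact ⟨hz', by rw [R_eq_zero_iff hz', bilin_eq_mul h, h1]; simp⟩

lemma hasDerivAt_curveMap {M : Matrix (Fin 2) (Fin 2) ℝ} {w : ℂ} (hw : curveDenom M w ≠ 0) :
    HasDerivAt (curveMap M) (M.det / curveDenom M w ^ 2) w := by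
  have h1 : HasDerivAt (fun w : ℂ => (M 0 1 : ℂ) * w - M 0 0) (M 0 1) w := by
    simpa using ((hasDerivAt_id w).const_mul (M 0 1 : ℂ)).sub_const (M 0 0 : ℂ)
  have h2 : HasDerivAt (curveDenom M) (M 1 1) w :=
    (((hasDerivAt_id w).const_mul (M 1 1 : ℂ)).sub_const (M 1 0 : ℂ)).congr_deriv (mul_one _)
  refine (h1.div h2 hw).congr_deriv ?_
  congr 1
  rw [Matrix.det_fin_two, curveDenom]
  push_cast
  ring

lemma isOpen_upper : IsOpen {w : ℂ | 0 < w.im} := isOpen_lt continuous_const Complex.continuous_im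

lemma continuous_curveDenom (M : Matrix (Fin 2) (Fin 2) ℝ) : Continuous (curveDenom M) :=
  (continuous_const.mul continuous_id).sub continuous_const

lemma continuousAt_curveMap {M : Matrix (Fin 2) (Fin 2) ℝ} (hM : M.det ≠ 0) {w : ℂ}
    (hw : 0 < w.im) : ContinuousAt (curveMap M) w :=
  (hasDerivAt_curveMap (curveDenom_ne_zero hM hw)).continuousAt

lemma analyticAt_curveMap {M : Matrix (Fin 2) (Fin 2) ℝ} (hM : M.det ≠ 0) {w : ℂ}
    (hw : 0 < w.im) : AnalyticAt ℂ (curveMap M) w := by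
  refine DifferentiableOn.analyticAt (s := {w : ℂ | 0 < w.im}) (fun x hx => ?_)
    (isOpen_upper.mem_nhds hw)
  exact (hasDerivAt_curveMap (curveDenom_ne_zero hM hx)).differentiableAt.differentiableWithinAt

/-- The coefficient of `dw ∧ dw̄` in the pullback of `η` to `D_M`. -/
def curvePull (M : Matrix (Fin 2) (Fin 2) ℝ) (η : Form11) (w : ℂ) : ℂ :=
  let s : ℂ := deriv (curveMap M) w
  let p : ℂ × ℂ := (curveMap M w, w)
  η 0 0 p * (s * star s) + η 0 1 p * s + η 1 0 p * star s + η 1 1 p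

/-- A local branch of a curve containing `D_M` has the same derivative as `D_M`. -/
lemma IsBranch.deriv_eq {Z : Set (ℂ × ℂ)} {M : Matrix (Fin 2) (Fin 2) ℝ} (hM : 0 < M.det)
    (hZ : DM M ⊆ Z) {w : ℂ} (hw : 0 < w.im) {f : ℂ → ℂ} (hf : IsBranch Z (curveMap M w, w) f) :
    deriv f w = deriv (curveMap M) w := by
  apply Filter.EventuallyEq.deriv_eq
  have hc : Tendsto (fun w' => (curveMap M w', w')) (𝓝 w) (𝓝 (curveMap M w, w)) :=
    (continuousAt_curveMap hM.ne' hw).prodMk continuousAt_id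
  -- Points of D_M near the base point lie in `Z`, hence on the graph of f, so f agrees with
  -- `curveMap M` near w.
  filter_upwards [hc.eventually hf.2.2, isOpen_upper.mem_nhds hw] with w' h1 h2
  exact (h1.1 (hZ ((mem_DM_iff hM (z := (curveMap M w', w')) h2).2 rfl))).symm

lemma isBranch_DM {M : Matrix (Fin 2) (Fin 2) ℝ} (hM : 0 < M.det) {w : ℂ} (hw : 0 < w.im) :
    IsBranch (DM M) (curveMap M w, w) (curveMap M) := by
  refine ⟨analyticAt_curveMap hM.ne' hw, rfl, ?_⟩
  filter_upwards [(isOpen_upper.preimage continuous_snd).mem_nhds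
    (show (curveMap M w, w) ∈ Prod.snd ⁻¹' {w : ℂ | 0 < w.im} from hw)] with q hq
  exact mem_DM_iff hM hq

lemma IsBranch.mem {Z : Set (ℂ × ℂ)} {p : ℂ × ℂ} {f : ℂ → ℂ} (h : IsBranch Z p f) : p ∈ Z :=
  h.2.2.self_of_nhds.2 h.2.1.symm

/-- Over each w there is exactly one branch, so the inner sum has one term. The germ supplied by
`choose` is arbitrary, but its derivative at w is determined. -/
lemma curveCurrent_DM_of_pos {M : Matrix (Fin 2) (Fin 2) ℝ} (hM : 0 < M.det) (η : Form11) :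
    curveCurrent (DM M) η = ∫ w in {w : ℂ | 0 < w.im}, (-2 * Complex.I) * curvePull M η w := by
  refine setIntegral_congr_fun isOpen_upper.measurableSet fun w (hw : 0 < w.im) => ?_
  have hb : ∃ f, IsBranch (DM M) (curveMap M w, w) f := ⟨_, isBranch_DM hM hw⟩
  let b : {z₁ : ℂ // ∃ f, IsBranch (DM M) (z₁, w) f} := ⟨curveMap M w, hb⟩
  have hu : ∀ x : {z₁ : ℂ // ∃ f, IsBranch (DM M) (z₁, w) f}, x = b := fun x => by
    obtain ⟨f, hf⟩ := x.2
    exact Subtype.ext ((mem_DM_iff hM (z := (x.1, w)) hw).1 hf.mem)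
  rw [tsum_eq_single b fun x hx => absurd (hu x) hx]
  have hs := b.2.choose_spec.deriv_eq hM subset_rfl hw
  simp only [curvePull, hs]
  rfl

lemma curveCurrent_empty (η : Form11) : curveCurrent ∅ η = 0 := by
  rw [curveCurrent]
  refine integral_eq_zero_of_ae (Eventually.of_forall fun w => ?_)
  have : IsEmpty {z₁ : ℂ // ∃ f, IsBranch ∅ (z₁, w) f} :=
    ⟨fun x => by obtain ⟨f, hf⟩ := x.2; exact hf.mem⟩
  simp

lemma DM_eq_empty {M : Matrix (Fin 2) (Fin 2) ℝ} (hM : M ≠ 0) (hd : M.det ≤ 0) : DM M = ∅ := by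
  ext z
  simp only [mem_empty_iff_false, iff_false]
  rintro ⟨hz, h⟩
  exact bilin_ne_zero hM hd hz ((R_eq_zero_iff hz M).1 h)

/-! ### Gaussian estimates -/

lemma integral_gaussian_complex {b : ℝ} (hb : 0 < b) (a : ℂ) :
    ∫ s : ℂ, Real.exp (-b * ‖s - a‖ ^ 2) = Real.pi / b := by
  rw [integral_sub_right_eq_self (fun s : ℂ => Real.exp (-b * ‖s‖ ^ 2)) a,
    GaussianFourier.integral_rexp_neg_mul_sq_norm hb]
  simp

/-- The integral is already known to be π/b ≠ 0, whereas the integral of a non-integrable function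
is 0 by convention. -/
lemma integrable_gaussian_complex {b : ℝ} (hb : 0 < b) (a : ℂ) :
    Integrable fun s : ℂ => Real.exp (-b * ‖s - a‖ ^ 2) := by
  by_contra h
  have h1 := integral_gaussian_complex hb a
  rw [integral_undef h] at h1
  have := Real.pi_pos
  have : 0 < Real.pi / b := by positivity
  linarith

/-! ### Integrability across the curve D_M -/

lemma measurable_R (M : Matrix (Fin 2) (Fin 2) ℝ) : Measurable fun z => R z M := by
  unfold R
  have h1 : Measurable fun z : ℂ × ℂ => z.1.im := Complex.measurable_im.comp measurable_fst
  have h2 : Measurable fun z : ℂ × ℂ => z.2.im := Complex.measurable_im.comp measurable_snd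
  fun_prop

lemma measurable_curveMap (M : Matrix (Fin 2) (Fin 2) ℝ) : Measurable (curveMap M) := by
  unfold curveMap curveDenom
  fun_prop

/-- On compact sets `R` is bounded below by the squared fibre distance to `D_M`. -/
lemma exists_mul_sq_le_R {M : Matrix (Fin 2) (Fin 2) ℝ} (hM : 0 < M.det) {K : Set (ℂ × ℂ)}
    (hK : IsCompact K) (hKH : K ⊆ HH) :
    ∃ κ > 0, ∀ z ∈ K, κ * ‖z.1 - curveMap M z.2‖ ^ 2 ≤ R z M := by
  have hpos : ∀ z ∈ K, 0 < ‖curveDenom M z.2‖ ^ 2 / (2 * z.1.im * z.2.im) := fun z hz => by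
    have h0 := curveDenom_ne_zero hM.ne' (hKH hz).2
    have h1 := (hKH hz).1
    have h2 := (hKH hz).2
    positivity
  have hc : ContinuousOn (fun z : ℂ × ℂ => ‖curveDenom M z.2‖ ^ 2 / (2 * z.1.im * z.2.im)) K := by
    refine ContinuousOn.div ?_ ?_ fun z hz => ?_
    · exact ((continuous_curveDenom M).comp continuous_snd).norm.pow 2 |>.continuousOn
    · exact ((continuous_const.mul (Complex.continuous_im.comp continuous_fst)).mul
        (Complex.continuous_im.comp continuous_snd)).continuousOn
    · have h1 := (hKH hz).1
      have h2 := (hKH hz).2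
      positivity
  obtain ⟨κ, hκ, h⟩ : ∃ κ > 0, ∀ z ∈ K, κ ≤ ‖curveDenom M z.2‖ ^ 2 / (2 * z.1.im * z.2.im) := by
    rcases K.eq_empty_or_nonempty with rfl | hne
    · exact ⟨1, one_pos, by simp⟩
    · obtain ⟨z₀, hz₀, hmin⟩ := hK.exists_isMinOn hne hc
      exact ⟨_, hpos z₀ hz₀, fun z hz => hmin hz⟩
  refine ⟨κ, hκ, fun z hz => ?_⟩
  rw [R_eq, bilin_eq_mul (curveDenom_ne_zero hM.ne' (hKH hz).2), norm_mul, mul_pow, mul_div_right_comm]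
  exact mul_le_mul_of_nonneg_right (h z hz) (by positivity)

/-- `∫_K exp (-t R) = O(1 / t)`. -/
lemma exists_setIntegral_exp_neg_R_le {M : Matrix (Fin 2) (Fin 2) ℝ} (hM : 0 < M.det)
    {K : Set (ℂ × ℂ)} (hK : IsCompact K) (hKH : K ⊆ HH) :
    ∃ C, ∀ t, 0 < t → ∫ z in K, Real.exp (-t * R z M) ≤ C / t := by
  obtain ⟨κ, hκ, hR⟩ := exists_mul_sq_le_R hM hK hKH
  set K₂ := Prod.snd '' K with hK₂
  have hK₂c : IsCompact K₂ := hK.image continuous_snd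
  -- After enlarging K to the cylinder over its projection K₂, each fibre contributes a full plane
  -- Gaussian, π/(tκ).
  refine ⟨Real.pi / κ * (volume.real K₂), fun t ht => ?_⟩
  have htκ : 0 < t * κ := mul_pos ht hκ
  have hmeas : Measurable fun z : ℂ × ℂ => Real.exp (-(t * κ) * ‖z.1 - curveMap M z.2‖ ^ 2) := by
    have : Measurable fun z : ℂ × ℂ => curveMap M z.2 := (measurable_curveMap M).comp measurable_snd
    have h2 : Measurable fun z : ℂ × ℂ => z.1 - curveMap M z.2 := measurable_fst.sub this
    exact Real.measurable_exp.comp ((h2.norm.pow_const 2).const_mul _)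
  have hfin : IsFiniteMeasure ((volume : Measure ℂ).restrict K₂) :=
    ⟨by rw [Measure.restrict_apply_univ]; exact hK₂c.measure_lt_top⟩
  have hint : Integrable (fun z : ℂ × ℂ => Real.exp (-(t * κ) * ‖z.1 - curveMap M z.2‖ ^ 2))
      ((volume : Measure ℂ).prod ((volume : Measure ℂ).restrict K₂)) := by
    rw [integrable_prod_iff' hmeas.aestronglyMeasurable]
    refine ⟨Eventually.of_forall fun w => integrable_gaussian_complex htκ (curveMap M w), ?_⟩
    simp only [Real.norm_eq_abs, Real.abs_exp, integral_gaussian_complex htκ]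
    exact integrable_const _
  have hprod : (volume : Measure ℂ).prod ((volume : Measure ℂ).restrict K₂)
      = (volume : Measure (ℂ × ℂ)).restrict (univ ×ˢ K₂) := by
    rw [Measure.volume_eq_prod, ← Measure.prod_restrict, Measure.restrict_univ]
  have hsub : K ⊆ univ ×ˢ K₂ := fun z hz => ⟨mem_univ _, mem_image_of_mem _ hz⟩
  calc ∫ z in K, Real.exp (-t * R z M)
      ≤ ∫ z in K, Real.exp (-(t * κ) * ‖z.1 - curveMap M z.2‖ ^ 2) := by
        refine setIntegral_mono_on ?_ ?_ hK.measurableSet fun z hz => ?_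
        · refine ContinuousOn.integrableOn_compact hK ?_
          exact (continuousOn_const.mul ((contDiffOn_R M).continuousOn.mono hKH)).rexp
        · rw [hprod] at hint
          exact IntegrableOn.mono_set hint hsub
        · apply Real.exp_le_exp.2
          have := mul_le_mul_of_nonneg_left (hR z hz) ht.le
          linarith
    _ ≤ ∫ z in univ ×ˢ K₂, Real.exp (-(t * κ) * ‖z.1 - curveMap M z.2‖ ^ 2) := by
        rw [hprod] at hint
        exact setIntegral_mono_set hint (Eventually.of_forall fun z => (Real.exp_pos _).le)
          (Eventually.of_forall hsub)
    _ = Real.pi / κ * (volume.real K₂) / t := by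
        rw [← hprod, integral_prod_symm _ hint]
        simp only [integral_gaussian_complex htκ, integral_const, smul_eq_mul,
          measureReal_restrict_apply_univ]
        field_simp

lemma continuousOn_negEi_comp_R {r : ℝ} (hr : 0 < r) {M : Matrix (Fin 2) (Fin 2) ℝ}
    {s : Set (ℂ × ℂ)} (hs : s ⊆ HH) (h : ∀ z ∈ s, bilin M z.1 z.2 ≠ 0) :
    ContinuousOn (fun z => negEi (2 * Real.pi * r * R z M)) s := by
  refine contDiffOn_negEi.continuousOn.comp
    (continuousOn_const.mul ((contDiffOn_R M).continuousOn.mono hs)) fun z hz => ?_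
  have := (R_pos_iff (hs hz) M).2 (h z hz)
  have := Real.pi_pos
  exact (by positivity : 0 < 2 * Real.pi * r * R z M)

/-- For det M > 0, insert the integral defining -Ei and integrate over K first: the inner integral
is at most C/(2πr t²), which is integrable over t > 1. For det M ≤ 0 the function is continuous on
K, as R has no zeros. -/
lemma integrableOn_negEi_comp_R {r : ℝ} (hr : 0 < r) {M : Matrix (Fin 2) (Fin 2) ℝ} (hM : M ≠ 0)
    {K : Set (ℂ × ℂ)} (hK : IsCompact K) (hKH : K ⊆ HH) :
    IntegrableOn (fun z => negEi (2 * Real.pi * r * R z M)) K := by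
  have hpi := Real.pi_pos
  rcases le_or_gt M.det 0 with hd | hd
  · exact (continuousOn_negEi_comp_R hr hKH fun z hz =>
      bilin_ne_zero hM hd (hKH hz)).integrableOn_compact hK
  obtain ⟨C, hC⟩ := exists_setIntegral_exp_neg_R_le hd hK hKH
  have hfin : IsFiniteMeasure (volume.restrict K) :=
    ⟨by rw [Measure.restrict_apply_univ]; exact hK.measure_lt_top⟩
  have hmeas : Measurable fun p : (ℂ × ℂ) × ℝ =>
      Real.exp (-(2 * Real.pi * r * R p.1 M) * p.2) / p.2 := by
    have : Measurable fun p : (ℂ × ℂ) × ℝ => R p.1 M := (measurable_R M).comp measurable_fst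
    have h2 : Measurable fun p : (ℂ × ℂ) × ℝ => -(2 * Real.pi * r * R p.1 M) * p.2 :=
      (this.const_mul _).neg.mul measurable_snd
    exact (Real.measurable_exp.comp h2).div measurable_snd
  have key : Integrable (fun p : (ℂ × ℂ) × ℝ =>
      Real.exp (-(2 * Real.pi * r * R p.1 M) * p.2) / p.2)
      ((volume.restrict K).prod (volume.restrict (Ioi (1 : ℝ)))) := by
    rw [integrable_prod_iff' hmeas.aestronglyMeasurable]
    constructor
    · refine Eventually.of_forall fun t => ?_
      refine Integrable.div_const ?_ _
      refine ContinuousOn.integrableOn_compact hK ?_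
      exact (((continuousOn_const.mul
        ((contDiffOn_R M).continuousOn.mono hKH)).neg).mul continuousOn_const).rexp
    · have hb : IntegrableOn (fun t : ℝ => C / (2 * Real.pi * r) * t ^ (-2 : ℝ)) (Ioi 1) :=
        (integrableOn_Ioi_rpow_of_lt (by norm_num) one_pos).const_mul _
      refine hb.mono' ?_ ?_
      · exact hmeas.norm.stronglyMeasurable.integral_prod_left'.aestronglyMeasurable
      · refine (ae_restrict_iff' measurableSet_Ioi).2
          (Eventually.of_forall fun t (ht : 1 < t) => ?_)
        have ht0 : 0 < t := by linarith
        rw [Real.norm_eq_abs, abs_of_nonneg (integral_nonneg fun _ => norm_nonneg _)]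
        have h1 := hC (2 * Real.pi * r * t) (by positivity)
        have h2 : ∫ z in K, ‖Real.exp (-(2 * Real.pi * r * R z M) * t) / t‖
            = (∫ z in K, Real.exp (-(2 * Real.pi * r * t) * R z M)) / t := by
          rw [← integral_div]
          refine integral_congr_ae (Eventually.of_forall fun z => ?_)
          beta_reduce
          rw [Real.norm_eq_abs, abs_of_nonneg (by positivity)]
          ring_nf
        rw [h2, Real.rpow_neg ht0.le]
        calc _ ≤ C / (2 * Real.pi * r * t) / t := by gcongr
          _ = _ := by
            rw [Real.rpow_two]
            field_simp
  exact key.integral_prod_left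

/-! ### Concentration of the Schwartz form along `D_M` -/

lemma R_curveMap_add {M : Matrix (Fin 2) (Fin 2) ℝ} {w : ℂ}
    (hw : curveDenom M w ≠ 0) (s : ℂ) :
    R (curveMap M w + s, w) M
      = ‖curveDenom M w‖ ^ 2 * ‖s‖ ^ 2 / (2 * (curveMap M w + s).im * w.im) := by
  rw [R_eq, bilin_eq_mul hw, norm_mul, mul_pow]
  simp

/-- Substitute z = g + s/√n, where g is the point of D_M over w. The Jacobian absorbs the factor n,
and the exponent tends to -πr|dw - c|²|s|²/(Im g · Im w), whose Gaussian integral is the stated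
constant. On the support of G the lower bound for R gives a majorant independent of n. -/
lemma tendsto_fibre_integral {M : Matrix (Fin 2) (Fin 2) ℝ} (hM : 0 < M.det) {r : ℝ} (hr : 0 < r)
    {G : ℂ × ℂ → ℂ} (hG : Continuous G) (hc : HasCompactSupport G) (hs : tsupport G ⊆ HH) {w : ℂ}
    (hw : 0 < w.im) :
    Tendsto (fun n : ℝ => ∫ z : ℂ,
        ((n * Real.exp (-(2 * Real.pi * (n * r) * R (z, w) M)) : ℝ) : ℂ) * G (z, w)) atTop
      (𝓝 (((curveMap M w).im * w.im / (r * ‖curveDenom M w‖ ^ 2) : ℝ) * G (curveMap M w, w))) := by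
  have hpi := Real.pi_pos
  obtain ⟨κ, hκ, hR⟩ := exists_mul_sq_le_R hM hc.isCompact hs
  obtain ⟨C, hC⟩ := hc.exists_bound_of_continuous hG
  have hC0 : 0 ≤ C := (norm_nonneg _).trans (hC 0)
  have hd := curveDenom_ne_zero hM.ne' hw
  have hg := im_curveMap_pos hM hw
  set g := curveMap M w with hgdef
  have hR0 : 0 < 2 * Real.pi * r * κ := by positivity
  have e : ∀ᶠ n : ℝ in atTop, ∫ s : ℂ,
      ((Real.exp (-(2 * Real.pi * (n * r) * R (g + (Real.sqrt n)⁻¹ • s, w) M)) : ℝ) : ℂ)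
        * G (g + (Real.sqrt n)⁻¹ • s, w) = ∫ z : ℂ,
        ((n * Real.exp (-(2 * Real.pi * (n * r) * R (z, w) M)) : ℝ) : ℂ) * G (z, w) := by
    filter_upwards [eventually_gt_atTop 0] with n hn
    rw [Measure.integral_comp_smul volume (fun s : ℂ =>
      ((Real.exp (-(2 * Real.pi * (n * r) * R (g + s, w) M)) : ℝ) : ℂ) * G (g + s, w)),
      integral_add_left_eq_self (fun z : ℂ =>
      ((Real.exp (-(2 * Real.pi * (n * r) * R (z, w) M)) : ℝ) : ℂ) * G (z, w)),
      Complex.finrank_real_complex, inv_pow, inv_inv, Real.sq_sqrt hn.le, abs_of_pos hn,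
      ← integral_smul]
    refine integral_congr_ae (Eventually.of_forall fun z => ?_)
    simp only [Complex.real_smul]
    push_cast
    ring
  refine Tendsto.congr' e ?_
  have hlim : ∫ s : ℂ, ((Real.exp (-(Real.pi * r * ‖curveDenom M w‖ ^ 2 / (g.im * w.im))
      * ‖s - 0‖ ^ 2) : ℝ) : ℂ) * G (g, w)
      = ((g.im * w.im / (r * ‖curveDenom M w‖ ^ 2) : ℝ) * G (g, w)) := by
    rw [integral_mul_const, integral_complex_ofReal, integral_gaussian_complex (by positivity)]
    congr 2
    field_simp
  rw [← hlim]
  have hsq : Tendsto (fun n : ℝ => (Real.sqrt n)⁻¹) atTop (𝓝 0) :=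
    tendsto_inv_atTop_zero.comp Real.tendsto_sqrt_atTop
  have hp : ∀ s : ℂ, Tendsto (fun n : ℝ => g + (Real.sqrt n)⁻¹ • s) atTop (𝓝 g) := fun s => by
    simpa using tendsto_const_nhds.add (hsq.smul_const s)
  refine tendsto_integral_filter_of_dominated_convergence
    (fun s => Real.exp (-(2 * Real.pi * r * κ) * ‖s - 0‖ ^ 2) * C) ?_ ?_ ?_ ?_
  · refine Eventually.of_forall fun n => Measurable.aestronglyMeasurable ?_
    have h1 : Measurable fun s : ℂ => (g + (Real.sqrt n)⁻¹ • s, w) := by fun_prop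
    have h2 : Measurable fun s : ℂ => R (g + (Real.sqrt n)⁻¹ • s, w) M :=
      (measurable_R M).comp h1
    have h3 := hG.measurable.comp h1
    exact (Complex.measurable_ofReal.comp (Real.measurable_exp.comp (h2.const_mul _).neg)).mul h3
  · filter_upwards [eventually_gt_atTop 0] with n hn
    refine Eventually.of_forall fun s => ?_
    by_cases hz : (g + (Real.sqrt n)⁻¹ • s, w) ∈ tsupport G
    · rw [norm_mul, Complex.norm_real, Real.norm_eq_abs, Real.abs_exp]
      refine mul_le_mul (Real.exp_le_exp.2 ?_) (hC _) (norm_nonneg _) (Real.exp_pos _).le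
      have h1 := hR _ hz
      simp only [← hgdef, add_sub_cancel_left, norm_smul, Real.norm_eq_abs, mul_pow, sq_abs,
        inv_pow, Real.sq_sqrt hn.le] at h1
      rw [sub_zero, neg_mul, neg_le_neg_iff]
      calc 2 * Real.pi * r * κ * ‖s‖ ^ 2
          = 2 * Real.pi * (n * r) * (κ * (n⁻¹ * ‖s‖ ^ 2)) := by field_simp
        _ ≤ _ := mul_le_mul_of_nonneg_left h1 (by positivity)
    · rw [image_eq_zero_of_notMem_tsupport hz, mul_zero, norm_zero]
      positivity
  · exact (integrable_gaussian_complex hR0 0).mul_const C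
  · refine Eventually.of_forall fun s => ?_
    refine Tendsto.mul ?_ ((hG.tendsto _).comp ((hp s).prodMk_nhds tendsto_const_nhds))
    refine (Complex.continuous_ofReal.tendsto _).comp ((Real.continuous_exp.tendsto _).comp ?_)
    have him : Tendsto (fun n : ℝ => (g + (Real.sqrt n)⁻¹ • s).im) atTop (𝓝 g.im) :=
      (Complex.continuous_im.tendsto _).comp (hp s)
    have h1 : Tendsto (fun n : ℝ => -(Real.pi * r * ‖curveDenom M w‖ ^ 2
        / ((g + (Real.sqrt n)⁻¹ • s).im * w.im)) * ‖s - 0‖ ^ 2) atTop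
        (𝓝 (-(Real.pi * r * ‖curveDenom M w‖ ^ 2 / (g.im * w.im)) * ‖s - 0‖ ^ 2)) :=
      ((tendsto_const_nhds.div (him.mul_const _) (by positivity)).neg).mul_const _
    refine h1.congr' ?_
    filter_upwards [eventually_gt_atTop 0] with n hn
    rw [R_curveMap_add hd, norm_smul, Real.norm_eq_abs, mul_pow, sq_abs, inv_pow,
      Real.sq_sqrt hn.le, sub_zero, ← hgdef]
    -- Here s is any complex number, so the shifted point may leave the upper half plane; if it is
    -- real, both sides vanish by the convention on division.
    by_cases h0 : (g + (Real.sqrt n)⁻¹ • s).im = 0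
    · rw [h0]; simp
    · field_simp

/-- The Gaussian integral π/(2πnrκ) cancels the factor n. The resulting bound, uniform in n and
supported on a compact set of w, allows passage to the limit in the outer integral. -/
lemma norm_fibre_integral_le {M : Matrix (Fin 2) (Fin 2) ℝ} {r : ℝ} (hr : 0 < r)
    {G : ℂ × ℂ → ℂ} {κ C : ℝ} (hκ : 0 < κ)
    (hR : ∀ z ∈ tsupport G, κ * ‖z.1 - curveMap M z.2‖ ^ 2 ≤ R z M) (hC : ∀ z, ‖G z‖ ≤ C)
    {n : ℝ} (hn : 0 < n) (w : ℂ) :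
    ‖∫ z : ℂ, ((n * Real.exp (-(2 * Real.pi * (n * r) * R (z, w) M)) : ℝ) : ℂ) * G (z, w)‖
      ≤ (Prod.snd '' tsupport G).indicator (fun _ => C / (2 * r * κ)) w := by
  have hpi := Real.pi_pos
  have hC0 : 0 ≤ C := (norm_nonneg _).trans (hC 0)
  by_cases hw : w ∈ Prod.snd '' tsupport G
  · rw [indicator_of_mem hw]
    have hb : 0 < 2 * Real.pi * (n * r) * κ := by positivity
    calc _ ≤ ∫ z : ℂ, n * Real.exp (-(2 * Real.pi * (n * r) * κ) * ‖z - curveMap M w‖ ^ 2) * C := by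
          refine norm_integral_le_of_norm_le
            (((integrable_gaussian_complex hb _).const_mul n).mul_const C)
            (Eventually.of_forall fun z => ?_)
          by_cases hz : (z, w) ∈ tsupport G
          · rw [norm_mul, Complex.norm_real, Real.norm_eq_abs, abs_of_nonneg (by positivity)]
            refine mul_le_mul (mul_le_mul_of_nonneg_left (Real.exp_le_exp.2 ?_) hn.le) (hC _)
              (norm_nonneg _) (by positivity)
            have := mul_le_mul_of_nonneg_left (hR _ hz)
              (by positivity : 0 ≤ 2 * Real.pi * (n * r))
            linarith
          · rw [image_eq_zero_of_notMem_tsupport hz, mul_zero, norm_zero]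
            positivity
      _ = C / (2 * r * κ) := by
          rw [integral_mul_const, integral_const_mul, integral_gaussian_complex hb]
          field_simp
  · rw [indicator_of_notMem hw]
    have h0 : ∀ z, G (z, w) = 0 := fun z =>
      image_eq_zero_of_notMem_tsupport fun h => hw ⟨_, h, rfl⟩
    simp [h0]

/-- Gaussian concentration along `D_M`. -/
lemma tendsto_integral_concentration {M : Matrix (Fin 2) (Fin 2) ℝ} (hM : 0 < M.det) {r : ℝ}
    (hr : 0 < r) {G : ℂ × ℂ → ℂ} (hG : Continuous G) (hc : HasCompactSupport G)
    (hs : tsupport G ⊆ HH) :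
    Tendsto (fun n : ℝ => ∫ z : ℂ × ℂ,
        ((n * Real.exp (-(2 * Real.pi * (n * r) * R z M)) : ℝ) : ℂ) * G z) atTop
      (𝓝 (∫ w in {w : ℂ | 0 < w.im},
        (((curveMap M w).im * w.im / (r * ‖curveDenom M w‖ ^ 2) : ℝ) * G (curveMap M w, w)))) := by
  obtain ⟨κ, hκ, hR⟩ := exists_mul_sq_le_R hM hc.isCompact hs
  obtain ⟨C, hC⟩ := hc.exists_bound_of_continuous hG
  have hint : ∀ n : ℝ, Integrable (fun z : ℂ × ℂ =>
      ((n * Real.exp (-(2 * Real.pi * (n * r) * R z M)) : ℝ) : ℂ) * G z) := fun n => by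
    refine integrable_mul_of_tsupport isOpen_HH ?_ hG hc hs
    exact Complex.continuous_ofReal.comp_continuousOn (continuousOn_const.mul
      ((continuousOn_const.mul (contDiffOn_R M).continuousOn).neg.rexp))
  have hfub : ∀ n : ℝ, ∫ w in {w : ℂ | 0 < w.im}, ∫ z : ℂ,
      ((n * Real.exp (-(2 * Real.pi * (n * r) * R (z, w) M)) : ℝ) : ℂ) * G (z, w)
      = ∫ z : ℂ × ℂ, ((n * Real.exp (-(2 * Real.pi * (n * r) * R z M)) : ℝ) : ℂ) * G z := fun n => by
    have h := hint n
    rw [Measure.volume_eq_prod] at h ⊢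
    rw [integral_prod_symm _ h]
    refine setIntegral_eq_integral_of_forall_compl_eq_zero fun w hw => ?_
    have h0 : ∀ z, G (z, w) = 0 := fun z =>
      image_eq_zero_of_notMem_tsupport fun h => hw (hs h).2
    simp [h0]
  simp_rw [← hfub]
  have hKc : IsCompact (Prod.snd '' tsupport G) := hc.isCompact.image continuous_snd
  refine tendsto_integral_filter_of_dominated_convergence
    ((Prod.snd '' tsupport G).indicator (fun _ => C / (2 * r * κ))) ?_ ?_ ?_ ?_
  · refine Eventually.of_forall fun n => ?_
    have h := hint n
    rw [Measure.volume_eq_prod] at h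
    exact h.integral_prod_right.aestronglyMeasurable.restrict
  · filter_upwards [eventually_gt_atTop 0] with n hn
    exact Eventually.of_forall fun w => norm_fibre_integral_le hr hκ hR hC hn w
  · refine Integrable.integrableOn ?_
    rw [integrable_indicator_iff hKc.measurableSet]
    exact integrableOn_const hKc.measure_lt_top.ne
  · refine (ae_restrict_iff' isOpen_upper.measurableSet).2 (Eventually.of_forall fun w hw => ?_)
    exact tendsto_fibre_integral hM hr hG hc hs hw

/-- Here R has no zeros, so it is bounded below by some κ > 0 on the compact support and the
integrand is at most n·exp(-2πrκn)·‖G‖. -/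
lemma tendsto_integral_concentration_of_nonpos {M : Matrix (Fin 2) (Fin 2) ℝ} (hM : M ≠ 0)
    (hd : M.det ≤ 0) {r : ℝ} (hr : 0 < r) {G : ℂ × ℂ → ℂ} (hG : Continuous G)
    (hc : HasCompactSupport G) (hs : tsupport G ⊆ HH) :
    Tendsto (fun n : ℝ => ∫ z : ℂ × ℂ,
        ((n * Real.exp (-(2 * Real.pi * (n * r) * R z M)) : ℝ) : ℂ) * G z) atTop (𝓝 0) := by
  have hpi := Real.pi_pos
  obtain ⟨κ, hκ, hR⟩ : ∃ κ > 0, ∀ z ∈ tsupport G, κ ≤ R z M := by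
    rcases (tsupport G).eq_empty_or_nonempty with h | hne
    · exact ⟨1, one_pos, by simp [h]⟩
    · obtain ⟨z₀, hz₀, hmin⟩ := hc.isCompact.exists_isMinOn hne
        ((contDiffOn_R M).continuousOn.mono hs)
      exact ⟨_, (R_pos_iff (hs hz₀) M).2 (bilin_ne_zero hM hd (hs hz₀)), fun z hz => hmin hz⟩
  have hGi : Integrable G := hG.integrable_of_hasCompactSupport hc
  have hlim : Tendsto (fun n : ℝ => n * Real.exp (-((2 * Real.pi * r * κ) * n))
      * ∫ z, ‖G z‖) atTop (𝓝 0) := by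
    have hb : 0 < 2 * Real.pi * r * κ := by positivity
    have h1 := ((Real.tendsto_pow_mul_exp_neg_atTop_nhds_zero 1).comp
      (tendsto_id.const_mul_atTop hb)).const_mul (2 * Real.pi * r * κ)⁻¹
    rw [mul_zero] at h1
    have h2 := h1.mul_const (∫ z, ‖G z‖)
    rw [zero_mul] at h2
    refine h2.congr fun n => ?_
    simp only [Function.comp, id, pow_one]
    field_simp
  refine squeeze_zero_norm' ?_ hlim
  filter_upwards [eventually_gt_atTop 0] with n hn
  rw [← integral_const_mul]
  refine norm_integral_le_of_norm_le (hGi.norm.const_mul _) (Eventually.of_forall fun z => ?_)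
  by_cases hz : z ∈ tsupport G
  · rw [norm_mul, Complex.norm_real, Real.norm_eq_abs, abs_of_nonneg (by positivity)]
    refine mul_le_mul_of_nonneg_right (mul_le_mul_of_nonneg_left (Real.exp_le_exp.2 ?_) hn.le)
      (norm_nonneg _)
    have := mul_le_mul_of_nonneg_left (hR _ hz) (by positivity : 0 ≤ 2 * Real.pi * (n * r))
    linarith
  · rw [image_eq_zero_of_notMem_tsupport hz, mul_zero, norm_zero]
    simp

/-! ### Pairing with test forms and the limit current -/

lemma continuous_wedge {α η : Form11} (hα : ∀ j k, ContinuousOn (α j k) HH) (hη : η.IsTest) :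
    Continuous (wedge α η) := by
  have h : ∀ j k j' k', Continuous fun z => α j k z * η j' k' z := fun j k j' k' =>
    continuous_mul_of_tsupport isOpen_HH (hα j k) (hη j' k').1.continuous (hη j' k').2.2
  exact (((h _ _ _ _).add (h _ _ _ _)).sub (h _ _ _ _)).sub (h _ _ _ _)

/-- A compact subset of `ℍ × ℍ` containing the support of a test form. -/
def Form11.supp (η : Form11) : Set (ℂ × ℂ) := ⋃ j, ⋃ k, tsupport (η j k)

lemma Form11.IsTest.isCompact_supp {η : Form11} (hη : η.IsTest) : IsCompact η.supp :=
  isCompact_iUnion fun j => isCompact_iUnion fun k => (hη j k).2.1.isCompact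

lemma Form11.IsTest.supp_subset {η : Form11} (hη : η.IsTest) : η.supp ⊆ HH :=
  iUnion_subset fun j => iUnion_subset fun k => (hη j k).2.2

lemma Form11.eq_zero_of_notMem_supp {η : Form11} {z : ℂ × ℂ} (hz : z ∉ η.supp) (j k : Fin 2) :
    η j k z = 0 :=
  image_eq_zero_of_notMem_tsupport fun h => hz (mem_iUnion_of_mem j (mem_iUnion_of_mem k h))

lemma support_wedge_subset (α η : Form11) : (wedge α η).support ⊆ η.supp := fun z hz => by
  by_contra h
  exact hz (by simp [wedge, Form11.eq_zero_of_notMem_supp h])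

lemma hasCompactSupport_wedge (α : Form11) {η : Form11} (hη : η.IsTest) :
    HasCompactSupport (wedge α η) :=
  HasCompactSupport.of_support_subset_isCompact hη.isCompact_supp (support_wedge_subset α η)

lemma tsupport_wedge_subset (α : Form11) {η : Form11} (hη : η.IsTest) :
    tsupport (wedge α η) ⊆ HH :=
  (closure_minimal (support_wedge_subset α η) hη.isCompact_supp.isClosed).trans hη.supp_subset

/-- Along `D_M` the leading coefficient of the Schwartz form gives the pullback to `D_M`. -/
lemma wedge_quadCoeff_curveMap {M : Matrix (Fin 2) (Fin 2) ℝ} (hM : 0 < M.det) (η : Form11)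
    {w : ℂ} (hw : 0 < w.im) :
    (((curveMap M w).im * w.im / ‖curveDenom M w‖ ^ 2 : ℝ) : ℂ)
      * wedge (quadCoeff M) η (curveMap M w, w) = (1 / 2) * curvePull M η w := by
  have hd := curveDenom_ne_zero hM.ne' hw
  have hg := im_curveMap_pos hM hw
  set g := curveMap M w with hgdef
  set c := curveDenom M w with hcdef
  have hgc : (g.im : ℂ) ≠ 0 := by exact_mod_cast hg.ne'
  have hwc : (w.im : ℂ) ≠ 0 := by exact_mod_cast hw.ne'
  have hcs : star c ≠ 0 := star_ne_zero.2 hd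
  have hn : ((‖c‖ ^ 2 : ℝ) : ℂ) = c * star c := by
    rw [← Complex.normSq_eq_norm_sq, ← Complex.mul_conj]; rfl
  have him : (g.im : ℂ) = M.det * w.im / (c * star c) := by
    rw [← hn, hgdef, im_curveMap M hd]; push_cast; rfl
  have hI : star g - g = -(2 * Complex.I * g.im) := by
    rw [ofReal_im_eq]; field_simp; ring
  -- On D_M the pair (P₀, P₁) is the gradient of f = c(w)(z₁ - g(w)), namely (c, -c g′) with g′ =
  -- det M / c². So the form with coefficients `quadCoeff` is |c|²/(2y₁y₂) times (dz₁ - g′dw) ∧ its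
  -- conjugate, and wedging with that pulls η back to the curve.
  have P0 : gradCoeff M 0 (g, w) = c := by
    simp only [gradCoeff, if_pos]
    rw [bilin_eq_mul hd, ← hgdef, ← hcdef, hI]
    field_simp
  have P1 : gradCoeff M 1 (g, w) = -(M.det / c) := by
    have : bilin M g (star w) = star (bilin M (star g) w) := by rw [star_bilin, star_star]
    simp only [gradCoeff, one_ne_zero, if_false]
    rw [this, bilin_eq_mul hd, ← hgdef, ← hcdef, hI, him]
    simp
    simp only [Complex.star_def] at hcs
    field_simp
  have hdm : M.det ≠ 0 := hM.ne'
  have hdc : (M.det : ℂ) ≠ 0 := by exact_mod_cast hdm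
  have hsd : star (M.det : ℂ) = M.det := Complex.conj_ofReal _
  simp only [wedge, quadCoeff, P0, P1, curvePull]
  rw [(hasDerivAt_curveMap hd).deriv, ← hgdef, ← hcdef]
  push_cast at hn ⊢
  rw [hn]
  simp only [star_neg, star_div₀, star_pow, hsd]
  field_simp
  ring

/-- The Schwartz forms converge to the current `δ_{D_M}`. -/
lemma tendsto_formCurrent_schwartzForm {M : Matrix (Fin 2) (Fin 2) ℝ} (hM : M ≠ 0) {r : ℝ}
    (hr : 0 < r) {η : Form11} (hη : η.IsTest) :
    Tendsto (fun n : ℝ => formCurrent (schwartzForm (n * r) M) η) atTop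
      (𝓝 (curveCurrent (DM M) η)) := by
  have hpi : (Real.pi : ℂ) ≠ 0 := by exact_mod_cast Real.pi_ne_zero
  have hA : ∀ j k, ContinuousOn (quadCoeff M j k) HH := fun j k =>
    ((isQuadraticFamily_quadCoeff j k).contDiffOn M).continuousOn
  have hB : ∀ j k, ContinuousOn (hypCoeff j k) HH := fun j k =>
    (contDiffOn_hypCoeff j k).continuousOn
  have hexp : ∀ n : ℝ, ContinuousOn (fun z =>
      ((n * Real.exp (-(2 * Real.pi * (n * r) * R z M)) : ℝ) : ℂ)) HH := fun n =>
    Complex.continuous_ofReal.comp_continuousOn (continuousOn_const.mul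
      ((continuousOn_const.mul (contDiffOn_R M).continuousOn).neg.rexp))
  have hI : ∀ (α : Form11) (_ : ∀ j k, ContinuousOn (α j k) HH) (n : ℝ), Integrable (fun z =>
      ((n * Real.exp (-(2 * Real.pi * (n * r) * R z M)) : ℝ) : ℂ) * wedge α η z) := fun α hα n =>
    integrable_mul_of_tsupport isOpen_HH (hexp n) (continuous_wedge hα hη)
      (hasCompactSupport_wedge α hη) (tsupport_wedge_subset α hη)
  -- The `quadCoeff` part carries exactly the factor n that the concentration lemma needs. For the
  -- `hypCoeff` part this factor is inserted by hand, leaving 1/n outside, so that part disappears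
  -- in the limit.
  have e : ∀ᶠ n : ℝ in atTop, (-4 * Complex.I * r) * (∫ z : ℂ × ℂ,
        ((n * Real.exp (-(2 * Real.pi * (n * r) * R z M)) : ℝ) : ℂ) * wedge (quadCoeff M) η z)
      + (n : ℂ)⁻¹ * ((2 / (Real.pi * Complex.I)) * ∫ z : ℂ × ℂ,
        ((n * Real.exp (-(2 * Real.pi * (n * r) * R z M)) : ℝ) : ℂ) * wedge hypCoeff η z)
      = formCurrent (schwartzForm (n * r) M) η := by
    filter_upwards [eventually_gt_atTop 0] with n hn
    have hnc : (n : ℂ) ≠ 0 := by exact_mod_cast hn.ne'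
    rw [formCurrent, topIntegral, setIntegral_eq_integral_of_forall_compl_eq_zero fun z hz => by
        rw [Function.notMem_support.1 fun h => hz (hη.supp_subset (support_wedge_subset _ η h)), mul_zero],
      ← integral_const_mul, ← integral_const_mul, ← integral_const_mul, ← integral_add
      ((hI _ hA n).const_mul _) (((hI _ hB n).const_mul _).const_mul _)]
    refine integral_congr_ae (Eventually.of_forall fun z => ?_)
    simp only [wedge, schwartzForm]
    push_cast
    field_simp
    rw [Complex.I_sq]
    ring
  refine Tendsto.congr' e ?_
  have hinv : Tendsto (fun n : ℝ => (n : ℂ)⁻¹) atTop (𝓝 0) := by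
    have := (Complex.continuous_ofReal.tendsto 0).comp tendsto_inv_atTop_zero
    simpa [Function.comp_def] using this
  rcases le_or_gt M.det 0 with hd | hd
  · rw [DM_eq_empty hM hd, curveCurrent_empty]
    have h1 := (tendsto_integral_concentration_of_nonpos hM hd hr (continuous_wedge hA hη)
      (hasCompactSupport_wedge _ hη) (tsupport_wedge_subset _ hη)).const_mul (-4 * Complex.I * r)
    have h2 := (tendsto_integral_concentration_of_nonpos hM hd hr (continuous_wedge hB hη)
      (hasCompactSupport_wedge _ hη) (tsupport_wedge_subset _ hη)).const_mul
        (2 / (Real.pi * Complex.I))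
    simpa using h1.add (hinv.mul h2)
  · rw [curveCurrent_DM_of_pos hd]
    have h1 := (tendsto_integral_concentration hd hr (continuous_wedge hA hη)
      (hasCompactSupport_wedge _ hη) (tsupport_wedge_subset _ hη)).const_mul (-4 * Complex.I * r)
    have h2 := (tendsto_integral_concentration hd hr (continuous_wedge hB hη)
      (hasCompactSupport_wedge _ hη) (tsupport_wedge_subset _ hη)).const_mul
        (2 / (Real.pi * Complex.I))
    have h3 := h1.add (hinv.mul h2)
    rw [zero_mul, add_zero, ← integral_const_mul] at h3
    have h4 : ∫ w in {w : ℂ | 0 < w.im}, (-4 * Complex.I * r) *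
        ((((curveMap M w).im * w.im / (r * ‖curveDenom M w‖ ^ 2) : ℝ) : ℂ)
          * wedge (quadCoeff M) η (curveMap M w, w))
        = ∫ w in {w : ℂ | 0 < w.im}, (-2 * Complex.I) * curvePull M η w := by
      refine setIntegral_congr_fun isOpen_upper.measurableSet fun w hw => ?_
      have h5 := wedge_quadCoeff_curveMap hd η hw
      have h6 : (((curveMap M w).im * w.im / (r * ‖curveDenom M w‖ ^ 2) : ℝ) : ℂ)
          = (r : ℂ)⁻¹ * (((curveMap M w).im * w.im / ‖curveDenom M w‖ ^ 2 : ℝ) : ℂ) := by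
        rw [← Complex.ofReal_inv, ← Complex.ofReal_mul]
        congr 1
        field_simp
      have hrc : (r : ℂ) ≠ 0 := by exact_mod_cast hr.ne'
      rw [h6]
      calc _ = (-4 * Complex.I) * ((((curveMap M w).im * w.im / ‖curveDenom M w‖ ^ 2 : ℝ) : ℂ)
          * wedge (quadCoeff M) η (curveMap M w, w)) := by
            field_simp
        _ = _ := by rw [h5]; ring
    rwa [h4] at h3

/-! ### The current equation for a single matrix -/

/-- For fixed z₁, two zeros w, w' satisfy (w - w')(d z₁ - b) = 0, and d z₁ = b would force b = d = 0
and det M = 0. So when det M > 0 the fibres of the zero set have at most one point, and Fubini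
applies. -/
lemma ae_bilin_ne_zero {M : Matrix (Fin 2) (Fin 2) ℝ} (hM : M ≠ 0) :
    ∀ᵐ z : ℂ × ℂ, z ∈ HH → bilin M z.1 z.2 ≠ 0 := by
  rcases le_or_gt M.det 0 with hd | hd
  · exact Eventually.of_forall fun z hz => bilin_ne_zero hM hd hz
  have hms : MeasurableSet {z : ℂ × ℂ | z ∈ HH ∧ bilin M z.1 z.2 = 0} := by
    refine measurableSet_HH.inter (measurableSet_eq_fun ?_ measurable_const)
    unfold bilin
    fun_prop
  have : ∀ᵐ z : ℂ × ℂ, z ∉ {z : ℂ × ℂ | z ∈ HH ∧ bilin M z.1 z.2 = 0} := by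
    rw [← measure_eq_zero_iff_ae_notMem, Measure.volume_eq_prod, Measure.measure_prod_null hms]
    refine Eventually.of_forall fun x => Set.Subsingleton.measure_zero (fun w hw w' hw' => ?_) _
    obtain ⟨⟨hx, _⟩, h1⟩ := hw
    obtain ⟨_, h2⟩ := hw'
    simp only at hx h1 h2
    have h3 : (w - w') * ((M 1 1 : ℂ) * x - M 0 1) = 0 := by
      rw [bilin] at h1 h2
      linear_combination h1 - h2
    refine sub_eq_zero.1 ((mul_eq_zero.1 h3).resolve_right fun h => ?_)
    obtain ⟨h4, h5⟩ := ofReal_mul_sub_eq_zero hx h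
    rw [Matrix.det_fin_two, h4, h5] at hd
    simp at hd
  filter_upwards [this] with z hz h1 h2
  exact hz ⟨h1, h2⟩

lemma continuous_ddc {η : Form11} (hη : η.IsTest) : Continuous (ddc η) := by
  have h : ∀ j k j' k', Continuous (dZ j (dZbar k (η j' k'))) := fun j k j' k' => by
    rw [dZ_eq_wirtinger, dZbar_eq_wirtinger]
    exact (contDiff_wirtinger (contDiff_wirtinger (hη j' k').1 _ _) _ _).continuous
  exact continuous_const.mul ((((h _ _ _ _).add (h _ _ _ _)).sub (h _ _ _ _)).sub (h _ _ _ _))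

lemma ddc_eq_zero_of_notMem_supp {η : Form11} {z : ℂ × ℂ} (hz : z ∉ η.supp) : ddc η z = 0 := by
  have : ∀ j k j' k', dZ j (dZbar k (η j' k')) z = 0 := fun j k j' k' => by
    refine image_eq_zero_of_notMem_tsupport fun h => hz ?_
    rw [dZ_eq_wirtinger, dZbar_eq_wirtinger] at h
    exact mem_iUnion_of_mem j' (mem_iUnion_of_mem k'
      (tsupport_wirtinger_subset _ _ (tsupport_wirtinger_subset _ _ h)))
  simp [ddc, this]

lemma exists_bound_ddc {η : Form11} (hη : η.IsTest) : ∃ C, ∀ z, ‖ddc η z‖ ≤ C :=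
  (HasCompactSupport.of_support_subset_isCompact hη.isCompact_supp fun _ hz => by_contra fun h =>
    hz (ddc_eq_zero_of_notMem_supp h)).exists_bound_of_continuous (continuous_ddc hη)

lemma integrable_mul_ddc {g : ℂ × ℂ → ℝ} {η : Form11} (hη : η.IsTest)
    (hg : IntegrableOn g η.supp) : Integrable fun z => (g z : ℂ) * ddc η z := by
  obtain ⟨C, hC⟩ := exists_bound_ddc hη
  have h1 : IntegrableOn (fun z => (g z : ℂ) * ddc η z) η.supp :=
    hg.ofReal.mul_bdd (c := C) (continuous_ddc hη).aestronglyMeasurable (Eventually.of_forall hC)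
  rw [← integrable_indicator_iff hη.isCompact_supp.measurableSet] at h1
  refine h1.congr (Eventually.of_forall fun z => ?_)
  by_cases hz : z ∈ η.supp
  · rw [indicator_of_mem hz]
  · simp only [indicator_of_notMem hz, ddc_eq_zero_of_notMem_supp hz, mul_zero]

/-- `dd^c [-Ei(-2π r R)] + δ_{D_M} = [schwartzForm]`. -/
theorem ddcCurrent_negEi_add_curveCurrent {M : Matrix (Fin 2) (Fin 2) ℝ} (hM : M ≠ 0) {r : ℝ}
    (hr : 0 < r) {η : Form11} (hη : η.IsTest) :
    ddcCurrent (fun z => negEi (2 * Real.pi * r * R z M)) η + curveCurrent (DM M) η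
      = formCurrent (schwartzForm r M) η := by
  have hpi := Real.pi_pos
  -- The same integrals have two limits: by dominated convergence the current of -Ei, and by the
  -- regularized equation the Schwartz form minus δ_{D_M}. Uniqueness of limits is the theorem.
  have h1 : Tendsto (fun n : ℝ => topIntegral
      (fun z => (negEiTrunc n (2 * Real.pi * r * R z M) : ℂ) * ddc η z)) atTop
      (𝓝 (ddcCurrent (fun z => negEi (2 * Real.pi * r * R z M)) η)) := by
    have hint := integrable_mul_ddc hη
      (integrableOn_negEi_comp_R hr hM hη.isCompact_supp hη.supp_subset)
    have hpos : ∀ᵐ z ∂(volume.restrict HH), 0 < 2 * Real.pi * r * R z M := by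
      refine (ae_restrict_iff' measurableSet_HH).2 ?_
      filter_upwards [ae_bilin_ne_zero hM] with z h hz
      have := (R_pos_iff hz M).2 (h hz)
      positivity
    refine tendsto_integral_filter_of_dominated_convergence
      (fun z => 4 * ‖(negEi (2 * Real.pi * r * R z M) : ℂ) * ddc η z‖) ?_ ?_ ?_ ?_
    · refine Eventually.of_forall fun n => Measurable.aestronglyMeasurable ?_
      have h2 : Measurable fun z => negEiTrunc n (2 * Real.pi * r * R z M) :=
        (contDiff_negEiTrunc n).continuous.measurable.comp ((measurable_R M).const_mul _)
      exact measurable_const.mul ((Complex.measurable_ofReal.comp h2).mul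
        (continuous_ddc hη).measurable)
    · filter_upwards [eventually_ge_atTop 1] with n hn
      filter_upwards [hpos] with z hz
      rw [norm_mul, norm_mul, norm_mul, Complex.norm_real, Complex.norm_real, Real.norm_eq_abs,
        Real.norm_eq_abs, abs_of_nonneg (negEi_nonneg _)]
      simp only [norm_neg, Complex.norm_ofNat]
      gcongr
      exact abs_negEiTrunc_le hn hz
    · exact (hint.norm.const_mul 4).integrableOn
    · filter_upwards [hpos] with z hz
      exact (((Complex.continuous_ofReal.tendsto _).comp (tendsto_negEiTrunc hz)).mul_const
        _).const_mul _
  have h2 : Tendsto (fun n : ℝ => topIntegral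
      (fun z => (negEiTrunc n (2 * Real.pi * r * R z M) : ℂ) * ddc η z)) atTop
      (𝓝 (formCurrent (schwartzForm r M) η - curveCurrent (DM M) η)) := by
    simp_rw [topIntegral_negEiTrunc _ r M hη]
    exact tendsto_const_nhds.sub (tendsto_formCurrent_schwartzForm hM hr hη)
  rw [tendsto_nhds_unique h1 h2, sub_add_cancel]

lemma locallyIntegrableOn_HH {g : ℂ × ℂ → ℝ}
    (h : ∀ K, IsCompact K → K ⊆ HH → IntegrableOn g K) : LocallyIntegrableOn g HH := by
  rw [locallyIntegrableOn_iff isOpen_HH.isLocallyClosed]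
  exact fun K hK hc => h K hc hK

lemma formCurrent_const_mul (c : ℂ) {α β η : Form11}
    (h : ∀ j k, ∀ z ∈ HH, β j k z = c * α j k z) : formCurrent β η = c * formCurrent α η := by
  rw [formCurrent, formCurrent, topIntegral, topIntegral, ← integral_const_mul]
  refine setIntegral_congr_fun measurableSet_HH fun z hz => ?_
  simp only [wedge, h _ _ z hz]
  ring

/-- The current equation for Kudla's function. -/
theorem xi_current {M : Matrix (Fin 2) (Fin 2) ℝ} (hM : M ≠ 0) :
    LocallyIntegrableOn (fun z => xi z M) HH ∧ ∀ η : Form11, η.IsTest →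
      ddcCurrent (fun z => xi z M) η
          + ((Real.exp (-Real.pi * quad M) : ℝ) : ℂ) * curveCurrent (DM M) η
        = formCurrent (phiKudla M) η := by
  have e : ∀ z, xi z M
      = negEi (2 * Real.pi * 1 * R z M) * Real.exp (-Real.pi * quad M) := fun z => by
    rw [xi, mul_one]
  simp_rw [e]
  refine ⟨locallyIntegrableOn_HH fun K hK hKH =>
    (integrableOn_negEi_comp_R one_pos hM hK hKH).mul_const _, fun η hη => ?_⟩
  rw [formCurrent_const_mul (((Real.exp (-Real.pi * quad M) : ℝ) : ℂ))
    (fun j k z hz => phiKudla_eq hz M j k), ← ddcCurrent_negEi_add_curveCurrent hM one_pos hη,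
    mul_add]
  congr 1
  rw [ddcCurrent, ddcCurrent, topIntegral, topIntegral, ← integral_const_mul]
  congr 1
  funext z
  push_cast
  ring

/-! ### Series of smooth functions on open sets -/

/-- Termwise differentiation of series of smooth functions on an open set. -/
lemma contDiffOn_tsum_of_isOpen {ι E F : Type*} [NormedAddCommGroup E] [NormedSpace ℝ E]
    [HasContDiffBump E] [FiniteDimensional ℝ E] [NormedAddCommGroup F] [NormedSpace ℝ F]
    [CompleteSpace F] {f : ι → E → F} {U : Set E} (hU : IsOpen U)
    (hf : ∀ i, ContDiffOn ℝ ∞ (f i) U) {v : ℕ → ι → ℝ} (hv : ∀ k, Summable (v k))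
    (hb : ∀ k i, ∀ x ∈ U, ‖iteratedFDerivWithin ℝ k (f i) U x‖ ≤ v k i) :
    ContDiffOn ℝ ∞ (fun x => ∑' i, f i x) U := by
  intro x hx
  obtain ⟨ε, hε, hball⟩ := Metric.isOpen_iff.1 hU x hx
  -- Multiplying by a bump that is 1 near x and supported in U makes every term smooth on the whole
  -- space. The Leibniz rule converts the bounds on U into global summable bounds.
  let χ : ContDiffBump x := ⟨ε / 4, ε / 2, by positivity, by linarith⟩
  have hχs : tsupport χ ⊆ U := by
    rw [χ.tsupport_eq]
    exact (Metric.closedBall_subset_ball (half_lt_self hε)).trans hball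
  have hχ : ContDiff ℝ ∞ χ := χ.contDiff
  have hz : ∀ i, ∀ y ∉ tsupport χ, (fun y => χ y • f i y) =ᶠ[𝓝 y] fun _ => 0 := fun i y hy => by
    filter_upwards [(isClosed_tsupport χ).isOpen_compl.mem_nhds hy] with w hw
    simp [image_eq_zero_of_notMem_tsupport hw]
  have hcd : ∀ i, ContDiff ℝ ∞ fun y => χ y • f i y := fun i => by
    refine contDiff_iff_contDiffAt.2 fun y => ?_
    by_cases hy : y ∈ tsupport χ
    · exact hχ.contDiffAt.smul ((hf i).contDiffAt (hU.mem_nhds (hχs hy)))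
    · exact contDiffAt_const.congr_of_eventuallyEq (hz i y hy)
  have hB : ∀ k, ∃ B, ∀ y, ‖iteratedFDeriv ℝ k χ y‖ ≤ B := fun k =>
    (χ.hasCompactSupport.iteratedFDeriv k).exists_bound_of_continuous
      (hχ.continuous_iteratedFDeriv (by exact_mod_cast le_top))
  choose B hB using hB
  have hB0 : ∀ k, 0 ≤ B k := fun k => (norm_nonneg _).trans (hB k x)
  have hv0 : ∀ k i, 0 ≤ v k i := fun k i => (norm_nonneg _).trans (hb k i x hx)
  have key : ContDiff ℝ ∞ fun y => ∑' i, χ y • f i y := by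
    refine contDiff_tsum (v := fun k i => ∑ j ∈ Finset.range (k + 1),
      (k.choose j : ℝ) * B j * v (k - j) i) hcd (fun k _ => ?_) (fun k i y _ => ?_)
    · exact summable_sum fun j _ => (hv _).mul_left _
    · by_cases hy : y ∈ U
      · rw [← iteratedFDerivWithin_of_isOpen k hU hy]
        refine (norm_iteratedFDerivWithin_smul_le hχ.contDiffOn (hf i) hU.uniqueDiffOn hy
          (n := k) (by exact_mod_cast le_top)).trans ?_
        refine Finset.sum_le_sum fun j _ => ?_
        rw [iteratedFDerivWithin_of_isOpen j hU hy]
        gcongr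
        · exact mul_nonneg (Nat.cast_nonneg _) (hB0 j)
        · exact hB j y
        · exact hb _ i y hy
      · have h0 := (hz i y fun h => hy (hχs h)).iteratedFDeriv ℝ k
        rw [h0.self_of_nhds, iteratedFDeriv_fun_zero]
        simp only [Pi.zero_apply, norm_zero]
        exact Finset.sum_nonneg fun j _ =>
          mul_nonneg (mul_nonneg (Nat.cast_nonneg _) (hB0 j)) (hv0 _ _)
  refine (key.contDiffAt.congr_of_eventuallyEq ?_).contDiffWithinAt
  filter_upwards [χ.eventuallyEq_one] with y hy
  simp only [hy, Pi.one_apply, one_smul]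

/-! ### Decay of the radial functions -/

/-- The derivative of exp(-at) t⁻ᵏ is -a times itself minus k times the function with k + 1.
Induction on n, for all k at once, reduces to t⁻ᵏ ≤ 1. -/
lemma exists_bound_iteratedDerivWithin_exp_mul (a : ℝ) (n : ℕ) : ∀ k : ℕ, ∃ C, ∀ t, 1 ≤ t →
    ‖iteratedDerivWithin n (fun t : ℝ => Real.exp (-(a * t)) * t⁻¹ ^ k) (Ioi 0) t‖
      ≤ C * Real.exp (-(a * t)) := by
  have hcd : ∀ (n k : ℕ), ContDiffOn ℝ n (fun t : ℝ => Real.exp (-(a * t)) * t⁻¹ ^ k) (Ioi 0) :=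
    fun n k => by
      refine ContDiffOn.mul ?_ ((contDiffOn_id.inv fun t (ht : 0 < t) => ht.ne').pow k)
      exact (Real.contDiff_exp.comp (contDiff_const.mul contDiff_id).neg).contDiffOn
  induction n with
  | zero =>
    refine fun k => ⟨1, fun t ht => ?_⟩
    have ht0 : 0 < t := by linarith
    rw [iteratedDerivWithin_zero, norm_mul, Real.norm_eq_abs, Real.abs_exp, Real.norm_eq_abs,
      abs_of_nonneg (by positivity), mul_comm]
    gcongr
    exact pow_le_one₀ (by positivity) (inv_le_one_of_one_le₀ ht)
  | succ n ih =>
    intro k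
    obtain ⟨C, hC⟩ := ih k
    obtain ⟨C', hC'⟩ := ih (k + 1)
    refine ⟨|a| * C + k * C', fun t ht => ?_⟩
    have ht0 : t ∈ Ioi (0 : ℝ) := lt_of_lt_of_le one_pos ht
    have hd : EqOn (derivWithin (fun t : ℝ => Real.exp (-(a * t)) * t⁻¹ ^ k) (Ioi 0))
        (fun t => -a * (Real.exp (-(a * t)) * t⁻¹ ^ k)
          + -(k : ℝ) * (Real.exp (-(a * t)) * t⁻¹ ^ (k + 1))) (Ioi 0) := fun s hs => by
      rw [derivWithin_of_isOpen isOpen_Ioi hs]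
      have h1 : HasDerivAt (fun t => -(a * t)) (-a) s := by
        simpa using ((hasDerivAt_id s).const_mul a).fun_neg
      have hs0 : s ≠ 0 := (show (0 : ℝ) < s from hs).ne'
      refine ((h1.exp.mul ((hasDerivAt_inv hs0).pow k)).congr_deriv ?_).deriv
      rcases k with _ | k
      · simp; ring
      · simp only [Nat.add_sub_cancel, Pi.pow_apply, ← inv_pow]
        push_cast
        ring
    rw [iteratedDerivWithin_succ', iteratedDerivWithin_congr hd ht0,
      iteratedDerivWithin_fun_add ht0 isOpen_Ioi.uniqueDiffOn
        (contDiffWithinAt_const.mul (hcd n k t ht0))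
        (contDiffWithinAt_const.mul (hcd n (k + 1) t ht0)),
      iteratedDerivWithin_const_mul_field, iteratedDerivWithin_const_mul_field]
    refine (norm_add_le _ _).trans ?_
    rw [norm_mul, norm_mul, norm_neg, norm_neg, Real.norm_eq_abs a, add_mul, mul_assoc, mul_assoc]
    simp only [Real.norm_natCast]
    gcongr
    · exact hC t ht
    · exact hC' t ht

/-- Smooth functions on `(0, ∞)` all of whose derivatives are `O(exp (-a t))` for `t ≥ 1`. -/
structure HasExpDecay (a : ℝ) (h : ℝ → ℝ) : Prop where
  contDiffOn : ContDiffOn ℝ ∞ h (Ioi 0)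
  bound : ∀ n : ℕ, ∃ C, ∀ t, 1 ≤ t → ‖iteratedDerivWithin n h (Ioi 0) t‖ ≤ C * Real.exp (-(a * t))

lemma hasExpDecay_exp (a : ℝ) : HasExpDecay a fun t => Real.exp (-(a * t)) where
  contDiffOn := (Real.contDiff_exp.comp (contDiff_const.mul contDiff_id).neg).contDiffOn
  bound n := by simpa using exists_bound_iteratedDerivWithin_exp_mul a n 0

/-- The derivative is -exp(-at)/t, so every order above zero is the case k = 1 of the preceding
bound; order zero is `negEi_le`. -/
lemma hasExpDecay_negEi {a : ℝ} (ha : 0 < a) : HasExpDecay a fun t => negEi (a * t) where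
  contDiffOn := contDiffOn_negEi.comp (contDiff_const.mul contDiff_id).contDiffOn
    fun _ ht => mul_pos ha ht
  bound n := by
    rcases n with _ | n
    · refine ⟨1 / a, fun t ht => ?_⟩
      have ht0 : 0 < t := by linarith
      rw [iteratedDerivWithin_zero, Real.norm_eq_abs, abs_of_nonneg (negEi_nonneg _)]
      refine (negEi_le (mul_pos ha ht0)).trans ?_
      rw [div_eq_inv_mul, one_div]
      gcongr
      exact le_mul_of_one_le_right ha.le ht
    · obtain ⟨C, hC⟩ := exists_bound_iteratedDerivWithin_exp_mul a n 1
      refine ⟨C, fun t ht => ?_⟩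
      have ht0 : t ∈ Ioi (0 : ℝ) := lt_of_lt_of_le one_pos ht
      have hd : EqOn (derivWithin (fun t => negEi (a * t)) (Ioi 0))
          (fun t => -(Real.exp (-(a * t)) * t⁻¹ ^ 1)) (Ioi 0) := fun s (hs : 0 < s) => by
        rw [derivWithin_of_isOpen isOpen_Ioi hs]
        have h1 : HasDerivAt (fun t => a * t) a s := by simpa using (hasDerivAt_id s).const_mul a
        refine (((hasDerivAt_negEi (mul_pos ha hs)).comp s h1).congr_deriv ?_).deriv
        field_simp
      rw [iteratedDerivWithin_succ', iteratedDerivWithin_congr hd ht0, iteratedDerivWithin_fun_neg,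
        norm_neg]
      exact hC t ht

/-! ### Growth of `R` in the matrix -/

/-- The sum of the squares of the entries. -/
def sumSq (M : Matrix (Fin 2) (Fin 2) ℝ) : ℝ := ∑ p : Fin 2 × Fin 2, M p.1 p.2 ^ 2

lemma sumSq_nonneg (M : Matrix (Fin 2) (Fin 2) ℝ) : 0 ≤ sumSq M :=
  Finset.sum_nonneg fun _ _ => sq_nonneg _

lemma sq_le_sumSq (M : Matrix (Fin 2) (Fin 2) ℝ) (i j : Fin 2) : M i j ^ 2 ≤ sumSq M :=
  Finset.single_le_sum (f := fun p : Fin 2 × Fin 2 => M p.1 p.2 ^ 2) (fun _ _ => sq_nonneg _)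
    (Finset.mem_univ (i, j))

/-- `R + det M`, the positive definite majorant. -/
def majorant (z : ℂ × ℂ) (M : Matrix (Fin 2) (Fin 2) ℝ) : ℝ :=
  (‖bilin M z.1 z.2‖ ^ 2 + ‖bilin M (star z.1) z.2‖ ^ 2) / (4 * z.1.im * z.2.im)

/-- Equivalent to |f(z̄₁, z₂)|² - |f(z₁, z₂)|² = 4 y₁y₂ det M: replacing z₁ by its conjugate
exchanges the two definite parts of the form of signature (2, 2). -/
lemma R_add_det {z : ℂ × ℂ} (hz : z ∈ HH) (M : Matrix (Fin 2) (Fin 2) ℝ) :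
    R z M + M.det = majorant z M := by
  have h1 := hz.1.ne'
  have h2 := hz.2.ne'
  rw [R_eq, majorant, ← Complex.normSq_eq_norm_sq, ← Complex.normSq_eq_norm_sq,
    Matrix.det_fin_two]
  field_simp
  simp [bilin, Complex.normSq_apply]
  ring

/-- If f vanishes at both (z₁, z₂) and (z̄₁, z₂), subtraction gives d z₂ = c, hence c = d = 0. Then
b z₂ = a, hence a = b = 0. -/
lemma majorant_pos {z : ℂ × ℂ} (hz : z ∈ HH) {M : Matrix (Fin 2) (Fin 2) ℝ} (hM : M ≠ 0) :
    0 < majorant z M := by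
  have h1 := hz.1
  have h2 := hz.2
  by_contra hle
  have hnum : ‖bilin M z.1 z.2‖ ^ 2 + ‖bilin M (star z.1) z.2‖ ^ 2 ≤ 0 := by
    by_contra hp
    push Not at hp
    exact hle (by unfold majorant; positivity)
  have e1 : bilin M z.1 z.2 = 0 := by
    rw [← norm_eq_zero, ← sq_eq_zero_iff]
    nlinarith [sq_nonneg ‖bilin M z.1 z.2‖, sq_nonneg ‖bilin M (star z.1) z.2‖]
  have e2 : bilin M (star z.1) z.2 = 0 := by
    rw [← norm_eq_zero, ← sq_eq_zero_iff]
    nlinarith [sq_nonneg ‖bilin M z.1 z.2‖, sq_nonneg ‖bilin M (star z.1) z.2‖]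
  have e3 : (M 1 1 : ℂ) * z.2 - M 1 0 = 0 := by
    have : (z.1 - star z.1) * ((M 1 1 : ℂ) * z.2 - M 1 0) = 0 := by
      rw [bilin] at e1 e2
      linear_combination e1 - e2
    exact (mul_eq_zero.1 this).resolve_left (sub_star_ne_zero h1)
  obtain ⟨h3, h4⟩ := ofReal_mul_sub_eq_zero h2 e3
  have e4 : (M 0 1 : ℂ) * z.2 - M 0 0 = 0 := by
    rw [bilin, h3, h4] at e1
    simp at e1
    linear_combination -e1
  obtain ⟨h5, h6⟩ := ofReal_mul_sub_eq_zero h2 e4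
  apply hM
  ext i j
  fin_cases i <;> fin_cases j <;> simpa

lemma bilin_smul (t : ℝ) (M : Matrix (Fin 2) (Fin 2) ℝ) (z₁ z₂ : ℂ) :
    bilin (t • M) z₁ z₂ = t * bilin M z₁ z₂ := by
  simp [bilin]
  ring

lemma majorant_smul (t : ℝ) (z : ℂ × ℂ) (M : Matrix (Fin 2) (Fin 2) ℝ) :
    majorant z (t • M) = t ^ 2 * majorant z M := by
  simp only [majorant, bilin_smul, norm_mul, mul_pow, Complex.norm_real, Real.norm_eq_abs, sq_abs]
  ring

lemma sumSq_smul (t : ℝ) (M : Matrix (Fin 2) (Fin 2) ℝ) : sumSq (t • M) = t ^ 2 * sumSq M := by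
  simp [sumSq, mul_pow, Finset.mul_sum]

lemma eq_zero_of_sumSq_eq_zero {M : Matrix (Fin 2) (Fin 2) ℝ} (h : sumSq M = 0) : M = 0 := by
  ext i j
  have := sq_le_sumSq M i j
  rw [h] at this
  exact pow_eq_zero_iff two_ne_zero |>.1 (le_antisymm this (sq_nonneg _))

/-- On compact sets the majorant is uniformly positive definite. -/
lemma exists_mul_sumSq_le {K : Set (ℂ × ℂ)} (hK : IsCompact K) (hKH : K ⊆ HH) :
    ∃ c > 0, ∀ z ∈ K, ∀ M, c * sumSq M ≤ R z M + M.det := by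
  -- Both sides are homogeneous of degree 2 in M, so the constant is a minimum of the majorant over
  -- K times the unit sphere.
  set S : Set (Fin 2 → Fin 2 → ℝ) := {M | sumSq M = 1} with hS
  have hcont : Continuous fun M : Fin 2 → Fin 2 → ℝ => sumSq M := by
    unfold sumSq
    fun_prop
  have hSc : IsCompact S := by
    refine IsCompact.of_isClosed_subset
      (isCompact_univ_pi fun _ => isCompact_univ_pi fun _ => isCompact_Icc (a := (-1 : ℝ)) (b := 1))
      (isClosed_eq hcont continuous_const) fun M hM i _ j _ => ?_
    have := sq_le_sumSq M i j
    rw [show sumSq M = 1 from hM] at this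
    exact abs_le.1 ((sq_le_one_iff_abs_le_one _).1 this)
  have hmaj : ContinuousOn (fun p : (ℂ × ℂ) × (Fin 2 → Fin 2 → ℝ) => majorant p.1 p.2)
      (K ×ˢ S) := by
    unfold majorant bilin
    refine ContinuousOn.div ?_ ?_ fun p hp => ?_
    · apply Continuous.continuousOn
      simp only [Complex.star_def]
      fun_prop
    · apply Continuous.continuousOn
      have h1 := Complex.continuous_im
      fun_prop
    · have h1 := (hKH hp.1).1
      have h2 := (hKH hp.1).2
      positivity
  obtain ⟨c, hc, h⟩ : ∃ c > 0, ∀ p ∈ K ×ˢ S, c ≤ majorant p.1 p.2 := by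
    rcases (K ×ˢ S).eq_empty_or_nonempty with h | hne
    · exact ⟨1, one_pos, by simp [h]⟩
    · obtain ⟨p, hp, hmin⟩ := (hK.prod hSc).exists_isMinOn hne hmaj
      refine ⟨_, majorant_pos (hKH hp.1) fun h => ?_, fun q hq => hmin hq⟩
      have : sumSq p.2 = 1 := hp.2
      rw [h] at this
      simp [sumSq] at this
  refine ⟨c, hc, fun z hz M => ?_⟩
  rw [R_add_det (hKH hz)]
  by_cases h0 : sumSq M = 0
  · rw [eq_zero_of_sumSq_eq_zero h0]
    simp [sumSq, majorant, bilin]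
  · have hpos : 0 < sumSq M := (sumSq_nonneg M).lt_of_ne' h0
    have hs : (Real.sqrt (sumSq M))⁻¹ ^ 2 = (sumSq M)⁻¹ := by
      rw [inv_pow, Real.sq_sqrt hpos.le]
    have h1 := h (z, (Real.sqrt (sumSq M))⁻¹ • M) ⟨hz, by
      change sumSq _ = 1
      exact (sumSq_smul _ M).trans (by rw [hs, inv_mul_cancel₀ h0])⟩
    have h2 : majorant z ((Real.sqrt (sumSq M))⁻¹ • M) = _ := majorant_smul _ z M
    simp only at h1
    rw [h2, hs, ← div_eq_inv_mul, le_div_iff₀ hpos] at h1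
    exact h1

/-! ### Families with tempered dependence on the matrix -/

/-- Families of smooth functions all of whose derivatives are `O(1 + |M|²)`, locally uniformly. -/
structure IsTemperedFamily {E : Type*} [NormedAddCommGroup E] [NormedSpace ℝ E]
    (f : Matrix (Fin 2) (Fin 2) ℝ → ℂ × ℂ → E) : Prop where
  contDiffOn : ∀ M, ContDiffOn ℝ ∞ (f M) HH
  bound : ∀ K, IsCompact K → K ⊆ HH → ∀ k : ℕ, ∃ C, 0 ≤ C ∧ ∀ M, ∀ z ∈ K,
    ‖iteratedFDerivWithin ℝ k (f M) HH z‖ ≤ C * (1 + sumSq M)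

section Tempered

variable {E : Type*} [NormedAddCommGroup E] [NormedSpace ℝ E]

lemma exists_bound_iteratedFDerivWithin {f : ℂ × ℂ → E} (hf : ContDiffOn ℝ ∞ f HH)
    {K : Set (ℂ × ℂ)} (hK : IsCompact K) (hKH : K ⊆ HH) (k : ℕ) :
    ∃ C, 0 ≤ C ∧ ∀ z ∈ K, ‖iteratedFDerivWithin ℝ k f HH z‖ ≤ C := by
  obtain ⟨C, hC⟩ := hK.exists_bound_of_continuousOn
    ((hf.continuousOn_iteratedFDerivWithin (m := k) (by exact_mod_cast le_top)
      isOpen_HH.uniqueDiffOn).mono hKH)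
  exact ⟨max C 0, le_max_right _ _, fun z hz => (hC z hz).trans (le_max_left _ _)⟩

lemma isTemperedFamily_const {f : ℂ × ℂ → E} (hf : ContDiffOn ℝ ∞ f HH) :
    IsTemperedFamily fun _ => f where
  contDiffOn _ := hf
  bound K hK hKH k := by
    obtain ⟨C, hC0, hC⟩ := exists_bound_iteratedFDerivWithin hf hK hKH k
    refine ⟨C, hC0, fun M z hz => (hC z hz).trans (le_mul_of_one_le_right hC0 ?_)⟩
    linarith [sumSq_nonneg M]

lemma IsTemperedFamily.add {f g : Matrix (Fin 2) (Fin 2) ℝ → ℂ × ℂ → E}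
    (hf : IsTemperedFamily f) (hg : IsTemperedFamily g) :
    IsTemperedFamily fun M z => f M z + g M z where
  contDiffOn M := (hf.contDiffOn M).add (hg.contDiffOn M)
  bound K hK hKH k := by
    obtain ⟨C, hC0, hC⟩ := hf.bound K hK hKH k
    obtain ⟨D, hD0, hD⟩ := hg.bound K hK hKH k
    refine ⟨C + D, add_nonneg hC0 hD0, fun M z hz => ?_⟩
    have hk : (k : ℕ∞ω) ≤ ∞ := by exact_mod_cast le_top
    have e := iteratedFDerivWithin_add_apply (((hf.contDiffOn M).of_le hk) z (hKH hz))
      (((hg.contDiffOn M).of_le hk) z (hKH hz)) isOpen_HH.uniqueDiffOn (hKH hz)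
    change ‖iteratedFDerivWithin ℝ k (f M + g M) HH z‖ ≤ _
    rw [e, add_mul]
    exact (norm_add_le _ _).trans (add_le_add (hC M z hz) (hD M z hz))

lemma IsQuadraticFamily.isTemperedFamily {f : Matrix (Fin 2) (Fin 2) ℝ → ℂ × ℂ → E}
    (hf : IsQuadraticFamily f) : IsTemperedFamily f := by
  refine ⟨hf.contDiffOn, fun K hK hKH k => ?_⟩
  obtain ⟨ρ, hρ, ef⟩ := hf
  choose C hC0 hC using fun p => exists_bound_iteratedFDerivWithin (hρ p) hK hKH k
  refine ⟨∑ p, C p, Finset.sum_nonneg fun p _ => hC0 p, fun M z hz => ?_⟩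
  have hk : (k : ℕ∞ω) ≤ ∞ := by exact_mod_cast le_top
  have e0 := iteratedFDerivWithin_fun_sum_apply (𝕜 := ℝ) (i := k) (u := Finset.univ)
    (f := fun (p : (Fin 2 × Fin 2) × (Fin 2 × Fin 2)) z =>
      (M p.1.1 p.1.2 * M p.2.1 p.2.2) • ρ p z) isOpen_HH.uniqueDiffOn (hKH hz)
    fun p _ => (contDiffOn_const.smul ((hρ p).of_le hk)) z (hKH hz)
  rw [iteratedFDerivWithin_congr (ef M) (hKH hz), e0, Finset.sum_mul]
  refine (norm_sum_le _ _).trans (Finset.sum_le_sum fun p _ => ?_)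
  have e := iteratedFDerivWithin_const_smul_apply (a := M p.1.1 p.1.2 * M p.2.1 p.2.2)
    (((hρ p).of_le hk) z (hKH hz)) isOpen_HH.uniqueDiffOn (hKH hz)
  change ‖iteratedFDerivWithin ℝ k ((M p.1.1 p.1.2 * M p.2.1 p.2.2) • ρ p) HH z‖ ≤ _
  rw [e, norm_smul, mul_comm]
  refine mul_le_mul (hC p z hz) ?_ (norm_nonneg _) (hC0 p)
  rw [Real.norm_eq_abs, abs_le]
  have h1 := sq_le_sumSq M p.1.1 p.1.2
  have h2 := sq_le_sumSq M p.2.1 p.2.2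
  constructor <;> nlinarith [sq_nonneg (M p.1.1 p.1.2 - M p.2.1 p.2.2),
    sq_nonneg (M p.1.1 p.1.2 + M p.2.1 p.2.2)]

/-- The basic estimate: the derivatives of `h(R) • q` decay like a Gaussian in `M`. -/
lemma exists_bound_iteratedFDerivWithin_comp_R {a c : ℝ} (ha : 0 < a) {h : ℝ → ℝ}
    (hh : HasExpDecay a h) {q : Matrix (Fin 2) (Fin 2) ℝ → ℂ × ℂ → E} (hq : IsTemperedFamily q)
    {K U : Set (ℂ × ℂ)} (hK : IsCompact K) (hKH : K ⊆ HH) (hU : IsOpen U) (hUK : U ⊆ K) (m : ℝ)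
    (k : ℕ) : ∃ C, ∀ M : Matrix (Fin 2) (Fin 2) ℝ, (∀ z ∈ U, 1 ≤ R z M) →
      (∀ z ∈ U, c * sumSq M - m ≤ R z M) → ∀ z ∈ U,
      ‖iteratedFDerivWithin ℝ k (fun z => h (R z M) • q M z) U z‖
        ≤ C * ((1 + sumSq M) ^ (k + 1) * Real.exp (-(a * c) * sumSq M)) := by
  have hUH : U ⊆ HH := hUK.trans hKH
  -- The tempered bounds concern derivatives within `HH`; on an open subset these are the same
  -- derivatives.
  have hwi : ∀ {F : Type} [NormedAddCommGroup F] [NormedSpace ℝ F] (f : ℂ × ℂ → F) (i : ℕ),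
      ∀ z ∈ U, iteratedFDerivWithin ℝ i f U z = iteratedFDerivWithin ℝ i f HH z :=
    fun f i z hz => by
      rw [iteratedFDerivWithin_of_isOpen i hU hz, iteratedFDerivWithin_of_isOpen i isOpen_HH (hUH hz)]
  have hwi' : ∀ (f : ℂ × ℂ → E) (i : ℕ),
      ∀ z ∈ U, iteratedFDerivWithin ℝ i f U z = iteratedFDerivWithin ℝ i f HH z :=
    fun f i z hz => by
      rw [iteratedFDerivWithin_of_isOpen i hU hz, iteratedFDerivWithin_of_isOpen i isOpen_HH (hUH hz)]
  choose A hA using hh.bound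
  choose B hB0 hB using fun i => isQuadraticFamily_R.isTemperedFamily.bound K hK hKH i
  choose D hD0 hD using fun i => hq.bound K hK hKH i
  set A' : ℝ := ∑ i ∈ Finset.range (k + 1), |A i| with hA'
  -- The added 1 makes B'(1 + |M|²) at least 1, so it is bounded by its j-th power for j ≥ 1, as the
  -- estimate for derivatives of a composition requires.
  set B' : ℝ := 1 + ∑ i ∈ Finset.range (k + 1), B i with hB'
  have hA'0 : 0 ≤ A' := Finset.sum_nonneg fun _ _ => abs_nonneg _
  have hB'1 : 1 ≤ B' := by
    have : 0 ≤ ∑ i ∈ Finset.range (k + 1), B i := Finset.sum_nonneg fun i _ => hB0 i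
    linarith
  -- The binomials come from the Leibniz rule, the factorials from the composition estimate, and
  -- exp(am) from the shift m in the lower bound for R.
  refine ⟨∑ i ∈ Finset.range (k + 1), (k.choose i : ℝ) * (i.factorial * (A' * Real.exp (a * m))
    * B' ^ i) * D (k - i), fun M h1 h2 z hz => ?_⟩
  have hS := sumSq_nonneg M
  have hk : (k : ℕ∞ω) ≤ ∞ := by exact_mod_cast le_top
  have hmaps : MapsTo (fun z => R z M) U (Ioi 0) := fun z hz => lt_of_lt_of_le one_pos (h1 z hz)
  have hRU : ContDiffOn ℝ ∞ (fun z => R z M) U := (contDiffOn_R M).mono hUH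
  have hhR : ContDiffOn ℝ ∞ (fun z => h (R z M)) U := hh.contDiffOn.comp hRU hmaps
  have hcomp : ∀ i ∈ Finset.range (k + 1),
      ‖iteratedFDerivWithin ℝ i (fun z => h (R z M)) U z‖ ≤ (i.factorial * (A' * Real.exp (a * m))
        * B' ^ i) * ((1 + sumSq M) ^ i * Real.exp (-(a * c) * sumSq M)) := fun i hi => by
    have hi' : i ≤ k := Nat.lt_succ_iff.1 (Finset.mem_range.1 hi)
    have := norm_iteratedFDerivWithin_comp_le (n := i) (N := ∞) hh.contDiffOn hRU
      (by exact_mod_cast le_top)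
      isOpen_Ioi.uniqueDiffOn hU.uniqueDiffOn hmaps hz
      (C := A' * Real.exp (a * m) * Real.exp (-(a * c) * sumSq M)) (D := B' * (1 + sumSq M))
      (fun j hj => ?_) (fun j hj1 hj => ?_)
    · refine this.trans (le_of_eq ?_)
      rw [mul_pow]
      ring
    · rw [norm_iteratedFDerivWithin_eq_norm_iteratedDerivWithin]
      refine (hA j _ (h1 z hz)).trans ?_
      have hAj : A j ≤ A' := (le_abs_self _).trans
        (Finset.single_le_sum (f := fun i => |A i|) (fun _ _ => abs_nonneg _)
          (Finset.mem_range.2 (by omega)))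
      rw [mul_assoc, ← Real.exp_add]
      refine mul_le_mul hAj (Real.exp_le_exp.2 ?_) (Real.exp_pos _).le hA'0
      nlinarith [h2 z hz]
    · have hBj : B j ≤ B' := by
        have := Finset.single_le_sum (f := B) (fun i _ => hB0 i)
          (Finset.mem_range.2 (by omega : j < k + 1))
        linarith
      rw [hwi _ j z hz]
      have h3 : 1 ≤ B' * (1 + sumSq M) := by nlinarith
      calc _ ≤ B j * (1 + sumSq M) := hB j M z (hUK hz)
        _ ≤ B' * (1 + sumSq M) := by gcongr
        _ ≤ (B' * (1 + sumSq M)) ^ j := le_self_pow₀ h3 (by omega)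
  refine (norm_iteratedFDerivWithin_smul_le hhR ((hq.contDiffOn M).mono hUH) hU.uniqueDiffOn hz
    hk).trans ?_
  rw [Finset.sum_mul]
  refine Finset.sum_le_sum fun i hi => ?_
  have hi' : i ≤ k := Nat.lt_succ_iff.1 (Finset.mem_range.1 hi)
  rw [hwi' _ _ z hz]
  have h4 := hD (k - i) M z (hUK hz)
  have h5 : (1 + sumSq M) ^ i ≤ (1 + sumSq M) ^ k := pow_le_pow_right₀ (by linarith) hi'
  calc _ ≤ (k.choose i : ℝ) * ((i.factorial * (A' * Real.exp (a * m))
        * B' ^ i) * ((1 + sumSq M) ^ k * Real.exp (-(a * c) * sumSq M)))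
        * (D (k - i) * (1 + sumSq M)) := by
        gcongr
        exact (hcomp i hi).trans (by gcongr)
    _ = _ := by rw [pow_succ]; ring

end Tempered

/-! ### Sums over integral matrices -/

/-- An integral matrix as a real matrix. -/
abbrev toRealMat (M : Matrix (Fin 2) (Fin 2) ℤ) : Matrix (Fin 2) (Fin 2) ℝ :=
  M.map fun n : ℤ => (n : ℝ)

lemma det_toRealMat (M : Matrix (Fin 2) (Fin 2) ℤ) : (toRealMat M).det = M.det := by
  simp [Matrix.det_fin_two]

lemma toRealMat_ne_zero {M : Matrix (Fin 2) (Fin 2) ℤ} (hM : M.det ≠ 0) : toRealMat M ≠ 0 :=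
  fun h => hM (by
    have := det_toRealMat M
    rw [h, Matrix.det_zero] at this
    exact_mod_cast this.symm)

lemma summable_exp_neg_mul_sq {b : ℝ} (hb : 0 < b) :
    Summable fun n : ℤ => Real.exp (-b * (n : ℝ) ^ 2) := by
  have h1 : Summable fun n : ℕ => Real.exp (-b) ^ n :=
    summable_geometric_of_lt_one (Real.exp_pos _).le (by simpa using hb)
  have h2 : ∀ n : ℕ, Real.exp (-b * (n : ℝ) ^ 2) ≤ Real.exp (-b) ^ n := fun n => by
    rw [← Real.exp_nat_mul]
    apply Real.exp_le_exp.2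
    have h3 : (n : ℝ) ≤ (n : ℝ) ^ 2 := by exact_mod_cast Nat.le_self_pow two_ne_zero n
    nlinarith
  have h3 : Summable fun n : ℕ => Real.exp (-b * (n : ℝ) ^ 2) :=
    h1.of_nonneg_of_le (fun _ => (Real.exp_pos _).le) h2
  exact Summable.of_nat_of_neg (by simpa using h3) (by simpa using h3)

lemma summable_exp_neg_sumSq {b : ℝ} (hb : 0 < b) :
    Summable fun M : Matrix (Fin 2) (Fin 2) ℤ => Real.exp (-b * sumSq (toRealMat M)) := by
  have h1 := summable_exp_neg_mul_sq hb
  have h2 := h1.mul_of_nonneg h1 (fun _ => (Real.exp_pos _).le) fun _ => (Real.exp_pos _).le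
  have h3 := h2.mul_of_nonneg h2 (fun _ => (mul_pos (Real.exp_pos _) (Real.exp_pos _)).le)
    fun _ => (mul_pos (Real.exp_pos _) (Real.exp_pos _)).le
  have hinj : Function.Injective fun M : Matrix (Fin 2) (Fin 2) ℤ =>
      ((M 0 0, M 0 1), (M 1 0, M 1 1)) := fun M N h => by
    simp only [Prod.mk.injEq] at h
    ext i j
    fin_cases i <;> fin_cases j
    exacts [h.1.1, h.1.2, h.2.1, h.2.2]
  refine (h3.comp_injective hinj).congr fun M => ?_
  simp only [Function.comp, ← Real.exp_add, sumSq, Fintype.sum_prod_type, Fin.sum_univ_two,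
    Matrix.map_apply]
  ring_nf

lemma one_add_pow_mul_exp_le (n : ℕ) {c : ℝ} (hc : 0 < c) :
    ∃ C, ∀ x, 0 ≤ x → (1 + x) ^ n * Real.exp (-c * x) ≤ C * Real.exp (-(c / 2) * x) := by
  -- Chosen so that nε ≤ c/2, which leaves half of the exponential; n + 1 instead of n covers n = 0.
  set ε : ℝ := c / (2 * (n + 1)) with hε
  have hε0 : 0 < ε := by positivity
  refine ⟨(1 + ε⁻¹) ^ n, fun x hx => ?_⟩
  have h1 : 1 + x ≤ (1 + ε⁻¹) * Real.exp (ε * x) := by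
    have := Real.add_one_le_exp (ε * x)
    have h2 : (1 + ε⁻¹) * (ε * x + 1) = 1 + x + (ε * x + ε⁻¹) := by field_simp; ring
    have h3 : 0 ≤ ε * x + ε⁻¹ := by positivity
    calc 1 + x ≤ (1 + ε⁻¹) * (ε * x + 1) := by linarith
      _ ≤ _ := by gcongr
  have h2 : (n : ℝ) * ε ≤ c / 2 := by
    rw [hε]
    have : (n : ℝ) * (c / (2 * (n + 1))) = (c / 2) * (n / (n + 1)) := by field_simp
    rw [this]
    refine mul_le_of_le_one_right (by positivity) ?_
    rw [div_le_one (by positivity)]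
    linarith
  calc (1 + x) ^ n * Real.exp (-c * x)
      ≤ ((1 + ε⁻¹) * Real.exp (ε * x)) ^ n * Real.exp (-c * x) := by gcongr
    _ = (1 + ε⁻¹) ^ n * Real.exp (n * (ε * x) + -c * x) := by
        rw [mul_pow, ← Real.exp_nat_mul, mul_assoc, ← Real.exp_add]
    _ ≤ _ := by
        gcongr
        nlinarith

lemma summable_pow_mul_exp_neg_sumSq (n : ℕ) {c : ℝ} (hc : 0 < c) :
    Summable fun M : Matrix (Fin 2) (Fin 2) ℤ =>
      (1 + sumSq (toRealMat M)) ^ n * Real.exp (-c * sumSq (toRealMat M)) := by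
  obtain ⟨C, hC⟩ := one_add_pow_mul_exp_le n hc
  refine ((summable_exp_neg_sumSq (half_pos hc)).mul_left C).of_nonneg_of_le (fun M => ?_)
    fun M => hC _ (sumSq_nonneg _)
  have := sumSq_nonneg (toRealMat M)
  positivity

/-- The terms of the convergent Gaussian series tend to 0, so only finitely many of them are at
least exp(-B). -/
lemma finite_sumSq_le (B : ℝ) : {M : Matrix (Fin 2) (Fin 2) ℤ | sumSq (toRealMat M) ≤ B}.Finite := by
  have h := (summable_exp_neg_sumSq one_pos).tendsto_cofinite_zero.eventually
    (gt_mem_nhds (Real.exp_pos (-B)))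
  refine (eventually_cofinite.1 h).subset fun M (hM : _ ≤ B) hlt => ?_
  have := Real.exp_lt_exp.1 hlt
  linarith

section Sums

variable {ι : Type*} {m : ℤ} {φ : ι → Matrix (Fin 2) (Fin 2) ℤ}

/-- Only finitely many `M` of determinant `m` have `R(z, M) < T` somewhere on a compact set. -/
lemma finite_exists_R_lt (hφ : Function.Injective φ) (hm : ∀ i, (φ i).det = m) {K : Set (ℂ × ℂ)}
    (hK : IsCompact K) (hKH : K ⊆ HH) (T : ℝ) :
    {i | ∃ z ∈ K, R z (toRealMat (φ i)) < T}.Finite := by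
  obtain ⟨c, hc, h⟩ := exists_mul_sumSq_le hK hKH
  refine ((finite_sumSq_le ((T + m) / c)).preimage hφ.injOn).subset ?_
  rintro i ⟨z, hz, hR⟩
  have h1 := h z hz (toRealMat (φ i))
  rw [det_toRealMat, hm] at h1
  change sumSq (toRealMat (φ i)) ≤ (T + m) / c
  rw [le_div_iff₀ hc]
  linarith

variable {E : Type*} [NormedAddCommGroup E] [NormedSpace ℝ E]

/-- Fixing the determinant turns positivity of R + det M into R ≥ c|M|² - m, so the basic estimate
is a polynomial times a Gaussian in the entries. -/
lemma exists_summable_bound (hφ : Function.Injective φ) (hm : ∀ i, (φ i).det = m) {a : ℝ}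
    (ha : 0 < a) {h : ℝ → ℝ} (hh : HasExpDecay a h)
    {q : Matrix (Fin 2) (Fin 2) ℝ → ℂ × ℂ → E} (hq : IsTemperedFamily q)
    {K U : Set (ℂ × ℂ)} (hK : IsCompact K) (hKH : K ⊆ HH) (hU : IsOpen U) (hUK : U ⊆ K) (k : ℕ) :
    ∃ v : ι → ℝ, Summable v ∧ ∀ i, (∀ z ∈ U, 1 ≤ R z (toRealMat (φ i))) → ∀ z ∈ U,
      ‖iteratedFDerivWithin ℝ k
        (fun z => h (R z (toRealMat (φ i))) • q (toRealMat (φ i)) z) U z‖ ≤ v i := by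
  obtain ⟨c, hc, hR⟩ := exists_mul_sumSq_le hK hKH
  obtain ⟨C, hC⟩ := exists_bound_iteratedFDerivWithin_comp_R (c := c) ha hh hq hK hKH hU hUK m k
  refine ⟨fun i => C * ((1 + sumSq (toRealMat (φ i))) ^ (k + 1)
      * Real.exp (-(a * c) * sumSq (toRealMat (φ i)))),
    ((summable_pow_mul_exp_neg_sumSq (k + 1) (mul_pos ha hc)).comp_injective hφ).mul_left C,
    fun i h1 z hz => hC _ h1 (fun z hz => ?_) z hz⟩
  have := hR z (hUK hz) (toRealMat (φ i))
  rw [det_toRealMat, hm] at this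
  linarith

/-- Smoothness of the part of the series consisting of the terms with `R ≥ 1`. -/
lemma contDiffOn_tsum_comp_R [CompleteSpace E] (hφ : Function.Injective φ)
    (hm : ∀ i, (φ i).det = m) {a : ℝ}
    (ha : 0 < a) {h : ℝ → ℝ} (hh : HasExpDecay a h)
    {q : Matrix (Fin 2) (Fin 2) ℝ → ℂ × ℂ → E} (hq : IsTemperedFamily q)
    {K U : Set (ℂ × ℂ)} (hK : IsCompact K) (hKH : K ⊆ HH) (hU : IsOpen U) (hUK : U ⊆ K)
    (h1 : ∀ i, ∀ z ∈ U, 1 ≤ R z (toRealMat (φ i))) :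
    ContDiffOn ℝ ∞ (fun z => ∑' i, h (R z (toRealMat (φ i))) • q (toRealMat (φ i)) z) U := by
  choose v hv hb using fun k => exists_summable_bound hφ hm ha hh hq hK hKH hU hUK k
  refine contDiffOn_tsum_of_isOpen hU (fun i => ?_) hv fun k i z hz => hb k i (h1 i) z hz
  refine ContDiffOn.smul (hh.contDiffOn.comp ((contDiffOn_R _).mono (hUK.trans hKH))
    fun z hz => lt_of_lt_of_le one_pos (h1 i z hz)) ((hq.contDiffOn _).mono (hUK.trans hKH))

/-- Locally uniform bound for the terms of the series, with finitely many exceptions. -/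
lemma exists_summable_norm_bound (hφ : Function.Injective φ) (hm : ∀ i, (φ i).det = m) {a : ℝ}
    (ha : 0 < a) {h : ℝ → ℝ} (hh : HasExpDecay a h)
    {q : Matrix (Fin 2) (Fin 2) ℝ → ℂ × ℂ → E} (hq : IsTemperedFamily q)
    {K : Set (ℂ × ℂ)} (hK : IsCompact K) (hKH : K ⊆ HH) :
    ∃ v : ι → ℝ, Summable v ∧ ∀ᶠ i in cofinite, ∀ z ∈ K,
      ‖h (R z (toRealMat (φ i))) • q (toRealMat (φ i)) z‖ ≤ v i := by
  -- The derivative estimate lives on an open set inside a compact one; K is placed in the interior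
  -- of the larger compact set L.
  obtain ⟨L, hL, hKL, hLH⟩ := exists_compact_between hK isOpen_HH hKH
  obtain ⟨v, hv, hb⟩ := exists_summable_bound hφ hm ha hh hq hL hLH isOpen_interior
    interior_subset 0
  refine ⟨v, hv, ?_⟩
  filter_upwards [(finite_exists_R_lt hφ hm hL hLH 1).compl_mem_cofinite] with i hi z hz
  have := hb i (fun z hz => ?_) z (hKL hz)
  · rwa [norm_iteratedFDerivWithin_zero] at this
  · by_contra hlt
    exact hi ⟨z, interior_subset hz, not_le.1 hlt⟩

/-- The finitely many terms with small R do not affect convergence, so this holds at every point of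
`HH`, on the divisor too. -/
lemma summable_comp_R [CompleteSpace E] (hφ : Function.Injective φ) (hm : ∀ i, (φ i).det = m)
    {a : ℝ} (ha : 0 < a) {h : ℝ → ℝ} (hh : HasExpDecay a h)
    {q : Matrix (Fin 2) (Fin 2) ℝ → ℂ × ℂ → E} (hq : IsTemperedFamily q) {z : ℂ × ℂ}
    (hz : z ∈ HH) : Summable fun i => h (R z (toRealMat (φ i))) • q (toRealMat (φ i)) z := by
  obtain ⟨v, hv, hb⟩ := exists_summable_norm_bound hφ hm ha hh hq isCompact_singleton
    (singleton_subset_iff.2 hz)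
  exact Summable.of_norm_bounded_eventually hv (hb.mono fun i hi => hi z rfl)

end Sums

/-! ### Matrices up to sign -/

/-- Representatives of the integral matrices of determinant `m ≠ 0` modulo `±1`. -/
abbrev LmPos (m : ℤ) : Type := {M : Lm m // 0 < M.1 0 0 ∨ (M.1 0 0 = 0 ∧ 0 < M.1 0 1)}

/-- The real matrix of an element of `LmPos m`. -/
abbrev LmPos.mat {m : ℤ} (M : LmPos m) : Matrix (Fin 2) (Fin 2) ℝ := toRealMat M.1.1

lemma LmPos.injective (m : ℤ) : Function.Injective fun M : LmPos m => M.1.1 :=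
  fun _ _ h => Subtype.ext (Subtype.ext h)

lemma LmPos.det_mat {m : ℤ} (M : LmPos m) : M.mat.det = m := by
  rw [det_toRealMat, M.1.2]

lemma LmPos.mat_ne_zero {m : ℤ} (hm : m ≠ 0) (M : LmPos m) : M.mat ≠ 0 :=
  toRealMat_ne_zero (by rwa [M.1.2])

instance (m : ℤ) : Countable (LmPos m) := by
  have : Countable (Matrix (Fin 2) (Fin 2) ℤ) := inferInstanceAs (Countable (Fin 2 → Fin 2 → ℤ))
  infer_instance

/-- Negation on `Lm m`. -/
def negLm {m : ℤ} (M : Lm m) : Lm m := ⟨-M.1, by rw [Matrix.det_neg, M.2]; simp⟩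

lemma negLm_negLm {m : ℤ} (M : Lm m) : negLm (negLm M) = M := Subtype.ext (neg_neg _)

/-- For m ≠ 0 the first row is nonzero, so exactly one of M, -M has lexicographically positive first
row. -/
lemma pos_negLm_iff {m : ℤ} (hm : m ≠ 0) (M : Lm m) :
    (0 < (negLm M).1 0 0 ∨ ((negLm M).1 0 0 = 0 ∧ 0 < (negLm M).1 0 1))
      ↔ ¬(0 < M.1 0 0 ∨ (M.1 0 0 = 0 ∧ 0 < M.1 0 1)) := by
  have h : ¬(M.1 0 0 = 0 ∧ M.1 0 1 = 0) := fun h => hm (by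
    rw [← M.2, Matrix.det_fin_two, h.1, h.2]; ring)
  simp only [negLm, Matrix.neg_apply]
  omega

/-- A sum of an even function over `Lm m` is twice the sum over representatives modulo `±1`. -/
lemma tsum_Lm_eq {E : Type*} [NormedAddCommGroup E] [CompleteSpace E] {m : ℤ} (hm : m ≠ 0)
    {F : Lm m → E} (hF : Summable F) (he : ∀ M, F (negLm M) = F M) :
    ∑' M, F M = ∑' M : LmPos m, F M.1 + ∑' M : LmPos m, F M.1 := by
  set s : Set (Lm m) := {M | 0 < M.1 0 0 ∨ (M.1 0 0 = 0 ∧ 0 < M.1 0 1)} with hs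
  let e : s ≃ (sᶜ : Set (Lm m)) :=
    { toFun := fun M => ⟨negLm M.1, fun h => (pos_negLm_iff hm M.1).1 h M.2⟩
      invFun := fun M => ⟨negLm M.1, (pos_negLm_iff hm M.1).2 M.2⟩
      left_inv := fun M => Subtype.ext (negLm_negLm _)
      right_inv := fun M => Subtype.ext (negLm_negLm _) }
  have h1 : ∑' M : s, F M + ∑' M : (sᶜ : Set (Lm m)), F M = ∑' M, F M :=
    (hF.subtype s).tsum_add_tsum_compl (hF.subtype sᶜ)
  have h2 : ∑' M : (sᶜ : Set (Lm m)), F M = ∑' M : s, F M := by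
    rw [← e.tsum_eq]
    exact tsum_congr fun M => he M.1
  rw [← h1, h2]
  rfl

lemma toRealMat_neg (M : Matrix (Fin 2) (Fin 2) ℤ) : toRealMat (-M) = (-1 : ℝ) • toRealMat M := by
  ext i j
  simp

lemma bilin_neg_one_smul (M : Matrix (Fin 2) (Fin 2) ℝ) (z₁ z₂ : ℂ) :
    bilin ((-1 : ℝ) • M) z₁ z₂ = -bilin M z₁ z₂ := by
  rw [bilin_smul]; simp

lemma R_neg (z : ℂ × ℂ) (M : Matrix (Fin 2) (Fin 2) ℝ) : R z ((-1 : ℝ) • M) = R z M := by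
  rw [R_eq, R_eq, bilin_neg_one_smul, norm_neg]

/-! ### The divisor `T(m)` -/

/-- Solving f = 0 for z₁ gives z₁ = (b z₂ - a)/(d z₂ - c), the Möbius action of γ = M·(0, -1; 1, 0).
This is a determinant-preserving bijection of integral matrices, so T(m) is the union of the D_M. -/
lemma moeb_eq_iff {γ M : Matrix (Fin 2) (Fin 2) ℤ} (h00 : γ 0 0 = M 0 1) (h01 : γ 0 1 = -M 0 0)
    (h10 : γ 1 0 = M 1 1) (h11 : γ 1 1 = -M 1 0) (hM : M.det ≠ 0) {z : ℂ × ℂ} (hz : z ∈ HH) :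
    z.1 = moeb γ z.2 ↔ bilin (toRealMat M) z.1 z.2 = 0 := by
  have hd : curveDenom (toRealMat M) z.2 ≠ 0 :=
    curveDenom_ne_zero (by rw [det_toRealMat]; exact_mod_cast hM) hz.2
  have e : moeb γ z.2 = curveMap (toRealMat M) z.2 := by
    simp [moeb, curveMap, curveDenom, h00, h01, h10, h11, sub_eq_add_neg]
  rw [e, bilin_eq_mul hd, mul_eq_zero, or_iff_right hd, sub_eq_zero]

lemma mem_T_iff_Lm {m : ℤ} (hm : m ≠ 0) {z : ℂ × ℂ} (hz : z ∈ HH) :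
    z ∈ T m ↔ ∃ M : Lm m, bilin (toRealMat M.1) z.1 z.2 = 0 := by
  constructor
  · rintro ⟨_, γ, h⟩
    have hd : (!![-γ.1 0 1, γ.1 0 0; -γ.1 1 1, γ.1 1 0] : Matrix (Fin 2) (Fin 2) ℤ).det = m := by
      have h0 := γ.2
      rw [Matrix.det_fin_two] at h0
      rw [Matrix.det_fin_two_of]
      linarith
    refine ⟨⟨_, hd⟩, (moeb_eq_iff ?_ ?_ ?_ ?_ (by rwa [hd]) hz).1 h⟩ <;> simp
  · rintro ⟨M, h⟩
    have hd : (!![M.1 0 1, -M.1 0 0; M.1 1 1, -M.1 1 0] : Matrix (Fin 2) (Fin 2) ℤ).det = m := by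
      have h0 := M.2
      rw [Matrix.det_fin_two] at h0
      rw [Matrix.det_fin_two_of]
      linarith
    refine ⟨hz, ⟨_, hd⟩, (moeb_eq_iff ?_ ?_ ?_ ?_ (by rwa [M.2]) hz).2 h⟩ <;> simp

lemma mem_T_iff {m : ℤ} (hm : m ≠ 0) {z : ℂ × ℂ} (hz : z ∈ HH) :
    z ∈ T m ↔ ∃ M : LmPos m, bilin M.mat z.1 z.2 = 0 := by
  rw [mem_T_iff_Lm hm hz]
  constructor
  · rintro ⟨M, h⟩
    by_cases hp : 0 < M.1 0 0 ∨ (M.1 0 0 = 0 ∧ 0 < M.1 0 1)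
    · exact ⟨⟨M, hp⟩, h⟩
    · refine ⟨⟨negLm M, (pos_negLm_iff hm M).2 hp⟩, ?_⟩
      simp only [LmPos.mat, negLm, toRealMat_neg, bilin_neg_one_smul, h, neg_zero]
  · rintro ⟨M, h⟩
    exact ⟨M.1, h⟩

lemma T_subset_HH (m : ℤ) : T m ⊆ HH := fun _ hz => hz.1

lemma DM_subset_T {m : ℤ} (hm : m ≠ 0) (M : LmPos m) : DM M.mat ⊆ T m := fun _ hz =>
  (mem_T_iff hm hz.1).2 ⟨M, (R_eq_zero_iff hz.1 _).1 hz.2⟩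

/-- A nonzero real quadratic polynomial has at most one root in the upper half plane. -/
lemma eq_of_quadratic_eq_zero {A B C : ℝ} (h : ¬(A = 0 ∧ B = 0 ∧ C = 0)) {w w' : ℂ}
    (hw : 0 < w.im) (hw' : 0 < w'.im) (e : A * w ^ 2 + B * w + C = 0)
    (e' : A * w' ^ 2 + B * w' + C = 0) : w = w' := by
  by_contra hne
  have h1 : (w - w') * (A * (w + w') + B) = 0 := by linear_combination e - e'
  have h2 := (mul_eq_zero.1 h1).resolve_left (sub_ne_zero.2 hne)
  -- The imaginary part of A(w + w') + B is A(Im w + Im w'), so A = 0 and the polynomial is linear.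
  have h3 := congrArg Complex.im h2
  simp at h3
  have hA : A = 0 := h3.resolve_right (by linarith)
  rw [hA, Complex.ofReal_zero] at e
  have e2 : (B : ℂ) * w - (-C : ℝ) = 0 := by
    push_cast
    linear_combination e
  obtain ⟨hB, hC⟩ := ofReal_mul_sub_eq_zero hw e2
  exact h ⟨hA, hB, by linarith⟩

/-- The three relations make M' proportional to M: m·M' = l·M with l = a'd - c'b. Taking
determinants gives l² = m². -/
lemma eq_or_eq_neg_of_minors {m : ℤ} (hm : m ≠ 0) {a b c d a' b' c' d' : ℤ}
    (h : a * d - b * c = m) (h' : a' * d' - b' * c' = m) (h1 : b' * d = d' * b)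
    (h2 : a' * c = c' * a) (h3 : a' * d + b' * c = c' * b + d' * a) :
    (a' = a ∧ b' = b ∧ c' = c ∧ d' = d) ∨ (a' = -a ∧ b' = -b ∧ c' = -c ∧ d' = -d) := by
  have ea : m * a' = (a' * d - c' * b) * a := by rw [← h]; linear_combination -b * h2
  have eb : m * b' = (a' * d - c' * b) * b := by
    rw [← h]; linear_combination a * h1 - b * h3
  have ec : m * c' = (a' * d - c' * b) * c := by rw [← h]; linear_combination -d * h2
  have ed : m * d' = (a' * d - c' * b) * d := by
    rw [← h]; linear_combination c * h1 - d * h3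
  generalize a' * d - c' * b = l at *
  have hl : m * (l ^ 2 - m ^ 2) = 0 := by
    have : (m * a') * (m * d') - (m * b') * (m * c') = m ^ 2 * m := by
      rw [← h']; ring
    rw [ea, eb, ec, ed] at this
    have h6 : l ^ 2 * (a * d - b * c) = m ^ 2 * m := by linear_combination this
    rw [h] at h6
    linear_combination h6
  have hl2 : l ^ 2 = m ^ 2 := sub_eq_zero.1 ((mul_eq_zero.1 hl).resolve_left hm)
  rcases sq_eq_sq_iff_eq_or_eq_neg.1 hl2 with rfl | rfl
  · exact Or.inl ⟨mul_left_cancel₀ hm ea, mul_left_cancel₀ hm eb, mul_left_cancel₀ hm ec,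
      mul_left_cancel₀ hm ed⟩
  · refine Or.inr ⟨mul_left_cancel₀ hm ?_, mul_left_cancel₀ hm ?_, mul_left_cancel₀ hm ?_,
      mul_left_cancel₀ hm ?_⟩ <;> linarith

/-- Two different components of `T(m)` meet in at most one point. -/
lemma subsingleton_curveMap_eq {m : ℤ} (hm : m ≠ 0) {M N : LmPos m} (hMN : M ≠ N) :
    {w : ℂ | 0 < w.im ∧ curveMap M.mat w = curveMap N.mat w}.Subsingleton := by
  rintro w ⟨hw, e⟩ w' ⟨hw', e'⟩
  -- Clearing denominators turns equality of the two Möbius maps into a quadratic equation for w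
  -- with integral coefficients.
  have hq : ∀ w : ℂ, 0 < w.im → curveMap M.mat w = curveMap N.mat w →
      (((M.1.1 0 1 * N.1.1 1 1 - N.1.1 0 1 * M.1.1 1 1 : ℤ) : ℝ) : ℂ) * w ^ 2
      + (((N.1.1 0 1 * M.1.1 1 0 + N.1.1 0 0 * M.1.1 1 1 - M.1.1 0 1 * N.1.1 1 0
        - M.1.1 0 0 * N.1.1 1 1 : ℤ) : ℝ) : ℂ) * w
      + (((M.1.1 0 0 * N.1.1 1 0 - N.1.1 0 0 * M.1.1 1 0 : ℤ) : ℝ) : ℂ) = 0 := fun w hw e => by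
    have hd : ∀ P : LmPos m, curveDenom P.mat w ≠ 0 := fun P =>
      curveDenom_ne_zero (by rw [P.det_mat]; exact_mod_cast hm) hw
    rw [curveMap, curveMap, div_eq_div_iff (hd M) (hd N)] at e
    simp only [curveDenom, LmPos.mat, Matrix.map_apply, Complex.ofReal_intCast] at e
    push_cast
    linear_combination e
  refine eq_of_quadratic_eq_zero (fun h => hMN ?_) hw hw' (hq w hw e) (hq w' hw' e')
  obtain ⟨h1, h2, h3⟩ := h
  norm_cast at h1 h2 h3
  have dM := M.1.2
  have dN := N.1.2
  rw [Matrix.det_fin_two] at dM dN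
  have pM := M.2
  have pN := N.2
  have := eq_or_eq_neg_of_minors hm dM dN (by linarith) (by linarith) (by linarith)
  apply LmPos.injective
  rcases this with ⟨e1, e2, e3, e4⟩ | ⟨e1, e2, e3, e4⟩
  · ext i j
    fin_cases i <;> fin_cases j
    exacts [e1.symm, e2.symm, e3.symm, e4.symm]
  -- The sign normalisation forbids N = -M.
  · omega

/-- There are countably many pairs, and each excludes at most one w. -/
lemma ae_curveMap_ne {m : ℤ} (hm : m ≠ 0) : ∀ᵐ w : ℂ, 0 < w.im → ∀ M N : LmPos m, M ≠ N →
    curveMap M.mat w ≠ curveMap N.mat w := by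
  have h : ∀ M N : LmPos m, ∀ᵐ w : ℂ, M ≠ N → 0 < w.im → curveMap M.mat w ≠ curveMap N.mat w :=
    fun M N => by
      by_cases hMN : M = N
      · exact Eventually.of_forall fun w h => absurd hMN h
      · have h0 := (subsingleton_curveMap_eq hm hMN).measure_zero (volume : Measure ℂ)
        filter_upwards [measure_eq_zero_iff_ae_notMem.1 h0] with w hw _ h1 h2
        exact hw ⟨h1, h2⟩
  have h2 := ae_all_iff.2 fun M => ae_all_iff.2 fun N => h M N
  filter_upwards [h2] with w hw h1 M N h3
  exact hw M N h3 h1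

lemma continuous_bilin (M : Matrix (Fin 2) (Fin 2) ℝ) :
    Continuous fun z : ℂ × ℂ => bilin M z.1 z.2 := by
  unfold bilin
  fun_prop

/-- Local finiteness of the components: near a point of `ℍ × ℍ` only the components through this
point are relevant. -/
lemma exists_local_data {m : ℤ} {z₀ : ℂ × ℂ} (hz₀ : z₀ ∈ HH) :
    ∃ (S₀ S₁ : Finset (LmPos m)) (K U : Set (ℂ × ℂ)), IsCompact K ∧ K ⊆ HH ∧ IsOpen U ∧ U ⊆ K ∧
      z₀ ∈ U ∧ S₀ ⊆ S₁ ∧ (∀ M ∈ S₀, bilin M.mat z₀.1 z₀.2 = 0) ∧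
      (∀ M ∉ S₁, ∀ z ∈ K, 1 ≤ R z M.mat) ∧
      (∀ M ∉ S₀, ∀ z ∈ U, bilin M.mat z.1 z.2 ≠ 0) := by
  classical
  obtain ⟨K, hK, hzK, hKH⟩ := exists_compact_subset isOpen_HH hz₀
  have hfin := finite_exists_R_lt (LmPos.injective m) (fun M => M.1.2) hK hKH 1
  set S₁ := hfin.toFinset with hS₁
  have h1 : ∀ M ∉ S₁, ∀ z ∈ K, 1 ≤ R z M.mat := fun M hM z hz => by
    by_contra hlt
    exact hM (hfin.mem_toFinset.2 ⟨z, hz, not_le.1 hlt⟩)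
  set S₀ := S₁.filter fun M => bilin M.mat z₀.1 z₀.2 = 0 with hS₀
  -- Of the finitely many components with small R somewhere on K, those missing z₀ also miss a
  -- neighbourhood of it.
  have hev : ∀ᶠ z in 𝓝 z₀, ∀ M ∈ S₁ \ S₀, bilin M.mat z.1 z.2 ≠ 0 := by
    rw [eventually_all_finset]
    intro M hM
    rw [Finset.mem_sdiff] at hM
    have : bilin M.mat z₀.1 z₀.2 ≠ 0 := fun h => hM.2 (Finset.mem_filter.2 ⟨hM.1, h⟩)
    exact (continuous_bilin M.mat).continuousAt.eventually_ne this
  obtain ⟨V, hV, hVo, hzV⟩ := eventually_nhds_iff.1 hev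
  refine ⟨S₀, S₁, K, interior K ∩ V, hK, hKH, isOpen_interior.inter hVo,
    inter_subset_left.trans interior_subset, ⟨hzK, hzV⟩, Finset.filter_subset _ _,
    fun M hM => (Finset.mem_filter.1 hM).2, h1, fun M hM z hz => ?_⟩
  by_cases hM1 : M ∈ S₁
  · exact hV z hz.2 M (Finset.mem_sdiff.2 ⟨hM1, hM⟩)
  · have hzK : z ∈ K := interior_subset hz.1
    exact (R_pos_iff (hKH hzK) _).1 (lt_of_lt_of_le one_pos (h1 M hM1 z hzK))

/-- When no other component passes through the point, local finiteness makes T(m) coincide with D_M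
nearby. -/
lemma isBranch_T {m : ℤ} (hm : 0 < m) (M : LmPos m) {w : ℂ} (hw : 0 < w.im)
    (hgen : ∀ N : LmPos m, M ≠ N → curveMap M.mat w ≠ curveMap N.mat w) :
    IsBranch (T m) (curveMap M.mat w, w) (curveMap M.mat) := by
  have hdet : ∀ N : LmPos m, 0 < N.mat.det := fun N => by rw [N.det_mat]; exact_mod_cast hm
  have hp : (curveMap M.mat w, w) ∈ HH := ⟨im_curveMap_pos (hdet M) hw, hw⟩
  obtain ⟨S₀, S₁, K, U, -, hKH, hU, hUK, hzU, -, h0, -, h2⟩ := exists_local_data (m := m) hp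
  refine ⟨analyticAt_curveMap (hdet M).ne' hw, rfl, ?_⟩
  filter_upwards [hU.mem_nhds hzU] with q hq
  have hqH := hKH (hUK hq)
  rw [mem_T_iff hm.ne' hqH]
  have hd : curveDenom M.mat q.2 ≠ 0 := curveDenom_ne_zero (hdet M).ne' hqH.2
  have hiff : bilin M.mat q.1 q.2 = 0 ↔ q.1 = curveMap M.mat q.2 := by
    rw [bilin_eq_mul hd, mul_eq_zero, or_iff_right hd, sub_eq_zero]
  rw [← hiff]
  refine ⟨fun ⟨N, hN⟩ => ?_, fun h => ⟨M, h⟩⟩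
  by_contra hne
  have hMN : M ≠ N := fun h => hne (h ▸ hN)
  have hNS : N ∈ S₀ := by
    by_contra h
    exact h2 N h q hq hN
  have h3 := h0 N hNS
  have hdN : curveDenom N.mat w ≠ 0 := curveDenom_ne_zero (hdet N).ne' hw
  simp only at h3
  rw [bilin_eq_mul hdN, mul_eq_zero, or_iff_right hdN, sub_eq_zero] at h3
  exact hgen N hMN h3

/-- Fibrewise decomposition of `δ_{T(m)}` into components. -/
lemma tsum_branches_T {m : ℤ} (hm : 0 < m) (η : Form11) {w : ℂ} (hw : 0 < w.im)
    (hgen : ∀ M N : LmPos m, M ≠ N → curveMap M.mat w ≠ curveMap N.mat w) :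
    (∑' z₁ : {z₁ : ℂ // ∃ f, IsBranch (T m) (z₁, w) f},
      (let s : ℂ := deriv z₁.2.choose w
       let p : ℂ × ℂ := (z₁.1, w)
       η 0 0 p * (s * star s) + η 0 1 p * s + η 1 0 p * star s + η 1 1 p))
      = ∑' M : LmPos m, curvePull M.mat η w := by
  have hdet : ∀ N : LmPos m, 0 < N.mat.det := fun N => by rw [N.det_mat]; exact_mod_cast hm
  let Φ : LmPos m → {z₁ : ℂ // ∃ f, IsBranch (T m) (z₁, w) f} := fun M =>
    ⟨curveMap M.mat w, _, isBranch_T hm M hw (hgen M)⟩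
  have hΦ : Function.Bijective Φ := by
    constructor
    · intro M N h
      by_contra hne
      exact hgen M N hne (congrArg Subtype.val h)
    · rintro ⟨z₁, f, hf⟩
      have hz := hf.mem
      obtain ⟨M, hM⟩ := (mem_T_iff hm.ne' (T_subset_HH m hz)).1 hz
      have hd : curveDenom M.mat w ≠ 0 := curveDenom_ne_zero (hdet M).ne' hw
      simp only at hM
      rw [bilin_eq_mul hd, mul_eq_zero, or_iff_right hd, sub_eq_zero] at hM
      exact ⟨M, Subtype.ext hM.symm⟩
  rw [← (Equiv.ofBijective Φ hΦ).tsum_eq]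
  refine tsum_congr fun M => ?_
  have hs := (Φ M).2.choose_spec.deriv_eq (hdet M) (DM_subset_T hm.ne' M) hw
  simp only [curvePull, ← hs]
  rfl

/-! ### The series over `LmPos m` -/

section Series

variable {E : Type*} [NormedAddCommGroup E] [NormedSpace ℝ E] [CompleteSpace E] {m : ℤ} {a : ℝ}
  {h : ℝ → ℝ} {q : Matrix (Fin 2) (Fin 2) ℝ → ℂ × ℂ → E}

lemma summable_LmPos (ha : 0 < a) (hh : HasExpDecay a h) (hq : IsTemperedFamily q) {z : ℂ × ℂ}
    (hz : z ∈ HH) : Summable fun M : LmPos m => h (R z M.mat) • q M.mat z :=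
  summable_comp_R (LmPos.injective m) (fun M => M.1.2) ha hh hq hz

lemma summable_Lm (ha : 0 < a) (hh : HasExpDecay a h) (hq : IsTemperedFamily q) {z : ℂ × ℂ}
    (hz : z ∈ HH) : Summable fun M : Lm m => h (R z (toRealMat M.1)) • q (toRealMat M.1) z :=
  summable_comp_R Subtype.val_injective (fun M => M.2) ha hh hq hz

lemma contDiffOn_tsum_notMem (ha : 0 < a) (hh : HasExpDecay a h) (hq : IsTemperedFamily q)
    {S : Finset (LmPos m)} {K U : Set (ℂ × ℂ)} (hK : IsCompact K) (hKH : K ⊆ HH) (hU : IsOpen U)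
    (hUK : U ⊆ K) (h1 : ∀ M ∉ S, ∀ z ∈ K, 1 ≤ R z M.mat) :
    ContDiffOn ℝ ∞ (fun z => ∑' M : {M // M ∉ S}, h (R z M.1.mat) • q M.1.mat z) U :=
  contDiffOn_tsum_comp_R (φ := fun M : {M // M ∉ S} => M.1.1.1)
    ((LmPos.injective m).comp Subtype.val_injective) (fun M => M.1.1.2) ha hh hq hK hKH hU hUK
    fun M z hz => h1 M.1 M.2 z (hUK hz)

/-- Meant for terms that stay smooth where R = 0, such as the Schwartz forms: locally, finitely many
terms are split off and the rest converge with all derivatives. -/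
lemma contDiffOn_tsum_LmPos (ha : 0 < a) (hh : HasExpDecay a h) (hq : IsTemperedFamily q)
    (hs : ∀ M : LmPos m, ContDiffOn ℝ ∞ (fun z => h (R z M.mat) • q M.mat z) HH) :
    ContDiffOn ℝ ∞ (fun z => ∑' M : LmPos m, h (R z M.mat) • q M.mat z) HH := by
  intro z₀ hz₀
  obtain ⟨S₀, S₁, K, U, hK, hKH, hU, hUK, hzU, -, -, h1, -⟩ := exists_local_data (m := m) hz₀
  have e : EqOn (fun z => ∑' M : LmPos m, h (R z M.mat) • q M.mat z)
      (fun z => ∑ M ∈ S₁, h (R z M.mat) • q M.mat z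
        + ∑' M : {M // M ∉ S₁}, h (R z M.1.mat) • q M.1.mat z) U := fun z hz =>
    ((summable_LmPos ha hh hq (hKH (hUK hz))).sum_add_tsum_subtype_compl S₁).symm
  have hc : ContDiffOn ℝ ∞ (fun z => ∑ M ∈ S₁, h (R z M.mat) • q M.mat z
        + ∑' M : {M // M ∉ S₁}, h (R z M.1.mat) • q M.1.mat z) U :=
    (ContDiffOn.sum fun M _ => (hs M).mono (hUK.trans hKH)).add
      (contDiffOn_tsum_notMem ha hh hq hK hKH hU hUK h1)
  exact ((hc.congr e).contDiffAt (hU.mem_nhds hzU)).contDiffWithinAt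

end Series

lemma isTemperedFamily_one : IsTemperedFamily fun _ _ => (1 : ℝ) :=
  isTemperedFamily_const contDiffOn_const

lemma hasExpDecay_negEi_two_pi {v : ℝ} (hv : 0 < v) :
    HasExpDecay (2 * Real.pi * v) fun t => negEi (2 * Real.pi * v * t) :=
  hasExpDecay_negEi (by positivity)

lemma summable_XiTerm {v : ℝ} (hv : 0 < v) (m : ℤ) {z : ℂ × ℂ} (hz : z ∈ HH) :
    Summable fun M : Lm m => XiTerm v z M.1 := by
  have h := summable_Lm (m := m) (by positivity) (hasExpDecay_negEi_two_pi hv)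
    isTemperedFamily_one hz
  simp only [smul_eq_mul, mul_one] at h
  exact h

lemma summable_negEi_LmPos {v : ℝ} (hv : 0 < v) (m : ℤ) {z : ℂ × ℂ} (hz : z ∈ HH) :
    Summable fun M : LmPos m => negEi (2 * Real.pi * v * R z M.mat) := by
  simpa using summable_LmPos (m := m) (by positivity) (hasExpDecay_negEi_two_pi hv)
    isTemperedFamily_one hz

lemma Xi_eq_tsum {v : ℝ} (hv : 0 < v) {m : ℤ} (hm : m ≠ 0) {z : ℂ × ℂ} (hz : z ∈ HH) :
    Xi v m z = ∑' M : LmPos m, negEi (2 * Real.pi * v * R z M.mat) := by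
  have h := tsum_Lm_eq hm (summable_XiTerm hv m hz) fun M => by
    change negEi (2 * Real.pi * v * R z (toRealMat (-M.1))) = _
    rw [toRealMat_neg, R_neg]
    rfl
  rw [Xi, h]
  change 1 / 2 * ((∑' M : LmPos m, negEi (2 * Real.pi * v * R z M.mat))
    + ∑' M : LmPos m, negEi (2 * Real.pi * v * R z M.mat)) = _
  ring

/-! ### The sum of the Schwartz forms -/

/-- The polynomial part of `schwartzForm`. -/
def schwartzPoly (r : ℝ) (j k : Fin 2) (M : Matrix (Fin 2) (Fin 2) ℝ) (z : ℂ × ℂ) : ℂ :=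
  -(1 / (2 * Real.pi * Complex.I)) * (2 * Real.pi * r) * quadCoeff M j k z
    + -(1 / (2 * Real.pi * Complex.I)) * hypCoeff j k z

lemma schwartzForm_eq (r : ℝ) (M : Matrix (Fin 2) (Fin 2) ℝ) (j k : Fin 2) (z : ℂ × ℂ) :
    schwartzForm r M j k z
      = Real.exp (-(2 * Real.pi * r * R z M)) • schwartzPoly r j k M z := by
  rw [schwartzForm, schwartzPoly, Complex.real_smul]
  ring

lemma isTemperedFamily_schwartzPoly (r : ℝ) (j k : Fin 2) :
    IsTemperedFamily (schwartzPoly r j k) := by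
  have h1 := ((isQuadraticFamily_quadCoeff j k).clm_comp (ContinuousLinearMap.mul ℝ ℂ
    (-(1 / (2 * Real.pi * Complex.I)) * (2 * Real.pi * r)))).isTemperedFamily
  exact h1.add (isTemperedFamily_const (contDiffOn_const.mul (contDiffOn_hypCoeff j k)))

/-- The form `dd^c Ξ(v, z, m)` off `T(m)`, as a sum of Schwartz forms. -/
def XiForm (v : ℝ) (m : ℤ) : Form11 := fun j k z => ∑' M : LmPos m, schwartzForm v M.mat j k z

lemma summable_schwartzForm {v : ℝ} (hv : 0 < v) (m : ℤ) (j k : Fin 2) {z : ℂ × ℂ} (hz : z ∈ HH) :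
    Summable fun M : LmPos m => schwartzForm v M.mat j k z := by
  simp_rw [schwartzForm_eq]
  exact summable_LmPos (by positivity) (hasExpDecay_exp (2 * Real.pi * v))
    (isTemperedFamily_schwartzPoly v j k) hz

lemma summable_schwartzForm_Lm {v : ℝ} (hv : 0 < v) (m : ℤ) (j k : Fin 2) {z : ℂ × ℂ}
    (hz : z ∈ HH) : Summable fun M : Lm m => schwartzForm v (toRealMat M.1) j k z := by
  simp_rw [schwartzForm_eq]
  exact summable_Lm (by positivity) (hasExpDecay_exp (2 * Real.pi * v))
    (isTemperedFamily_schwartzPoly v j k) hz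

lemma isSmooth_XiForm {v : ℝ} (hv : 0 < v) (m : ℤ) : (XiForm v m).IsSmooth := fun j k => by
  have h := contDiffOn_tsum_LmPos (m := m) (by positivity) (hasExpDecay_exp (2 * Real.pi * v))
    (isTemperedFamily_schwartzPoly v j k) fun M => by
      simp_rw [← schwartzForm_eq]
      exact isSmooth_schwartzForm v M.mat j k
  simp_rw [← schwartzForm_eq] at h
  exact h

lemma schwartzForm_neg (r : ℝ) (M : Matrix (Fin 2) (Fin 2) ℝ) :
    schwartzForm r ((-1 : ℝ) • M) = schwartzForm r M := by
  have h : ∀ j z, gradCoeff ((-1 : ℝ) • M) j z = -gradCoeff M j z := fun j z => by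
    simp only [gradCoeff, bilin_neg_one_smul]
    split_ifs <;> ring
  funext j k z
  simp only [schwartzForm, quadCoeff, R_neg, h, star_neg, neg_mul_neg]

/-- The group acts on all matrices of determinant m but does not preserve the chosen representatives
modulo sign, so invariance has to be read off from the full sum. -/
lemma XiForm_add_self {v : ℝ} (hv : 0 < v) {m : ℤ} (hm : m ≠ 0) (j k : Fin 2) {z : ℂ × ℂ}
    (hz : z ∈ HH) : XiForm v m j k z + XiForm v m j k z
      = ∑' M : Lm m, schwartzForm v (toRealMat M.1) j k z := by
  rw [tsum_Lm_eq hm (summable_schwartzForm_Lm hv m j k hz) fun M => by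
    change schwartzForm v (toRealMat (-M.1)) j k z = _
    rw [toRealMat_neg, schwartzForm_neg]]
  rfl

/-! ### Invariance under `SL₂(ℤ) × SL₂(ℤ)` -/

/-- The automorphy factor `c z + d`. -/
def autFactor (γ : Matrix (Fin 2) (Fin 2) ℤ) (z : ℂ) : ℂ := γ 1 0 * z + γ 1 1

lemma autFactor_ne_zero {γ : Matrix (Fin 2) (Fin 2) ℤ} (hγ : γ.det = 1) {z : ℂ} (hz : 0 < z.im) :
    autFactor γ z ≠ 0 := fun h => by
  have e : (((γ 1 0 : ℤ) : ℝ) : ℂ) * z - ((-(γ 1 1 : ℤ) : ℝ) : ℂ) = 0 := by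
    rw [autFactor] at h
    push_cast
    linear_combination h
  obtain ⟨h1, h2⟩ := ofReal_mul_sub_eq_zero hz e
  rw [neg_eq_zero] at h2
  norm_cast at h1 h2
  rw [Matrix.det_fin_two, h1, h2] at hγ
  simp at hγ

lemma star_autFactor (γ : Matrix (Fin 2) (Fin 2) ℤ) (z : ℂ) :
    star (autFactor γ z) = autFactor γ (star z) := by
  simp [autFactor]

lemma star_moeb (γ : Matrix (Fin 2) (Fin 2) ℤ) (z : ℂ) : star (moeb γ z) = moeb γ (star z) := by
  simp [moeb]

lemma moeb_sub_star {γ : Matrix (Fin 2) (Fin 2) ℤ} (hγ : γ.det = 1) {z : ℂ} (hz : 0 < z.im) :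
    moeb γ z - star (moeb γ z) = (z - star z) / (autFactor γ z * star (autFactor γ z)) := by
  have h1 := autFactor_ne_zero hγ hz
  have h2 : star (autFactor γ z) ≠ 0 := star_ne_zero.2 h1
  have hd : (γ 0 0 : ℂ) * γ 1 1 - γ 0 1 * γ 1 0 = 1 := by
    rw [Matrix.det_fin_two] at hγ
    exact_mod_cast hγ
  rw [star_moeb]
  rw [star_autFactor] at *
  change ((γ 0 0 : ℂ) * z + γ 0 1) / autFactor γ z
    - ((γ 0 0 : ℂ) * star z + γ 0 1) / autFactor γ (star z) = _
  rw [div_sub_div _ _ h1 h2]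
  congr 1
  simp only [autFactor]
  linear_combination (z - star z) * hd

lemma im_moeb_pos {γ : Matrix (Fin 2) (Fin 2) ℤ} (hγ : γ.det = 1) {z : ℂ} (hz : 0 < z.im) :
    0 < (moeb γ z).im := by
  have h1 := autFactor_ne_zero hγ hz
  have h := moeb_sub_star hγ hz
  have h2 : autFactor γ z * star (autFactor γ z) = ((Complex.normSq (autFactor γ z) : ℝ) : ℂ) :=
    Complex.mul_conj _
  rw [h2] at h
  have h3 := congrArg Complex.im h
  rw [Complex.div_ofReal_im] at h3
  simp only [Complex.sub_im, Complex.star_def, Complex.conj_im] at h3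
  have h4 := Complex.normSq_pos.2 h1
  have h5 : 0 < (z.im - -z.im) / Complex.normSq (autFactor γ z) := by
    apply div_pos _ h4
    linarith
  linarith

lemma act_mem {γ : Fin 2 → Matrix.SpecialLinearGroup (Fin 2) ℤ} {z : ℂ × ℂ} (hz : z ∈ HH) :
    act γ z ∈ HH := ⟨im_moeb_pos (γ 0).2 hz.1, im_moeb_pos (γ 1).2 hz.2⟩

/-- The right action of `SL₂(ℤ) × SL₂(ℤ)` on integral matrices of determinant `m`. -/
def pullLm {m : ℤ} (γ : Fin 2 → Matrix.SpecialLinearGroup (Fin 2) ℤ) : Lm m ≃ Lm m where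
  toFun M := ⟨((γ 0)⁻¹).1 * M.1 * ((γ 1)⁻¹).1.transpose, by
    rw [Matrix.det_mul, Matrix.det_mul, Matrix.det_transpose, ((γ 0)⁻¹).2, ((γ 1)⁻¹).2, M.2]
    ring⟩
  invFun M := ⟨(γ 0).1 * M.1 * (γ 1).1.transpose, by simp [M.2, (γ 0).2, (γ 1).2]⟩
  left_inv M := Subtype.ext (by
    have h0 : (γ 0).1 * ((γ 0)⁻¹).1 = 1 := congrArg Subtype.val (mul_inv_cancel (γ 0))
    have h1 : ((γ 1)⁻¹).1.transpose * (γ 1).1.transpose = 1 := by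
      rw [← Matrix.transpose_mul, show (γ 1).1 * ((γ 1)⁻¹).1 = 1 from
        congrArg Subtype.val (mul_inv_cancel (γ 1)), Matrix.transpose_one]
    calc _ = ((γ 0).1 * ((γ 0)⁻¹).1) * M.1 * (((γ 1)⁻¹).1.transpose * (γ 1).1.transpose) := by
          simp only [Matrix.mul_assoc]
      _ = M.1 := by rw [h0, h1, Matrix.one_mul, Matrix.mul_one])
  right_inv M := Subtype.ext (by
    have h0 : ((γ 0)⁻¹).1 * (γ 0).1 = 1 := congrArg Subtype.val (inv_mul_cancel (γ 0))
    have h1 : (γ 1).1.transpose * ((γ 1)⁻¹).1.transpose = 1 := by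
      rw [← Matrix.transpose_mul, show ((γ 1)⁻¹).1 * (γ 1).1 = 1 from
        congrArg Subtype.val (inv_mul_cancel (γ 1)), Matrix.transpose_one]
    calc _ = (((γ 0)⁻¹).1 * (γ 0).1) * M.1 * ((γ 1).1.transpose * ((γ 1)⁻¹).1.transpose) := by
          simp only [Matrix.mul_assoc]
      _ = M.1 := by rw [h0, h1, Matrix.one_mul, Matrix.mul_one])

section Invariance

variable {m : ℤ} (γ : Fin 2 → Matrix.SpecialLinearGroup (Fin 2) ℤ) (M : Lm m)

/-- The polynomial is (1, -z₁) M (1, -z₂)ᵗ, and (1, -γz) = (1, -z)γ⁻¹ / (cz + d). The points are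
allowed to be arbitrary because conjugate arguments occur as well. -/
lemma bilin_moeb {z₁ z₂ : ℂ} (h₁ : autFactor (γ 0).1 z₁ ≠ 0) (h₂ : autFactor (γ 1).1 z₂ ≠ 0) :
    bilin (toRealMat M.1) (moeb (γ 0).1 z₁) (moeb (γ 1).1 z₂)
      = bilin (toRealMat (pullLm γ M).1) z₁ z₂
        / (autFactor (γ 0).1 z₁ * autFactor (γ 1).1 z₂) := by
  have e₁ : moeb (γ 0).1 z₁ = (((γ 0).1 0 0 : ℂ) * z₁ + (γ 0).1 0 1) / autFactor (γ 0).1 z₁ := rfl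
  have e₂ : moeb (γ 1).1 z₂ = (((γ 1).1 0 0 : ℂ) * z₂ + (γ 1).1 0 1) / autFactor (γ 1).1 z₂ := rfl
  rw [e₁, e₂, eq_div_iff (mul_ne_zero h₁ h₂), bilin]
  field_simp
  simp only [bilin, autFactor, pullLm, Equiv.coe_fn_mk, Matrix.SpecialLinearGroup.coe_inv,
    Matrix.adjugate_fin_two, Matrix.map_apply, Matrix.mul_apply, Fin.sum_univ_two,
    Matrix.transpose_apply, Matrix.of_apply, Matrix.cons_val', Matrix.cons_val_zero,
    Matrix.cons_val_one, Matrix.cons_val_fin_one]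
  push_cast
  ring

lemma bilin_act {z : ℂ × ℂ} (hz : z ∈ HH) : bilin (toRealMat M.1) (act γ z).1 (act γ z).2
      = bilin (toRealMat (pullLm γ M).1) z.1 z.2
        / (autFactor (γ 0).1 z.1 * autFactor (γ 1).1 z.2) :=
  bilin_moeb γ M (autFactor_ne_zero (γ 0).2 hz.1) (autFactor_ne_zero (γ 1).2 hz.2)

lemma R_act {z : ℂ × ℂ} (hz : z ∈ HH) :
    R (act γ z) (toRealMat M.1) = R z (toRealMat (pullLm γ M).1) := by
  have h0 := autFactor_ne_zero (γ 0).2 hz.1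
  have h1 := autFactor_ne_zero (γ 1).2 hz.2
  have h0' := star_ne_zero.2 h0
  have h1' := star_ne_zero.2 h1
  have e : ((R (act γ z) (toRealMat M.1) : ℝ) : ℂ) = R z (toRealMat (pullLm γ M).1) := by
    rw [ofReal_R, ofReal_R, ← star_bilin, ← star_bilin, bilin_act γ M hz,
      show (act γ z).1 - star (act γ z).1 = _ from moeb_sub_star (γ 0).2 hz.1,
      show (act γ z).2 - star (act γ z).2 = _ from moeb_sub_star (γ 1).2 hz.2,
      star_div₀, star_mul]
    have g0 := sub_star_ne_zero hz.1
    have g1 := sub_star_ne_zero hz.2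
    -- The automorphy factors and their conjugates become independent symbols, so only a rational
    -- identity remains.
    generalize star (autFactor (γ 0).1 z.1) = J0' at *
    generalize star (autFactor (γ 1).1 z.2) = J1' at *
    generalize autFactor (γ 0).1 z.1 = J0 at *
    generalize autFactor (γ 1).1 z.2 = J1 at *
    field_simp
  exact_mod_cast e

lemma gradCoeff_zero_act {z : ℂ × ℂ} (hz : z ∈ HH) :
    gradCoeff (toRealMat M.1) 0 (act γ z) = gradCoeff (toRealMat (pullLm γ M).1) 0 z
      * (autFactor (γ 0).1 z.1 / autFactor (γ 1).1 z.2) := by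
  have h0 := autFactor_ne_zero (γ 0).2 hz.1
  have h1 := autFactor_ne_zero (γ 1).2 hz.2
  have h0' := star_ne_zero.2 h0
  have g0 := sub_star_ne_zero hz.1
  have e : bilin (toRealMat M.1) (star (act γ z).1) (act γ z).2
      = bilin (toRealMat (pullLm γ M).1) (star z.1) z.2
        / (star (autFactor (γ 0).1 z.1) * autFactor (γ 1).1 z.2) := by
    rw [star_autFactor]
    rw [star_autFactor] at h0'
    rw [← bilin_moeb γ M h0' h1, ← star_moeb]
    rfl
  rw [gradCoeff_zero, gradCoeff_zero, e,
    show (act γ z).1 - star (act γ z).1 = _ from moeb_sub_star (γ 0).2 hz.1]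
  generalize star (autFactor (γ 0).1 z.1) = J0' at *
  field_simp

lemma gradCoeff_one_act {z : ℂ × ℂ} (hz : z ∈ HH) :
    gradCoeff (toRealMat M.1) 1 (act γ z) = gradCoeff (toRealMat (pullLm γ M).1) 1 z
      * (autFactor (γ 1).1 z.2 / autFactor (γ 0).1 z.1) := by
  have h0 := autFactor_ne_zero (γ 0).2 hz.1
  have h1 := autFactor_ne_zero (γ 1).2 hz.2
  have h1' := star_ne_zero.2 h1
  have g1 := sub_star_ne_zero hz.2
  have e : bilin (toRealMat M.1) (act γ z).1 (star (act γ z).2)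
      = bilin (toRealMat (pullLm γ M).1) z.1 (star z.2)
        / (autFactor (γ 0).1 z.1 * star (autFactor (γ 1).1 z.2)) := by
    rw [star_autFactor]
    rw [star_autFactor] at h1'
    rw [← bilin_moeb γ M h0 h1', ← star_moeb]
    rfl
  rw [gradCoeff_one, gradCoeff_one, e,
    show (act γ z).2 - star (act γ z).2 = _ from moeb_sub_star (γ 1).2 hz.2]
  generalize star (autFactor (γ 1).1 z.2) = J1' at *
  field_simp

/-- Equivariance of the Schwartz forms. -/
lemma schwartzForm_act (r : ℝ) {z : ℂ × ℂ} (hz : z ∈ HH) (j k : Fin 2) :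
    schwartzForm r (toRealMat M.1) j k (act γ z) * actDeriv γ j z * star (actDeriv γ k z)
      = schwartzForm r (toRealMat (pullLm γ M).1) j k z := by
  have h0 := autFactor_ne_zero (γ 0).2 hz.1
  have h1 := autFactor_ne_zero (γ 1).2 hz.2
  have h0' := star_ne_zero.2 h0
  have h1' := star_ne_zero.2 h1
  have g0 := sub_star_ne_zero hz.1
  have g1 := sub_star_ne_zero hz.2
  have hb : ∀ y : ℂ, y - star y ≠ 0 → -1 / (4 * (y.im : ℂ) ^ 2) = 1 / (y - star y) ^ 2 :=
    fun y hy => by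
      rw [ofReal_im_eq, div_pow, mul_pow, Complex.I_sq]
      field_simp
      ring
  have a0 := sub_star_ne_zero (act_mem (γ := γ) hz).1
  have a1 := sub_star_ne_zero (act_mem (γ := γ) hz).2
  have m0 : (act γ z).1 - star (act γ z).1 = _ := moeb_sub_star (γ 0).2 hz.1
  have m1 : (act γ z).2 - star (act γ z).2 = _ := moeb_sub_star (γ 1).2 hz.2
  have hquad : quadCoeff (toRealMat M.1) j k (act γ z) * actDeriv γ j z * star (actDeriv γ k z)
      = quadCoeff (toRealMat (pullLm γ M).1) j k z := by
    have d0 : actDeriv γ 0 z = 1 / autFactor (γ 0).1 z.1 ^ 2 := rfl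
    have d1 : actDeriv γ 1 z = 1 / autFactor (γ 1).1 z.2 ^ 2 := rfl
    simp only [quadCoeff, two_mul_im_mul_im, m0, m1]
    fin_cases j <;> fin_cases k <;>
    simp only [Fin.zero_eta, Fin.mk_one, gradCoeff_zero_act γ M hz, gradCoeff_one_act γ M hz, d0,
      d1, star_div₀, star_mul, star_one, star_pow] <;>
    generalize star (autFactor (γ 0).1 z.1) = J0' at * <;>
    generalize star (autFactor (γ 1).1 z.2) = J1' at * <;>
    field_simp
  have hhyp : hypCoeff j k (act γ z) * actDeriv γ j z * star (actDeriv γ k z)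
      = hypCoeff j k z := by
    have d0 : actDeriv γ 0 z = 1 / autFactor (γ 0).1 z.1 ^ 2 := rfl
    have d1 : actDeriv γ 1 z = 1 / autFactor (γ 1).1 z.2 ^ 2 := rfl
    simp only [hypCoeff, hb _ a0, hb _ a1, hb _ g0, hb _ g1, m0, m1]
    fin_cases j <;> fin_cases k <;>
    simp only [Fin.zero_eta, Fin.mk_one, d0, d1, star_div₀, star_one, star_pow, Matrix.of_apply,
      Matrix.cons_val', Matrix.cons_val_zero, Matrix.cons_val_one, Matrix.cons_val_fin_one,
      zero_mul] <;>
    generalize star (autFactor (γ 0).1 z.1) = J0' at * <;>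
    generalize star (autFactor (γ 1).1 z.2) = J1' at * <;>
    field_simp
  simp only [schwartzForm, R_act γ M hz]
  rw [← hquad, ← hhyp]
  ring

end Invariance

lemma act_mem_T_iff {m : ℤ} (hm : m ≠ 0) (γ : Fin 2 → Matrix.SpecialLinearGroup (Fin 2) ℤ)
    {z : ℂ × ℂ} (hz : z ∈ HH) : act γ z ∈ T m ↔ z ∈ T m := by
  rw [mem_T_iff_Lm hm (act_mem hz), mem_T_iff_Lm hm hz]
  refine Iff.trans (exists_congr fun M => ?_) ((pullLm γ).exists_congr_right
    (q := fun M : Lm m => bilin (toRealMat M.1) z.1 z.2 = 0))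
  rw [bilin_act γ M hz, div_eq_zero_iff, or_iff_left (mul_ne_zero
    (autFactor_ne_zero (γ 0).2 hz.1) (autFactor_ne_zero (γ 1).2 hz.2))]

lemma Xi_act (v : ℝ) {m : ℤ} (γ : Fin 2 → Matrix.SpecialLinearGroup (Fin 2) ℤ) {z : ℂ × ℂ}
    (hz : z ∈ HH) : Xi v m (act γ z) = Xi v m z := by
  rw [Xi, Xi, ← (pullLm γ).tsum_eq fun M : Lm m => XiTerm v z M.1]
  congr 1
  refine tsum_congr fun M => ?_
  exact congrArg (fun t => negEi (2 * Real.pi * v * t)) (R_act γ M hz)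

lemma isInvariant_XiForm {v : ℝ} (hv : 0 < v) {m : ℤ} (hm : m ≠ 0) :
    (XiForm v m).IsInvariant := fun γ z hz j k => by
  have h : XiForm v m j k (act γ z) * actDeriv γ j z * star (actDeriv γ k z)
      + XiForm v m j k (act γ z) * actDeriv γ j z * star (actDeriv γ k z)
      = XiForm v m j k z + XiForm v m j k z := by
    rw [← add_mul, ← add_mul, XiForm_add_self hv hm j k hz, XiForm_add_self hv hm j k (act_mem hz),
      ← (pullLm γ).tsum_eq fun M : Lm m => schwartzForm v (toRealMat M.1) j k z, ← tsum_mul_right, ← tsum_mul_right]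
    exact tsum_congr fun M => schwartzForm_act γ M v hz j k
  rw [← two_mul, ← two_mul] at h
  exact mul_left_cancel₀ two_ne_zero h

/-! ### Local integrability and the current equation for `Ξ` -/

/-- On a compact set this is a finite sum of terms integrable by part (1) plus a continuous
remainder. -/
lemma locallyIntegrableOn_Xi {v : ℝ} (hv : 0 < v) {m : ℤ} (hm : m ≠ 0) :
    LocallyIntegrableOn (Xi v m) HH := locallyIntegrableOn_HH fun K hK hKH => by
  obtain ⟨L, hL, hKL, hLH⟩ := exists_compact_between hK isOpen_HH hKH
  have hfin := finite_exists_R_lt (LmPos.injective m) (fun M => M.1.2) hL hLH 1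
  have h1 : ∀ M ∉ hfin.toFinset, ∀ z ∈ L, 1 ≤ R z M.mat := fun M hM z hz => by
    by_contra hlt
    exact hM (hfin.mem_toFinset.2 ⟨z, hz, not_le.1 hlt⟩)
  have hc := contDiffOn_tsum_notMem (by positivity) (hasExpDecay_negEi_two_pi hv)
    isTemperedFamily_one hL hLH isOpen_interior interior_subset h1
  simp only [smul_eq_mul, mul_one] at hc
  have hsum : IntegrableOn (fun z => ∑ M ∈ hfin.toFinset, negEi (2 * Real.pi * v * R z M.mat)
      + ∑' M : {M // M ∉ hfin.toFinset}, negEi (2 * Real.pi * v * R z M.1.mat)) K :=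
    (integrable_finsetSum _ fun M _ =>
      integrableOn_negEi_comp_R hv (M.mat_ne_zero hm) hK hKH).add
      ((hc.continuousOn.mono hKL).integrableOn_compact hK)
  refine hsum.congr_fun (fun z hz => ?_) hK.measurableSet
  rw [Xi_eq_tsum hv hm (hKH hz)]
  exact (summable_negEi_LmPos hv m (hKH hz)).sum_add_tsum_subtype_compl _

/-! ### Termwise integration of the series -/

lemma topIntegral_congr {f g : ℂ × ℂ → ℂ} (h : ∀ z ∈ HH, f z = g z) :
    topIntegral f = topIntegral g :=
  setIntegral_congr_fun measurableSet_HH fun z hz => by simp only [h z hz]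

lemma topIntegral_eq_of_forall_notMem {f : ℂ × ℂ → ℂ} {K : Set (ℂ × ℂ)} (hKH : K ⊆ HH)
    (h0 : ∀ z ∉ K, f z = 0) : topIntegral f = ∫ z in K, (-4 : ℂ) * f z := by
  rw [topIntegral]
  apply setIntegral_eq_of_subset_of_forall_sdiff_eq_zero measurableSet_HH hKH
  intro z hz
  rw [h0 z hz.2, mul_zero]

/-- The uniform bound is asked of all but finitely many terms, the others being merely integrable;
this leaves room for the terms with a logarithmic singularity on K. -/
lemma hasSum_topIntegral {ι : Type*} [Countable ι] {F : ι → ℂ × ℂ → ℂ} {K : Set (ℂ × ℂ)}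
    (hK : IsCompact K) (hKH : K ⊆ HH) (h0 : ∀ i, ∀ z ∉ K, F i z = 0)
    (hint : ∀ i, IntegrableOn (F i) K) {u : ι → ℝ} (hu : Summable u)
    (hb : ∀ᶠ i in cofinite, ∀ z ∈ K, ‖F i z‖ ≤ u i) :
    HasSum (fun i => topIntegral (F i)) (topIntegral fun z => ∑' i, F i z) := by
  have hfin : IsFiniteMeasure (volume.restrict K) :=
    ⟨by rw [Measure.restrict_apply_univ]; exact hK.measure_lt_top⟩
  have h1 : Summable fun i => ∫ z in K, ‖(-4 : ℂ) * F i z‖ := by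
    refine Summable.of_norm_bounded_eventually
      (g := fun i => (volume.restrict K).real univ * (4 * u i)) ((hu.mul_left _).mul_left _) ?_
    filter_upwards [hb] with i hi
    rw [Real.norm_eq_abs, abs_of_nonneg (integral_nonneg fun _ => norm_nonneg _)]
    refine (setIntegral_mono_on ((hint i).const_mul _).norm (integrable_const (4 * u i))
      hK.measurableSet fun z hz => ?_).trans (by rw [integral_const, smul_eq_mul])
    rw [norm_mul, norm_neg, Complex.norm_ofNat]
    exact mul_le_mul_of_nonneg_left (hi z hz) (by norm_num)
  have h2 := hasSum_integral_of_summable_integral_norm (fun i => (hint i).const_mul (-4 : ℂ)) h1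
  simp_rw [fun i => topIntegral_eq_of_forall_notMem hKH (h0 i)]
  rw [topIntegral_eq_of_forall_notMem hKH fun z hz => by simp [h0 _ z hz]]
  simp_rw [← tsum_mul_left]
  exact h2

lemma hasSum_ddcCurrent_negEi {v : ℝ} (hv : 0 < v) {m : ℤ} (hm : m ≠ 0) {η : Form11}
    (hη : η.IsTest) :
    HasSum (fun M : LmPos m => ddcCurrent (fun z => negEi (2 * Real.pi * v * R z M.mat)) η)
      (ddcCurrent (Xi v m) η) := by
  obtain ⟨u, hu, hb⟩ := exists_summable_norm_bound (LmPos.injective m) (fun M => M.1.2)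
    (by positivity) (hasExpDecay_negEi_two_pi hv) isTemperedFamily_one hη.isCompact_supp
    hη.supp_subset
  obtain ⟨C, hC⟩ := exists_bound_ddc hη
  have h := hasSum_topIntegral (ι := LmPos m)
    (F := fun M z => (negEi (2 * Real.pi * v * R z M.mat) : ℂ) * ddc η z) hη.isCompact_supp
    hη.supp_subset (fun M z hz => by rw [ddc_eq_zero_of_notMem_supp hz, mul_zero])
    (fun M => (integrable_mul_ddc hη (integrableOn_negEi_comp_R hv (M.mat_ne_zero hm)
      hη.isCompact_supp hη.supp_subset)).integrableOn) (hu.mul_right C)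
    (hb.mono fun M hM z hz => by
      have h1 := hM z hz
      rw [smul_eq_mul, mul_one] at h1
      rw [norm_mul, Complex.norm_real]
      exact mul_le_mul h1 (hC z) (norm_nonneg _) ((norm_nonneg _).trans h1))
  convert h using 1
  · rfl
  refine topIntegral_congr fun z hz => ?_
  rw [Xi_eq_tsum hv hm hz, Complex.ofReal_tsum, tsum_mul_right]

lemma norm_wedge_le {α η : Form11} {z : ℂ × ℂ} {C : ℝ} (hC : ∀ j k, ‖η j k z‖ ≤ C) :
    ‖wedge α η z‖ ≤ (‖α 0 0 z‖ + ‖α 1 1 z‖ + ‖α 0 1 z‖ + ‖α 1 0 z‖) * C := by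
  have h : ∀ j k j' k', ‖α j k z * η j' k' z‖ ≤ ‖α j k z‖ * C := fun j k j' k' => by
    rw [norm_mul]
    exact mul_le_mul_of_nonneg_left (hC _ _) (norm_nonneg _)
  simp only [add_mul]
  exact (norm_sub_le _ _).trans (add_le_add ((norm_sub_le _ _).trans
    (add_le_add (norm_add_le_of_le (h _ _ _ _) (h _ _ _ _)) (h _ _ _ _))) (h _ _ _ _))

lemma exists_bound_form {η : Form11} (hη : η.IsTest) : ∃ C, ∀ j k z, ‖η j k z‖ ≤ C := by
  choose C hC using fun p : Fin 2 × Fin 2 =>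
    (hη p.1 p.2).2.1.exists_bound_of_continuous (hη p.1 p.2).1.continuous
  have h0 : ∀ p, 0 ≤ C p := fun p => (norm_nonneg _).trans (hC p 0)
  exact ⟨∑ p, C p, fun j k z => (hC (j, k) z).trans
    (Finset.single_le_sum (fun p _ => h0 p) (Finset.mem_univ (j, k)))⟩

lemma hasSum_formCurrent_schwartzForm {v : ℝ} (hv : 0 < v) (m : ℤ) {η : Form11}
    (hη : η.IsTest) :
    HasSum (fun M : LmPos m => formCurrent (schwartzForm v M.mat) η)
      (formCurrent (XiForm v m) η) := by
  choose u hu hb using fun j k => exists_summable_norm_bound (LmPos.injective m)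
    (fun M => M.1.2) (by positivity) (hasExpDecay_exp (2 * Real.pi * v))
    (isTemperedFamily_schwartzPoly v j k) hη.isCompact_supp hη.supp_subset
  simp_rw [← schwartzForm_eq] at hb
  obtain ⟨C, hC⟩ := exists_bound_form hη
  have hC0 : 0 ≤ C := (norm_nonneg _).trans (hC 0 0 0)
  have h := hasSum_topIntegral (ι := LmPos m)
    (F := fun M => wedge (schwartzForm v M.mat) η) hη.isCompact_supp
    hη.supp_subset (fun M z hz => by simp [wedge, Form11.eq_zero_of_notMem_supp hz])
    (fun M => (integrable_wedge (fun j k => (isSmooth_schwartzForm v M.mat j k).continuousOn)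
      hη).integrableOn)
    (((((hu 0 0).add (hu 1 1)).add (hu 0 1)).add (hu 1 0)).mul_right C) (by
      filter_upwards [hb 0 0, hb 1 1, hb 0 1, hb 1 0] with M h1 h2 h3 h4 z hz
      refine (norm_wedge_le fun j k => hC j k z).trans (mul_le_mul_of_nonneg_right ?_ hC0)
      exact add_le_add (add_le_add (add_le_add (h1 z hz) (h2 z hz)) (h3 z hz)) (h4 z hz))
  convert h using 1
  · rfl
  refine topIntegral_congr fun z hz => ?_
  have hs : ∀ j k, HasSum (fun M : LmPos m => schwartzForm v M.mat j k z) (XiForm v m j k z) :=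
    fun j k => (summable_schwartzForm hv m j k hz).hasSum
  exact (((((hs 0 0).mul_right _).add ((hs 1 1).mul_right _)).sub ((hs 0 1).mul_right _)).sub
    ((hs 1 0).mul_right _)).tsum_eq.symm

lemma curvePull_eq_zero {M : Matrix (Fin 2) (Fin 2) ℝ} {η : Form11} {w : ℂ}
    (h : (curveMap M w, w) ∉ η.supp) : curvePull M η w = 0 := by
  simp [curvePull, Form11.eq_zero_of_notMem_supp h]

lemma continuousOn_curvePull {M : Matrix (Fin 2) (Fin 2) ℝ} (hM : 0 < M.det) {η : Form11}
    (hη : η.IsTest) : ContinuousOn (curvePull M η) {w : ℂ | 0 < w.im} := fun w hw => by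
  have hc := continuousAt_curveMap hM.ne' hw
  have hd : ContinuousAt (deriv (curveMap M)) w := (analyticAt_curveMap hM.ne' hw).deriv.continuousAt
  have he : ∀ j k, ContinuousAt (fun w => η j k (curveMap M w, w)) w := fun j k =>
    ContinuousAt.comp (f := fun w => (curveMap M w, w)) (hη j k).1.continuous.continuousAt
      (hc.prodMk continuousAt_id)
  exact (((((he 0 0).mul (hd.mul hd.star)).add ((he 0 1).mul hd)).add
    ((he 1 0).mul hd.star)).add (he 1 1)).continuousWithinAt

lemma integrableOn_curvePull {M : Matrix (Fin 2) (Fin 2) ℝ} (hM : 0 < M.det) {η : Form11}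
    (hη : η.IsTest) : IntegrableOn (curvePull M η) {w : ℂ | 0 < w.im} := by
  have hK : IsCompact (Prod.snd '' η.supp) := hη.isCompact_supp.image continuous_snd
  have hKU : Prod.snd '' η.supp ⊆ {w : ℂ | 0 < w.im} := by
    rintro _ ⟨z, hz, rfl⟩
    exact (hη.supp_subset hz).2
  refine (((continuousOn_curvePull hM hη).mono hKU).integrableOn_compact
    hK).of_forall_sdiff_eq_zero isOpen_upper.measurableSet fun w hw => curvePull_eq_zero fun h =>
    hw.2 ⟨_, h, rfl⟩

lemma T_eq_empty {m : ℤ} (hm : m < 0) : T m = ∅ := by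
  ext z
  simp only [mem_empty_iff_false, iff_false]
  intro hz
  obtain ⟨M, hM⟩ := (mem_T_iff hm.ne hz.1).1 hz
  exact bilin_ne_zero (M.mat_ne_zero hm.ne) (by rw [M.det_mat]; exact_mod_cast hm.le) hz.1 hM

/-- As R = 0 on D_M, only the finitely many M with R < 1 somewhere on the support of η contribute.
Over almost every w the components have distinct points, so no branch is counted twice; for m < 0
everything is empty. -/
lemma hasSum_curveCurrent {m : ℤ} (hm : m ≠ 0) {η : Form11} (hη : η.IsTest) :
    HasSum (fun M : LmPos m => curveCurrent (DM M.mat) η) (curveCurrent (T m) η) := by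
  rcases hm.lt_or_gt with hneg | hpos
  · rw [T_eq_empty hneg, curveCurrent_empty]
    convert hasSum_zero with M
    rw [DM_eq_empty (M.mat_ne_zero hm) (by rw [M.det_mat]; exact_mod_cast hneg.le),
      curveCurrent_empty]
  have hdet : ∀ N : LmPos m, 0 < N.mat.det := fun N => by rw [N.det_mat]; exact_mod_cast hpos
  have hfin := finite_exists_R_lt (LmPos.injective m) (fun M => M.1.2) hη.isCompact_supp
    hη.supp_subset 1
  have h0 : ∀ M ∉ hfin.toFinset, ∀ w : ℂ, 0 < w.im → curvePull M.mat η w = 0 :=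
    fun M hM w hw => curvePull_eq_zero fun h => hM (hfin.mem_toFinset.2 ⟨_, h, by
      have h1 := ((mem_DM_iff (hdet M) (z := (curveMap M.mat w, w)) hw).2 rfl).2
      change R (curveMap M.mat w, w) M.mat < 1
      rw [h1]
      exact one_pos⟩)
  have hT : curveCurrent (T m) η = ∑ M ∈ hfin.toFinset, curveCurrent (DM M.mat) η := by
    simp_rw [fun M : LmPos m => curveCurrent_DM_of_pos (hdet M) η]
    rw [← integral_finsetSum _ fun M _ => (integrableOn_curvePull (hdet M) hη).const_mul _,
      curveCurrent]
    refine setIntegral_congr_ae isOpen_upper.measurableSet ?_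
    filter_upwards [ae_curveMap_ne hpos.ne'] with w hgen hw
    rw [tsum_branches_T hpos η hw (hgen hw), tsum_eq_sum fun M hM => h0 M hM w hw,
      Finset.mul_sum]
  rw [hT]
  refine hasSum_sum_of_ne_finset_zero fun M hM => ?_
  rw [curveCurrent_DM_of_pos (hdet M)]
  exact setIntegral_eq_zero_of_forall_eq_zero fun w hw => by rw [h0 M hM w hw, mul_zero]

/-- The current equation for `Ξ(v, z, m)`. -/
theorem ddcCurrent_Xi_add_curveCurrent {v : ℝ} (hv : 0 < v) {m : ℤ} (hm : m ≠ 0) {η : Form11}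
    (hη : η.IsTest) :
    ddcCurrent (Xi v m) η + curveCurrent (T m) η = formCurrent (XiForm v m) η := by
  have h := (hasSum_ddcCurrent_negEi hv hm hη).add (hasSum_curveCurrent hm hη)
  simp_rw [fun M : LmPos m => ddcCurrent_negEi_add_curveCurrent (M.mat_ne_zero hm) hv hη] at h
  exact h.unique (hasSum_formCurrent_schwartzForm hv m hη)

/-! ### Smoothness and the logarithmic singularity of `Ξ` -/

lemma contDiffOn_negEi_comp_R {v : ℝ} (hv : 0 < v) {M : Matrix (Fin 2) (Fin 2) ℝ}
    {s : Set (ℂ × ℂ)} (hs : s ⊆ HH) (h : ∀ z ∈ s, bilin M z.1 z.2 ≠ 0) :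
    ContDiffOn ℝ ∞ (fun z => negEi (2 * Real.pi * v * R z M)) s := by
  refine contDiffOn_negEi.comp (contDiffOn_const.mul ((contDiffOn_R M).mono hs)) fun z hz => ?_
  have := (R_pos_iff (hs hz) M).2 (h z hz)
  have := Real.pi_pos
  exact (by positivity : 0 < 2 * Real.pi * v * R z M)

lemma contDiffOn_log_div {a : ℝ} (ha : 0 < a) :
    ContDiffOn ℝ ∞ (fun z : ℂ × ℂ => Real.log (a / (2 * z.1.im * z.2.im))) HH := by
  have h1 : ContDiff ℝ ∞ fun z : ℂ × ℂ => z.1.im := Complex.imCLM.contDiff.comp contDiff_fst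
  have h2 : ContDiff ℝ ∞ fun z : ℂ × ℂ => z.2.im := Complex.imCLM.contDiff.comp contDiff_snd
  have h0 : ∀ z ∈ HH, 0 < 2 * z.1.im * z.2.im := fun z hz =>
    mul_pos (mul_pos two_pos hz.1) hz.2
  exact (contDiffOn_const.div ((contDiff_const.mul h1).mul h2).contDiffOn
    fun z hz => (h0 z hz).ne').log fun z hz => (div_pos ha (h0 z hz)).ne'

lemma Xi_eq_sum_add_tsum {v : ℝ} (hv : 0 < v) {m : ℤ} (hm : m ≠ 0) (S : Finset (LmPos m))
    {z : ℂ × ℂ} (hz : z ∈ HH) : Xi v m z = ∑ M ∈ S, negEi (2 * Real.pi * v * R z M.mat)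
      + ∑' M : {M // M ∉ S}, negEi (2 * Real.pi * v * R z M.1.mat) := by
  rw [Xi_eq_tsum hv hm hz]
  exact ((summable_negEi_LmPos hv m hz).sum_add_tsum_subtype_compl S).symm

lemma contDiffOn_tsum_negEi {v : ℝ} (hv : 0 < v) {m : ℤ} {S : Finset (LmPos m)}
    {K U : Set (ℂ × ℂ)} (hK : IsCompact K) (hKH : K ⊆ HH) (hU : IsOpen U) (hUK : U ⊆ K)
    (h1 : ∀ M ∉ S, ∀ z ∈ K, 1 ≤ R z M.mat) :
    ContDiffOn ℝ ∞ (fun z => ∑' M : {M // M ∉ S}, negEi (2 * Real.pi * v * R z M.1.mat)) U := by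
  have hc := contDiffOn_tsum_notMem (by positivity) (hasExpDecay_negEi_two_pi hv)
    isTemperedFamily_one hK hKH hU hUK h1
  simp only [smul_eq_mul, mul_one] at hc
  exact hc

lemma contDiffOn_Xi {v : ℝ} (hv : 0 < v) {m : ℤ} (hm : m ≠ 0) :
    ContDiffOn ℝ ∞ (Xi v m) (HH \ T m) := fun z₀ hz₀ => by
  obtain ⟨S₀, S₁, K, U, hK, hKH, hU, hUK, hzU, -, h0, h1, h2⟩ :=
    exists_local_data (m := m) hz₀.1
  -- Off T(m) no component passes through z₀, so every term is smooth near it.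
  have hS₀ : ∀ M, M ∉ S₀ := fun M hM => hz₀.2 ((mem_T_iff hm hz₀.1).2 ⟨M, h0 M hM⟩)
  have hc : ContDiffOn ℝ ∞ (Xi v m) U :=
    ((ContDiffOn.sum (s := S₁) fun M _ => contDiffOn_negEi_comp_R hv (hUK.trans hKH)
      (h2 M (hS₀ M))).add (contDiffOn_tsum_negEi hv hK hKH hU hUK h1)).congr
      fun z hz => Xi_eq_sum_add_tsum hv hm S₁ (hKH (hUK hz))
  exact (hc.contDiffAt (hU.mem_nhds hzU)).contDiffWithinAt

/-- The product of the equations of finitely many components is a reduced equation. -/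
lemma isReducedEquation_prod {m : ℤ} (hm : m ≠ 0) {S : Finset (LmPos m)} {U : Set (ℂ × ℂ)}
    (hU : IsOpen U) (hUH : U ⊆ HH) (h : ∀ M ∉ S, ∀ z ∈ U, bilin M.mat z.1 z.2 ≠ 0) :
    IsReducedEquation (T m) U fun z => ∏ M ∈ S, bilin M.mat z.1 z.2 := by
  classical
  have hdiff : Differentiable ℂ fun z : ℂ × ℂ => ∏ M ∈ S, bilin M.mat z.1 z.2 := fun z => by
    have hb : ∀ M ∈ S, DifferentiableAt ℂ (fun z : ℂ × ℂ => bilin M.mat z.1 z.2) z :=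
      fun M _ => by
        unfold bilin
        fun_prop
    exact (HasFDerivAt.finsetProd fun M hM => (hb M hM).hasFDerivAt).differentiableAt
  have hmem : ∀ z ∈ U, (z ∈ T m ↔ ∃ M ∈ S, bilin M.mat z.1 z.2 = 0) := fun z hz => by
    rw [mem_T_iff hm (hUH hz)]
    refine ⟨fun ⟨M, hM⟩ => ⟨M, ?_, hM⟩, fun ⟨M, _, hM⟩ => ⟨M, hM⟩⟩
    by_contra hMS
    exact h M hMS z hz hM
  refine ⟨hdiff.differentiableOn, fun z hz => ?_, fun z hz => ?_⟩
  · rw [hmem z hz, Finset.prod_eq_zero_iff]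
  rcases hm.lt_or_gt with hneg | hpos
  · rw [T_eq_empty hneg] at hz
    exact hz.1.elim
  have hdet : ∀ N : LmPos m, 0 < N.mat.det := fun N => by rw [N.det_mat]; exact_mod_cast hpos
  obtain ⟨M, hMS, hM⟩ := (hmem z hz.2).1 hz.1
  have hd : ∀ (N : LmPos m) {w : ℂ}, 0 < w.im → curveDenom N.mat w ≠ 0 := fun N _ hw =>
    curveDenom_ne_zero (hdet N).ne' hw
  have hz2 : 0 < z.2.im := (hUH hz.2).2
  rw [bilin_eq_mul (hd M hz2), mul_eq_zero, or_iff_right (hd M hz2), sub_eq_zero] at hM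
  have hz' : (curveMap M.mat z.2, z.2) = z := Prod.ext hM.symm rfl
  have hc : Tendsto (fun w => (curveMap M.mat w, w)) (𝓝 z.2) (𝓝 z) := by
    have := (continuousAt_curveMap (hdet M).ne' hz2).prodMk continuousAt_id
    rwa [ContinuousAt, id, hz'] at this
  -- A set of full measure is dense, so the given point is a limit of points of the same component
  -- lying on no other component. There the differential must not vanish.
  have hfreq : ∃ᶠ w in 𝓝 z.2, 0 < w.im → ∀ M N : LmPos m, M ≠ N →
      curveMap M.mat w ≠ curveMap N.mat w :=
    mem_closure_iff_frequently.1 (Measure.dense_of_ae (ae_curveMap_ne hm) z.2)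
  refine mem_closure_of_frequently_of_tendsto ((hfreq.and_eventually
    ((isOpen_upper.eventually_mem hz2).and (hc.eventually (hU.mem_nhds hz.2)))).mono ?_) hc
  rintro w ⟨hgen, hw, hwU⟩
  refine ⟨⟨(hmem _ hwU).2 ⟨M, hMS, ?_⟩, hwU⟩, fun hzero => ?_⟩
  · simp only
    rw [bilin_eq_mul (hd M hw), sub_self, mul_zero]
  -- The derivative in the z₁ direction is computed twice: it would be 0 if the differential
  -- vanished, but the product rule leaves (dw - c) times the values of the other factors, all
  -- nonzero.
  have e1 : HasDerivAt (fun t : ℂ => ∏ N ∈ S, bilin N.mat t w) 0 (curveMap M.mat w) := by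
    have h1 : HasDerivAt (fun t : ℂ => (t, w)) (1, 0) (curveMap M.mat w) :=
      (hasDerivAt_id _).prodMk (hasDerivAt_const _ _)
    have h2 := (hdiff (curveMap M.mat w, w)).hasFDerivAt
    rw [hzero] at h2
    exact HasFDerivAt.comp_hasDerivAt (f := fun t : ℂ => (t, w)) _ h2 h1
  have e2 : HasDerivAt (fun t : ℂ => ∏ N ∈ S, bilin N.mat t w)
      (curveDenom M.mat w * ∏ N ∈ S.erase M, bilin N.mat (curveMap M.mat w) w)
      (curveMap M.mat w) := by
    have h3 : (fun t : ℂ => ∏ N ∈ S, bilin N.mat t w) = fun t =>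
        (curveDenom M.mat w * (t - curveMap M.mat w)) * ∏ N ∈ S.erase M, bilin N.mat t w := by
      funext t
      rw [← Finset.mul_prod_erase S _ hMS, bilin_eq_mul (hd M hw)]
    have h4 : DifferentiableAt ℂ (fun t : ℂ => ∏ N ∈ S.erase M, bilin N.mat t w)
        (curveMap M.mat w) := by
      unfold bilin
      fun_prop
    rw [h3]
    refine ((((hasDerivAt_id _).sub_const _).const_mul _).mul h4.hasDerivAt).congr_deriv ?_
    simp
  have e3 := e2.unique e1
  refine mul_ne_zero (hd M hw) (Finset.prod_ne_zero_iff.2 fun N hN => ?_) e3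
  rw [bilin_eq_mul (hd N hw)]
  exact mul_ne_zero (hd N hw) (sub_ne_zero.2 (hgen hw M N (Finset.ne_of_mem_erase hN).symm))

/-- `Ξ(v, z, m) = -log |f|² + smooth` near each point of `ℍ × ℍ`. -/
theorem exists_log_singularity {v : ℝ} (hv : 0 < v) {m : ℤ} (hm : m ≠ 0) {z₀ : ℂ × ℂ}
    (hz₀ : z₀ ∈ HH) : ∃ U ⊆ HH, IsOpen U ∧ z₀ ∈ U ∧
    ∃ f : ℂ × ℂ → ℂ, IsReducedEquation (T m) U f ∧
      ∃ u : ℂ × ℂ → ℝ, ContDiffOn ℝ ∞ u U ∧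
        ∀ z ∈ U \ T m, Xi v m z = -Real.log (‖f z‖ ^ 2) + u z := by
  classical
  have hpi := Real.pi_pos
  obtain ⟨S₀, S₁, K, U, hK, hKH, hU, hUK, hzU, h01, -, h1, h2⟩ :=
    exists_local_data (m := m) hz₀
  obtain ⟨c, hc⟩ := exists_negEi_eq
  have hUH : U ⊆ HH := hUK.trans hKH
  -- The equation is the product over the components through z₀. The smooth part collects what
  -- remains of those terms after removing -log|f|², the other terms with small R, which have no
  -- zeros on U, and the tail.
  refine ⟨U, hUH, hU, hzU, _, isReducedEquation_prod hm hU hUH h2, fun z =>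
    ∑ M ∈ S₀, (c - Real.log (2 * Real.pi * v / (2 * z.1.im * z.2.im))
        + ein (2 * Real.pi * v * R z M.mat))
      + ∑ M ∈ S₁ \ S₀, negEi (2 * Real.pi * v * R z M.mat)
      + ∑' M : {M // M ∉ S₁}, negEi (2 * Real.pi * v * R z M.1.mat), ?_, fun z hz => ?_⟩
  · refine (ContDiffOn.add (ContDiffOn.sum fun M _ => ?_) (ContDiffOn.sum fun M hM => ?_)).add
      (contDiffOn_tsum_negEi hv hK hKH hU hUK h1)
    · exact (contDiffOn_const.sub ((contDiffOn_log_div (by positivity)).mono hUH)).add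
        (contDiff_ein.comp_contDiffOn (contDiffOn_const.mul ((contDiffOn_R M.mat).mono hUH)))
    · exact contDiffOn_negEi_comp_R hv hUH (h2 M (Finset.mem_sdiff.1 hM).2)
  · have hzH := hUH hz.1
    have hb : ∀ M : LmPos m, bilin M.mat z.1 z.2 ≠ 0 := fun M hM =>
      hz.2 ((mem_T_iff hm hzH).2 ⟨M, hM⟩)
    have hy : 0 < 2 * z.1.im * z.2.im := mul_pos (mul_pos two_pos hzH.1) hzH.2
    have hlog : ∀ M : LmPos m, negEi (2 * Real.pi * v * R z M.mat)
        = -Real.log (‖bilin M.mat z.1 z.2‖ ^ 2)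
          + (c - Real.log (2 * Real.pi * v / (2 * z.1.im * z.2.im))
            + ein (2 * Real.pi * v * R z M.mat)) := fun M => by
      have hR := (R_pos_iff hzH M.mat).2 (hb M)
      have hn : 0 < ‖bilin M.mat z.1 z.2‖ := norm_pos_iff.2 (hb M)
      have e : 2 * Real.pi * v * R z M.mat
          = ‖bilin M.mat z.1 z.2‖ ^ 2 * (2 * Real.pi * v / (2 * z.1.im * z.2.im)) := by
        rw [R_eq]
        ring
      have h3 : Real.log (2 * Real.pi * v * R z M.mat) = Real.log (‖bilin M.mat z.1 z.2‖ ^ 2)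
          + Real.log (2 * Real.pi * v / (2 * z.1.im * z.2.im)) := by
        rw [e, Real.log_mul (by positivity) (by positivity)]
      rw [hc _ (by positivity), h3]
      ring
    have hprod : Real.log (‖∏ M ∈ S₀, bilin M.mat z.1 z.2‖ ^ 2)
        = ∑ M ∈ S₀, Real.log (‖bilin M.mat z.1 z.2‖ ^ 2) := by
      rw [norm_prod, ← Finset.prod_pow]
      exact Real.log_prod fun M _ => pow_ne_zero 2 (norm_ne_zero_iff.2 (hb M))
    rw [Xi_eq_sum_add_tsum hv hm S₁ hzH, ← Finset.sum_sdiff h01,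
      Finset.sum_congr rfl fun M (_ : M ∈ S₀) => hlog M, Finset.sum_add_distrib,
      Finset.sum_neg_distrib, hprod]
    ring

theorem isGreenFunction_Xi {v : ℝ} (hv : 0 < v) {m : ℤ} (hm : m ≠ 0) :
    IsGreenFunction (T m) (Xi v m) where
  invariant_divisor γ _ hz := act_mem_T_iff hm γ hz
  invariant γ _ hz := Xi_act v γ hz.1
  smooth := contDiffOn_Xi hv hm
  log_singularity _ hz₀ := exists_log_singularity hv hm hz₀
  locallyIntegrable := locallyIntegrableOn_Xi hv hm
  current_equation := ⟨XiForm v m, isSmooth_XiForm hv m, isInvariant_XiForm hv hm,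
    fun _ hη => ddcCurrent_Xi_add_curveCurrent hv hm hη⟩

end KudlaGreen

end

theorem mainTheorem12 :
    (∀ M : Matrix (Fin 2) (Fin 2) ℝ, M ≠ 0 →
      MeasureTheory.LocallyIntegrableOn (fun z => KudlaGreen.xi z M) KudlaGreen.HH ∧
      ∀ η : KudlaGreen.Form11, η.IsTest →
        KudlaGreen.ddcCurrent (fun z => KudlaGreen.xi z M) η
          + ((Real.exp (-Real.pi * KudlaGreen.quad M) : ℝ) : ℂ)
            * KudlaGreen.curveCurrent (KudlaGreen.DM M) η
          = KudlaGreen.formCurrent (KudlaGreen.phiKudla M) η) ∧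
    (∀ m : ℤ, m ≠ 0 → ∀ v : ℝ, 0 < v →
      (∀ z ∈ KudlaGreen.HH \ KudlaGreen.T m,
        Summable fun M : KudlaGreen.Lm m => KudlaGreen.XiTerm v z M.1) ∧
      KudlaGreen.IsGreenFunction (KudlaGreen.T m) (KudlaGreen.Xi v m)) := by
  exact ⟨fun _ hM => KudlaGreen.xi_current hM, fun m hm _ hv =>
    ⟨fun _ hz => KudlaGreen.summable_XiTerm hv m hz.1, KudlaGreen.isGreenFunction_Xi hv hm⟩⟩
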